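/- **Setting.** Let $\mathcal P^m(\mathbb R^n)$ be the ring of $m$-jets at the origin of $C^m$ functions on $\mathbb R^n$, identified with real polynomials of degree at most $m$, multiplied modulo terms of degree greater than $m$. For $F\in C^m(\mathbb R^n)$ let $J^m(F)$ be its $m$-th degree Taylor polynomial at the origin, and let $\mathcal P_0^m(\mathbb R^n)\subset\mathcal P^m(\mathbb R^n)$ be the jets vanishing at the origin. An ideal $I\lhd\mathcal P_0^m(\mathbb R^n)$ is an ideal of $\mathcal P^m(\mathbb R^n)$ contained in $\mathcal P_0^m(\mathbb R^n)$, and $\langle p_1,\dots,p_k\rangle_m$ is the ideal generated by $p_1,\dots,p_k$. For $\vec 0\in E\subset\mathbb R^n$ put $$I^m(E):=\{J^m(F)\;|\;F\in C^m(\mathbb R^n),\ F=0\text{ on }E\}.$$ *Equivalence.* Ideals $I,I'\lhd\mathcal P_0^m(\mathbb R^n)$ are equivalent if there is a $C^m$-diffeomorphism $\phi:\mathbb R^n\to\mathbb R^n$ with $\phi(\vec 0)=\vec 0$ such that $I'=\{J^m(p\circ\phi)\;|\;p\in I\}$. *Closed ideals.* For $\omega\in S^{n-1}$ and $\delta,r>0$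 let $\Gamma(\omega,\delta,r)=\{\vec x:0<|\vec x|<r,\ |\vec x/|\vec x|-\omega|<\delta\}$, and for $K\ge1$ let $\mathrm{Ann}_K(r)=\{\vec x:r/K<|\vec x|<Kr\}$. A direction $\omega\in S^{n-1}$ is forbidden for $I$ if there are $p_1,\dots,p_L\in I$ and $c,\delta,r>0$ with $|p_1(\vec x)|+\dots+|p_L(\vec x)|>c|\vec x|^m$ for all $\vec x\in\Gamma(\omega,\delta,r)$. Let $\mathrm{Allow}(I)\subset S^{n-1}$ be the set of directions that are not forbidden. The ideal $I$ implies $p\in\mathcal P_0^m(\mathbb R^n)$ if there exist $A>0$ and $Q_1,\dots,Q_L\in I$ such that for every $\epsilon>0$ there exist $\delta,r>0$ such that for every $0<\rho\le r$ there are $F,S_1,\dots,S_L\in C^m(\mathrm{Ann}_4(\rho))$ satisfying - $|\partial^\alpha F(\vec x)|\le\epsilon\rho^{m-|\alpha|}$ and $|\partial^\alpha S_l(\vec x)|\le A\rho^{-|\alpha|}$ for all $\vec x\in\mathrm{Ann}_4(\rho)$, $|\alpha|\le m$ and $1\le l\le L$; - $p(\vec x)=F(\vec x)+S_1(\vec x)Q_1(\vec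 x)+\dots+S_L(\vec x)Q_L(\vec x)$ for all $\vec x\in\mathrm{Ann}_2(\rho)$ with $\mathrm{dist}(\vec x/|\vec x|,\mathrm{Allow}(I))<\delta$ (where $\mathrm{dist}(\cdot,\emptyset)=+\infty$). The ideal $I$ is closed if it equals the set of all jets in $\mathcal P_0^m(\mathbb R^n)$ that it implies. **Theorem 1.4.** Let $(x,y)$ be the standard coordinates on $\mathbb R^2$. Every closed ideal of $\mathcal P_0^3(\mathbb R^2)$ is equivalent to one of the following 15 ideals: - $\{0\},\ \langle x\rangle_3,\ \langle x^2\rangle_3,\ \langle x^3\rangle_3,\ \langle xy\rangle_3,\ \langle yx^2\rangle_3,\ \langle xy(x+y)\rangle_3,\ \langle x^2-y^3\rangle_3$; - $\langle x^2,xy\rangle_3,\ \langle x^2,xy^2\rangle_3,\ \langle x^2y,xy^2\rangle_3,\ \langle x^3,x^2y\rangle_3,\ \langle x^2-y^3,xy^2\rangle_3,\ \mathcal P_0^3(\mathbb R^2)$; - $\langle x^3,x^2y,xy^2\rangle_3$. Moreover, each of these 15 ideals is equal to $I^3(E)$ for some semi-algebraic set $E\subset\mathbb R^2$ that contains the origin,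 and any two different ideals in the list are non-equivalent. -/

import Mathlib

noncomputable section

namespace ClosedJetIdeals

/-- The ring `𝒫^m(ℝⁿ)` of `m`-jets at the origin: real polynomials in `n` variables modulo
those all of whose monomials have degree greater than `m`. -/
abbrev JetRing (m n : ℕ) : Type :=
  MvPolynomial (Fin n) ℝ ⧸ (MvPolynomial.idealOfVars (Fin n) ℝ) ^ (m + 1)

/-- The jet represented by a polynomial. -/
abbrev toJet (m : ℕ) {n : ℕ} : MvPolynomial (Fin n) ℝ →+* JetRing m n :=
  Ideal.Quotient.mk _

/-- The sum of the terms of degree at most `m` of a polynomial. -/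
def truncPoly (m : ℕ) {n : ℕ} (p : MvPolynomial (Fin n) ℝ) : MvPolynomial (Fin n) ℝ :=
  ∑ k ∈ Finset.range (m + 1), MvPolynomial.homogeneousComponent k p

theorem truncPoly_eq_of_toJet_eq {m n : ℕ} {p q : MvPolynomial (Fin n) ℝ}
    (h : toJet m p = toJet m q) : truncPoly m p = truncPoly m q := by
  have h' : p - q ∈ (MvPolynomial.idealOfVars (Fin n) ℝ) ^ (m + 1) := Ideal.Quotient.eq.mp h
  rw [MvPolynomial.mem_pow_idealOfVars_iff'] at h'
  refine Finset.sum_congr rfl fun k hk => ?_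
  ext d
  rw [MvPolynomial.coeff_homogeneousComponent, MvPolynomial.coeff_homogeneousComponent]
  split_ifs with hd
  · have hx := h' d (by rw [hd]; exact Finset.mem_range.mp hk)
    rw [MvPolynomial.coeff_sub] at hx
    exact sub_eq_zero.mp hx
  · rfl

/-- The polynomial of degree at most `m` that a jet is identified with. -/
def jetPoly {m n : ℕ} (p : JetRing m n) : MvPolynomial (Fin n) ℝ :=
  Quotient.lift (truncPoly m) (fun _ _ h => truncPoly_eq_of_toJet_eq (Quotient.sound h)) p

theorem jetPoly_toJet {m n : ℕ} (p : MvPolynomial (Fin n) ℝ) :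
    jetPoly (toJet m p) = truncPoly m p := rfl

/-- The value `p(x)` of a jet, regarded as a polynomial of degree at most `m`. -/
def jetEval {m n : ℕ} (p : JetRing m n) (x : EuclideanSpace ℝ (Fin n)) : ℝ :=
  MvPolynomial.eval (fun i => x i) (jetPoly p)

/-- `𝒫₀^m(ℝⁿ)`: the jets that vanish at the origin, as an ideal of `𝒫^m(ℝⁿ)`. -/
def jetsAtZero (m n : ℕ) : Ideal (JetRing m n) :=
  (MvPolynomial.idealOfVars (Fin n) ℝ).map (toJet m)

/-- The ideal `⟨p : p ∈ s⟩_m` generated by the jets of the polynomials in `s`. -/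
def jetSpan (m : ℕ) {n : ℕ} (s : Set (MvPolynomial (Fin n) ℝ)) : Ideal (JetRing m n) :=
  Ideal.span (toJet m '' s)

/-- The partial derivative `∂f/∂x_i`. -/
def partialD {n : ℕ} (i : Fin n) (f : EuclideanSpace ℝ (Fin n) → ℝ) :
    EuclideanSpace ℝ (Fin n) → ℝ :=
  fun x => fderiv ℝ f x (EuclideanSpace.single i 1)

/-- `∂^α f = ∂₁^{α₁} ∂₂^{α₂} ⋯ ∂ₙ^{αₙ} f`, for a multi-index `α`. -/
def multiD {n : ℕ} (α : Fin n →₀ ℕ) (f : EuclideanSpace ℝ (Fin n) → ℝ) :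
    EuclideanSpace ℝ (Fin n) → ℝ :=
  (List.finRange n).foldr (fun i g => (partialD i)^[α i] g) f

/-- `J^m(F)`: the Taylor polynomial `∑_{|α| ≤ m} ∂^α F(0) / α! · x^α`, as a jet
(meaningful for `F` of class `C^m`). -/
def jetOf (m : ℕ) {n : ℕ} (F : EuclideanSpace ℝ (Fin n) → ℝ) : JetRing m n :=
  toJet m (∑ k ∈ Finset.range (m + 1), ∑ α ∈ Finset.finsuppAntidiag Finset.univ k,
    MvPolynomial.monomial α (multiD α F 0 / ∏ i, ((α i).factorial : ℝ)))

/-- `I^m(E)`: the `m`-jets of the `C^m` functions on `ℝⁿ` that vanish on `E`. -/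
def vanishingJets (m : ℕ) {n : ℕ} (E : Set (EuclideanSpace ℝ (Fin n))) : Set (JetRing m n) :=
  {p | ∃ F : EuclideanSpace ℝ (Fin n) → ℝ, ContDiff ℝ m F ∧ (∀ x ∈ E, F x = 0) ∧ jetOf m F = p}

/-- Semi-algebraic subsets of `ℝⁿ`: those described by finitely many polynomial equations and
inequalities and boolean operations. -/
inductive IsSemialgebraic {n : ℕ} : Set (EuclideanSpace ℝ (Fin n)) → Prop
  | eq_zero (p : MvPolynomial (Fin n) ℝ) :
      IsSemialgebraic {x | MvPolynomial.eval (fun i => x i) p = 0}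
  | pos (p : MvPolynomial (Fin n) ℝ) :
      IsSemialgebraic {x | 0 < MvPolynomial.eval (fun i => x i) p}
  | compl {s : Set (EuclideanSpace ℝ (Fin n))} : IsSemialgebraic s → IsSemialgebraic sᶜ
  | union {s t : Set (EuclideanSpace ℝ (Fin n))} :
      IsSemialgebraic s → IsSemialgebraic t → IsSemialgebraic (s ∪ t)
  | inter {s t : Set (EuclideanSpace ℝ (Fin n))} :
      IsSemialgebraic s → IsSemialgebraic t → IsSemialgebraic (s ∩ t)

/-- The cone `Γ(ω, δ, r)`. -/
def cone {n : ℕ} (ω : EuclideanSpace ℝ (Fin n)) (δ r : ℝ) : Set (EuclideanSpace ℝ (Fin n)) :=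
  {x | 0 < ‖x‖ ∧ ‖x‖ < r ∧ dist (‖x‖⁻¹ • x) ω < δ}

/-- The annulus `Ann_K(r)`. -/
def annulus (n : ℕ) (K r : ℝ) : Set (EuclideanSpace ℝ (Fin n)) :=
  {x | r / K < ‖x‖ ∧ ‖x‖ < K * r}

/-- `ω` is a forbidden direction of the jets `p_1, …, p_L`. -/
def IsForbiddenFor {m n L : ℕ} (p : Fin L → JetRing m n) (ω : EuclideanSpace ℝ (Fin n)) : Prop :=
  ∃ c > 0, ∃ δ > 0, ∃ r > 0, ∀ x ∈ cone ω δ r, c * ‖x‖ ^ m < ∑ l, |jetEval (p l) x|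

/-- `Forb(I)`: the directions that are forbidden for some finite family of jets in `I`. -/
def forb {m n : ℕ} (I : Ideal (JetRing m n)) : Set (EuclideanSpace ℝ (Fin n)) :=
  {ω | ‖ω‖ = 1 ∧ ∃ (L : ℕ) (p : Fin L → JetRing m n), (∀ l, p l ∈ I) ∧ IsForbiddenFor p ω}

/-- `Allow(I)`: the directions that are not forbidden. -/
def allow {m n : ℕ} (I : Ideal (JetRing m n)) : Set (EuclideanSpace ℝ (Fin n)) :=
  {ω | ‖ω‖ = 1 ∧ ω ∉ forb I}

/-- The ideal `I` implies the jet `p`. The condition `∃ ω ∈ allow I, dist (x/|x|) ω < δ` says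
`dist(x/|x|, Allow(I)) < δ`, where the distance to the empty set is `+∞`. -/
def Implies {m n : ℕ} (I : Ideal (JetRing m n)) (p : JetRing m n) : Prop :=
  ∃ A > (0 : ℝ), ∃ (L : ℕ) (Q : Fin L → JetRing m n), (∀ l, Q l ∈ I) ∧
    ∀ ε > (0 : ℝ), ∃ δ > (0 : ℝ), ∃ r > (0 : ℝ), ∀ ρ : ℝ, 0 < ρ → ρ ≤ r →
      ∃ (F : EuclideanSpace ℝ (Fin n) → ℝ) (S : Fin L → EuclideanSpace ℝ (Fin n) → ℝ),
        ContDiffOn ℝ m F (annulus n 4 ρ) ∧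
        (∀ l, ContDiffOn ℝ m (S l) (annulus n 4 ρ)) ∧
        (∀ x ∈ annulus n 4 ρ, ∀ α : Fin n →₀ ℕ, α.degree ≤ m →
          |multiD α F x| ≤ ε * ρ ^ (m - α.degree)) ∧
        (∀ x ∈ annulus n 4 ρ, ∀ α : Fin n →₀ ℕ, α.degree ≤ m → ∀ l,
          |multiD α (S l) x| ≤ A * (ρ ^ α.degree)⁻¹) ∧
        ∀ x ∈ annulus n 2 ρ, (∃ ω ∈ allow I, dist (‖x‖⁻¹ • x) ω < δ) →
          jetEval p x = F x + ∑ l, S l x * jetEval (Q l) x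

/-- The implication-closure `cl(I)`. -/
def implicationClosure {m n : ℕ} (I : Ideal (JetRing m n)) : Set (JetRing m n) :=
  {p | p ∈ jetsAtZero m n ∧ Implies I p}

/-- `I` is a closed ideal of `𝒫₀^m(ℝⁿ)`: it is contained in `𝒫₀^m(ℝⁿ)` and `I = cl(I)`. -/
def IsClosedIdeal {m n : ℕ} (I : Ideal (JetRing m n)) : Prop :=
  I ≤ jetsAtZero m n ∧ (I : Set (JetRing m n)) = implicationClosure I

/-- `I` and `I'` are equivalent: for some `C^m`-diffeomorphism `φ` of `ℝⁿ` that fixes the origin,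
`I'` is the image of `I` under `p ↦ J^m(p ∘ φ)`. -/
def Equivalent {m n : ℕ} (I I' : Ideal (JetRing m n)) : Prop :=
  ∃ φ : EuclideanSpace ℝ (Fin n) ≃ EuclideanSpace ℝ (Fin n),
    ContDiff ℝ m φ ∧ ContDiff ℝ m φ.symm ∧ φ 0 = 0 ∧
    (I' : Set (JetRing m n)) =
      (fun p : JetRing m n => jetOf m (jetEval p ∘ φ)) '' (I : Set (JetRing m n))

/-- The coordinate `x` on `ℝ²`, as a polynomial. -/
abbrev x : MvPolynomial (Fin 2) ℝ := MvPolynomial.X 0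

/-- The coordinate `y` on `ℝ²`, as a polynomial. -/
abbrev y : MvPolynomial (Fin 2) ℝ := MvPolynomial.X 1

/-- The fifteen model ideals of `𝒫₀³(ℝ²)`. -/
def models : Fin 15 → Ideal (JetRing 3 2) :=
  ![⊥,
    jetSpan 3 {x},
    jetSpan 3 {x ^ 2},
    jetSpan 3 {x ^ 3},
    jetSpan 3 {x * y},
    jetSpan 3 {y * x ^ 2},
    jetSpan 3 {x * y * (x + y)},
    jetSpan 3 {x ^ 2 - y ^ 3},
    jetSpan 3 {x ^ 2, x * y},
    jetSpan 3 {x ^ 2, x * y ^ 2},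
    jetSpan 3 {x ^ 2 * y, x * y ^ 2},
    jetSpan 3 {x ^ 3, x ^ 2 * y},
    jetSpan 3 {x ^ 2 - y ^ 3, x * y ^ 2},
    jetsAtZero 3 2,
    jetSpan 3 {x ^ 3, x ^ 2 * y, x * y ^ 2}]

end ClosedJetIdeals

end

/-! A 3-jet in two variables is a cubic polynomial, so most of the argument is algebra with ten real
coefficients. Analysis enters twice: the jet of a C³ function is the unique cubic that approximates
it up to o(|v|³), and closedness of an ideal permits a division.

Classification. Closedness is used only through `IsClosedIdeal.isSaturated`. Suppose w·p = u·q with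
q in I, with u and w smooth and homogeneous of the same degree, and with w vanishing only in
forbidden directions. Then p = (u/w)·q near the allowed directions. The factor u/w has degree zero,
so its derivatives obey the scale-invariant bounds in the definition of implication, and p lies in
I. In particular an ideal for which every direction is forbidden is the whole of 𝒫₀. So if no jet of
I has a linear part, some direction is not forbidden in the sense of `Repels`. All leading forms
vanish there, which removes coefficients.

The ideals are sorted by their lowest-order jets. Order one: a change of coordinates puts x in I,
and I is ⟨x⟩ or everything (`isClassified_of_linear_mem`). Order two: a definite quadratic part
would forbid all directions. An indefinite one is normalised to xy (`isClassified_of_xy_add_mem`), a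
degenerate one to x² (`isClassified_of_sq_add_mem`). The remaining cubic terms are removed by ideal
members, quadratic shears and scalings. Saturation and `repels_of_cusp` exclude the configurations
that are not in the list. Order three: I is a space of binary cubic forms with a common real zero,
sorted by further common zeros and by dimension (`isClassified_of_noQuadratic`).

Realisation. Each model is the vanishing ideal of explicit lines, parabolas and cusps. A generator
belongs to it because on E it agrees with a C³ function that is o(|v|³), often a power of √y or
√(-y). Conversely, Taylor expansion along the curves, and along differences of two or three
neighbouring curves, forces the remaining coefficients to vanish.

Non-equivalence. A diffeomorphism induces a ring automorphism of the jets, and `invariantKey` is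
built from ring-theoretic properties that separate the fifteen models. -/

noncomputable section

/-! ### Coordinates on the ring of 3-jets in the plane. -/

namespace ClosedJetIdeals

open MvPolynomial

/-- The Euclidean plane. -/
abbrev Plane := EuclideanSpace ℝ (Fin 2)

/-- The cubic polynomial with the given coefficients, ordered by degree. -/
def cubicPoly (a b c d e f g h k l : ℝ) : MvPolynomial (Fin 2) ℝ :=
  C a + C b * x + C c * y + C d * x ^ 2 + C e * (x * y) + C f * y ^ 2 +
    C g * x ^ 3 + C h * (x ^ 2 * y) + C k * (x * y ^ 2) + C l * y ^ 3

/-- The jet with the given coefficients. -/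
def jt (a b c d e f g h k l : ℝ) : JetRing 3 2 := toJet 3 (cubicPoly a b c d e f g h k l)

/-- The cubic polynomial function with the given coefficients. -/
def cubicFun (a b c d e f g h k l : ℝ) (v : Plane) : ℝ :=
  a + b * v 0 + c * v 1 + d * v 0 ^ 2 + e * (v 0 * v 1) + f * v 1 ^ 2 +
    g * v 0 ^ 3 + h * (v 0 ^ 2 * v 1) + k * (v 0 * v 1 ^ 2) + l * v 1 ^ 3

theorem toJet_monomial_eq_zero {i j : ℕ} (h : 4 ≤ i + j) :
    (toJet 3 x) ^ i * (toJet 3 y) ^ j = 0 := by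
  rw [← map_pow, ← map_pow, ← map_mul, Ideal.Quotient.eq_zero_iff_mem]
  refine Ideal.pow_le_pow_right h ?_
  rw [pow_add]
  exact Ideal.mul_mem_mul
    (Ideal.pow_mem_pow (Ideal.subset_span (Set.mem_range_self 0)) _)
    (Ideal.pow_mem_pow (Ideal.subset_span (Set.mem_range_self 1)) _)

theorem jt_add (a b c d e f g h k l a' b' c' d' e' f' g' h' k' l' : ℝ) :
    jt a b c d e f g h k l + jt a' b' c' d' e' f' g' h' k' l' =
      jt (a + a') (b + b') (c + c') (d + d') (e + e') (f + f') (g + g') (h + h') (k + k')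
        (l + l') := by
  simp only [jt, cubicPoly, ← map_add]
  congr 1
  simp only [map_add]
  ring

/-- The terms of degree at least four are multiples of the five quartic monomials, which are zero as
jets. The `linear_combination` lists these terms with one quartic monomial divided out. -/
theorem jt_mul (a b c d e f g h k l a' b' c' d' e' f' g' h' k' l' : ℝ) :
    jt a b c d e f g h k l * jt a' b' c' d' e' f' g' h' k' l' =
      jt (a * a') (a * b' + b * a') (a * c' + c * a') (a * d' + b * b' + d * a') (a * e' + b * c'
        + c * b' + e * a') (a * f' + c * c' + f * a') (a * g' + b * d' + d * b' + g * a') (a *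
        h' + b * e' + c * d' + d * c' + e * b' + h * a') (a * k' + b * f' + c * e' + e * c' + f
        * b' + k * a') (a * l' + c * f' + f * c' + l * a') := by
  have h40 := toJet_monomial_eq_zero (i := 4) (j := 0) le_rfl
  have h31 := toJet_monomial_eq_zero (i := 3) (j := 1) le_rfl
  have h22 := toJet_monomial_eq_zero (i := 2) (j := 2) le_rfl
  have h13 := toJet_monomial_eq_zero (i := 1) (j := 3) le_rfl
  have h04 := toJet_monomial_eq_zero (i := 0) (j := 4) le_rfl
  simp only [jt, cubicPoly, map_add, map_mul, map_pow]
  -- With x, y and the embedding of constants named, the goal is an identity in a commutative ring,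
  -- and the quotient is never unfolded.
  generalize toJet 3 x = X at *
  generalize toJet 3 y = Y at *
  have hκ : ∀ r : ℝ, toJet 3 (C r : MvPolynomial (Fin 2) ℝ) = (toJet 3).comp C r := fun _ => rfl
  simp only [hκ]
  generalize (toJet 3).comp (C : ℝ →+* MvPolynomial (Fin 2) ℝ) = κ at *
  linear_combination (κ c * κ l' + κ f * κ f' + κ f * κ l' * Y ^ 1 + κ l * κ c' + κ l * κ f' * Y ^ 1 + κ l * κ l'
    * Y ^ 2) * h04 + (κ b * κ l' + κ c * κ k' + κ e * κ f' + κ e * κ l' * Y ^ 1 + κ f * κ e' + κ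
    f * κ k' * Y ^ 1 + κ k * κ c' + κ k * κ f' * Y ^ 1 + κ k * κ l' * Y ^ 2 + κ l * κ b' + κ l *
    κ e' * Y ^ 1 + κ l * κ k' * Y ^ 2) * h13 + (κ b * κ k' + κ c * κ h' + κ d * κ f' + κ d * κ
    l' * Y ^ 1 + κ e * κ e' + κ e * κ k' * Y ^ 1 + κ f * κ d' + κ f * κ h' * Y ^ 1 + κ h * κ c'
    + κ h * κ f' * Y ^ 1 + κ h * κ l' * Y ^ 2 + κ k * κ b' + κ k * κ e' * Y ^ 1 + κ k * κ k' * Y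
    ^ 2 + κ l * κ d' * Y ^ 1 + κ l * κ h' * Y ^ 2) * h22 + (κ b * κ h' + κ c * κ g' + κ d * κ e'
    + κ d * κ k' * Y ^ 1 + κ e * κ d' + κ e * κ h' * Y ^ 1 + κ f * κ g' * Y ^ 1 + κ g * κ c' + κ
    g * κ f' * Y ^ 1 + κ g * κ l' * Y ^ 2 + κ h * κ b' + κ h * κ e' * Y ^ 1 + κ h * κ k' * Y ^ 2
    + κ k * κ d' * Y ^ 1 + κ k * κ h' * Y ^ 2 + κ l * κ g' * Y ^ 2) * h31 + (κ b * κ g' + κ d *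
    κ d' + κ d * κ g' * X ^ 1 + κ d * κ h' * Y ^ 1 + κ e * κ g' * Y ^ 1 + κ g * κ b' + κ g * κ
    d' * X ^ 1 + κ g * κ e' * Y ^ 1 + κ g * κ g' * X ^ 2 + κ g * κ h' * X ^ 1 * Y ^ 1 + κ g * κ
    k' * Y ^ 2 + κ h * κ d' * Y ^ 1 + κ h * κ g' * X ^ 1 * Y ^ 1 + κ h * κ h' * Y ^ 2 + κ k * κ
    g' * Y ^ 2) * h40

theorem jt_zero : jt 0 0 0 0 0 0 0 0 0 0 = 0 := by simp [jt, cubicPoly]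

theorem jt_one : jt 1 0 0 0 0 0 0 0 0 0 = 1 := by simp [jt, cubicPoly]

theorem eval_cubicPoly (a b c d e f g h k l : ℝ) (v : Plane) :
    eval (fun i => v i) (cubicPoly a b c d e f g h k l) = cubicFun a b c d e f g h k l v := by
  simp [cubicPoly, cubicFun]

theorem totalDegree_cubicPoly_le (a b c d e f g h k l : ℝ) :
    (cubicPoly a b c d e f g h k l).totalDegree ≤ 3 := by
  have key : ∀ (r : ℝ) (i j : ℕ), i + j ≤ 3 → (C r * (x ^ i * y ^ j)).totalDegree ≤ 3 := by
    intro r i j hij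
    refine (totalDegree_mul _ _).trans ?_
    rw [totalDegree_C, zero_add]
    refine (totalDegree_mul _ _).trans ?_
    rwa [totalDegree_X_pow, totalDegree_X_pow]
  have hsum : cubicPoly a b c d e f g h k l = C a * (x ^ 0 * y ^ 0) + C b * (x ^ 1 * y ^ 0) +
      C c * (x ^ 0 * y ^ 1) + C d * (x ^ 2 * y ^ 0) + C e * (x ^ 1 * y ^ 1) +
      C f * (x ^ 0 * y ^ 2) + C g * (x ^ 3 * y ^ 0) + C h * (x ^ 2 * y ^ 1) +
      C k * (x ^ 1 * y ^ 2) + C l * (x ^ 0 * y ^ 3) := by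
    rw [cubicPoly]
    ring
  rw [hsum]
  iterate 9 refine (totalDegree_add _ _).trans (max_le ?_ (key _ _ _ (by norm_num)))
  exact key _ _ _ (by norm_num)

theorem jetPoly_jt (a b c d e f g h k l : ℝ) :
    jetPoly (jt a b c d e f g h k l) = cubicPoly a b c d e f g h k l := by
  rw [jt, jetPoly_toJet, truncPoly]
  have h1 := totalDegree_cubicPoly_le a b c d e f g h k l
  conv_rhs => rw [← sum_homogeneousComponent (cubicPoly a b c d e f g h k l)]
  refine (Finset.sum_subset (Finset.range_mono (by omega)) fun i _ hi => ?_).symm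
  exact homogeneousComponent_eq_zero _ _ (by simpa using hi)

theorem jetEval_jt (a b c d e f g h k l : ℝ) (v : Plane) :
    jetEval (jt a b c d e f g h k l) v = cubicFun a b c d e f g h k l v := by
  rw [jetEval, jetPoly_jt, eval_cubicPoly]

/-- The coefficients of a cubic function can be read off from its values. -/
theorem cubicFun_injective {a b c d e f g h k l a' b' c' d' e' f' g' h' k' l' : ℝ}
    (H : ∀ v, cubicFun a b c d e f g h k l v = cubicFun a' b' c' d' e' f' g' h' k' l' v) :
    a = a' ∧ b = b' ∧ c = c' ∧ d = d' ∧ e = e' ∧ f = f' ∧ g = g' ∧ h = h' ∧ k = k' ∧ l = l' := by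
  have H' : ∀ s t : ℝ, cubicFun a b c d e f g h k l !₂[s, t] =
      cubicFun a' b' c' d' e' f' g' h' k' l' !₂[s, t] := fun s t => H _
  simp only [cubicFun] at H'
  simp at H'
  -- Ten points that determine a cubic: the seven on the axes give the pure powers, the last three
  -- the coefficients of xy, x²y and xy².
  have h00 := H' 0 0
  have h10 := H' 1 0
  have h20 := H' (-1) 0
  have h30 := H' 2 0
  have h01 := H' 0 1
  have h02 := H' 0 (-1)
  have h03 := H' 0 2
  have h11 := H' 1 1
  have h12 := H' 1 (-1)
  have h21 := H' (-1) 1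
  norm_num at *
  refine ⟨?_, ?_, ?_, ?_, ?_, ?_, ?_, ?_, ?_, ?_⟩ <;> linarith

theorem jt_inj {a b c d e f g h k l a' b' c' d' e' f' g' h' k' l' : ℝ} :
    jt a b c d e f g h k l = jt a' b' c' d' e' f' g' h' k' l' ↔
    a = a' ∧ b = b' ∧ c = c' ∧ d = d' ∧ e = e' ∧ f = f' ∧ g = g' ∧ h = h' ∧ k = k' ∧ l = l' := by
  refine ⟨fun H => cubicFun_injective fun v => ?_, ?_⟩
  · rw [← jetEval_jt, H, jetEval_jt]
  · rintro ⟨rfl, rfl, rfl, rfl, rfl, rfl, rfl, rfl, rfl, rfl⟩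
    rfl

theorem exists_jt (p : JetRing 3 2) : ∃ a b c d e f g h k l, p = jt a b c d e f g h k l := by
  obtain ⟨P, rfl⟩ := Ideal.Quotient.mk_surjective p
  induction P using MvPolynomial.induction_on with
  | C r => exact ⟨r, 0, 0, 0, 0, 0, 0, 0, 0, 0, by simp [jt, cubicPoly]⟩
  | add P Q hP hQ =>
    obtain ⟨a, b, c, d, e, f, g, h, k, l, hP⟩ := hP
    obtain ⟨a', b', c', d', e', f', g', h', k', l', hQ⟩ := hQ
    exact ⟨_, _, _, _, _, _, _, _, _, _, by rw [map_add, hP, hQ, jt_add]⟩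
  | mul_X P i hP =>
    obtain ⟨a, b, c, d, e, f, g, h, k, l, hP⟩ := hP
    have hx : toJet 3 x = jt 0 1 0 0 0 0 0 0 0 0 := by simp [jt, cubicPoly]
    have hy : toJet 3 y = jt 0 0 1 0 0 0 0 0 0 0 := by simp [jt, cubicPoly]
    fin_cases i
    · exact ⟨_, _, _, _, _, _, _, _, _, _, by rw [map_mul, hP]; erw [hx]; rw [jt_mul]⟩
    · exact ⟨_, _, _, _, _, _, _, _, _, _, by rw [map_mul, hP]; erw [hy]; rw [jt_mul]⟩

theorem jt_congr {a b c d e f g h k l a' b' c' d' e' f' g' h' k' l' : ℝ} (ha : a = a') (hb : b = b')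
    (hc : c = c') (hd : d = d') (he : e = e') (hf : f = f') (hg : g = g') (hh : h = h')
    (hk : k = k') (hl : l = l') :
    jt a b c d e f g h k l = jt a' b' c' d' e' f' g' h' k' l' := by
  subst ha hb hc hd he hf hg hh hk hl
  rfl

theorem toJet_cubicPoly (a b c d e f g h k l : ℝ) :
    toJet 3 (cubicPoly a b c d e f g h k l) = jt a b c d e f g h k l := rfl

-- From here on jets are handled only through `jt_add`, `jt_mul`, `jt_inj` and `exists_jt`.
attribute [irreducible] jt

end ClosedJetIdeals

end

/-! ### Taylor expansion to third order. -/

noncomputable section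

namespace ClosedJetIdeals

open MvPolynomial Filter Topology Asymptotics

theorem contDiff_coord {n : WithTop ℕ∞} (i : Fin 2) : ContDiff ℝ n fun v : Plane => v i :=
  (EuclideanSpace.proj (𝕜 := ℝ) i).contDiff

theorem contDiff_cubicFun {n : WithTop ℕ∞} (a b c d e f g h k l : ℝ) :
    ContDiff ℝ n (cubicFun a b c d e f g h k l) := by
  have h0 := contDiff_coord (n := n) 0
  have h1 := contDiff_coord (n := n) 1
  unfold cubicFun
  fun_prop

theorem fderiv_cubicFun (a b c d e f g h k l : ℝ) (v w : Plane) :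
    fderiv ℝ (cubicFun a b c d e f g h k l) v w =
      (b + 2 * d * v 0 + e * v 1 + 3 * g * v 0 ^ 2 + 2 * h * (v 0 * v 1) + k * v 1 ^ 2) * w 0 +
      (c + e * v 0 + 2 * f * v 1 + h * v 0 ^ 2 + 2 * k * (v 0 * v 1) + 3 * l * v 1 ^ 2) * w 1 := by
  have h0 : HasFDerivAt (fun v : Plane => v 0) (EuclideanSpace.proj (𝕜 := ℝ) 0) v :=
    (EuclideanSpace.proj (𝕜 := ℝ) 0).hasFDerivAt
  have h1 : HasFDerivAt (fun v : Plane => v 1) (EuclideanSpace.proj (𝕜 := ℝ) 1) v :=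
    (EuclideanSpace.proj (𝕜 := ℝ) 1).hasFDerivAt
  have H := (((((((((hasFDerivAt_const a v).add (h0.const_mul b)).add (h1.const_mul c)).add
    ((h0.pow 2).const_mul d)).add ((h0.mul h1).const_mul e)).add ((h1.pow 2).const_mul f)).add
    ((h0.pow 3).const_mul g)).add (((h0.pow 2).mul h1).const_mul h)).add
    ((h0.mul (h1.pow 2)).const_mul k)).add ((h1.pow 3).const_mul l)
  have H' : fderiv ℝ (cubicFun a b c d e f g h k l) v = _ := H.fderiv
  rw [H']
  simp
  ring

theorem partialD_zero_cubicFun (a b c d e f g h k l : ℝ) :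
    partialD 0 (cubicFun a b c d e f g h k l) =
      cubicFun b (2 * d) e (3 * g) (2 * h) k 0 0 0 0 := by
  ext v
  rw [partialD, fderiv_cubicFun]
  simp [cubicFun]

theorem partialD_one_cubicFun (a b c d e f g h k l : ℝ) :
    partialD 1 (cubicFun a b c d e f g h k l) =
      cubicFun c e (2 * f) h (2 * k) (3 * l) 0 0 0 0 := by
  ext v
  rw [partialD, fderiv_cubicFun]
  simp [cubicFun]

theorem partialD_contDiff {n : ℕ} {k : WithTop ℕ∞} {G : EuclideanSpace ℝ (Fin n) → ℝ} (i : Fin n)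
    (hG : ContDiff ℝ (k + 1) G) : ContDiff ℝ k (partialD i G) :=
  (hG.fderiv_right le_rfl).clm_apply contDiff_const

theorem partialD_sub {F G : Plane → ℝ} (i : Fin 2) (hF : Differentiable ℝ F)
    (hG : Differentiable ℝ G) :
    partialD i (fun v => F v - G v) = fun v => partialD i F v - partialD i G v := by
  ext v
  simp [partialD, fderiv_fun_sub (hF v) (hG v)]

/-- The Taylor coefficients use one order of differentiation, whereas `Flat` asks about all orders.
-/
theorem partialD_comm {F : Plane → ℝ} (hF : ContDiff ℝ 2 F) (i j : Fin 2) :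
    partialD i (partialD j F) = partialD j (partialD i F) := by
  ext v
  have hd : DifferentiableAt ℝ (fderiv ℝ F) v :=
    (hF.fderiv_right (m := 1) (by norm_num)).differentiable (by norm_num) v
  have key : ∀ i j : Fin 2, partialD i (partialD j F) v =
      fderiv ℝ (fderiv ℝ F) v (EuclideanSpace.single i 1) (EuclideanSpace.single j 1) := by
    intro i j
    change fderiv ℝ (fun u => fderiv ℝ F u (EuclideanSpace.single j 1)) v _ = _
    rw [fderiv_clm_apply hd (differentiableAt_const _)]
    simp
  rw [key, key]
  exact (hF.contDiffAt.isSymmSndFDerivAt (by simp)) _ _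

/-- The function is of class `C^k` and its derivatives up to order `k` vanish at the origin. -/
def Flat : ℕ → (Plane → ℝ) → Prop
  | 0, G => ContDiff ℝ 0 G ∧ G 0 = 0
  | k + 1, G => ContDiff ℝ (k + 1) G ∧ G 0 = 0 ∧ ∀ i, Flat k (partialD i G)

theorem norm_le_sum_coord (L : Plane →L[ℝ] ℝ) :
    ‖L‖ ≤ |L (EuclideanSpace.single 0 1)| + |L (EuclideanSpace.single 1 1)| := by
  refine L.opNorm_le_bound (by positivity) fun w => ?_
  have hw : w = w 0 • EuclideanSpace.single 0 (1 : ℝ) + w 1 • EuclideanSpace.single 1 (1 : ℝ) := by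
    ext i
    fin_cases i <;> simp
  have h0 : |w 0| ≤ ‖w‖ := PiLp.norm_apply_le w 0
  have h1 : |w 1| ≤ ‖w‖ := PiLp.norm_apply_le w 1
  conv_lhs => rw [hw]
  rw [map_add, map_smul, map_smul, smul_eq_mul, smul_eq_mul, Real.norm_eq_abs]
  refine (abs_add_le _ _).trans ?_
  rw [abs_mul, abs_mul, add_mul]
  nlinarith [abs_nonneg (L (EuclideanSpace.single 0 1)), abs_nonneg (L (EuclideanSpace.single 1 1))]

/-- By induction both partial derivatives are o(|v|^k). The mean value inequality on the ball of
radius |v| gains the factor |v|. -/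
theorem Flat.isLittleO {k : ℕ} {G : Plane → ℝ} (hG : Flat k G) :
    G =o[𝓝 0] fun v => ‖v‖ ^ k := by
  induction k generalizing G with
  | zero =>
    simp only [pow_zero]
    rw [isLittleO_one_iff]
    have := hG.1.continuous.tendsto 0
    rwa [hG.2] at this
  | succ k ih =>
    rw [isLittleO_iff]
    intro ε hε
    -- Half of ε for each partial derivative, since their sum bounds the norm of the differential.
    have h0 := (ih (hG.2.2 0)).bound (half_pos hε)
    have h1 := (ih (hG.2.2 1)).bound (half_pos hε)
    obtain ⟨r, hr, hball⟩ := Metric.eventually_nhds_iff_ball.1 (h0.and h1)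
    filter_upwards [Metric.ball_mem_nhds 0 hr] with v hv
    have hsub : Metric.closedBall (0 : Plane) ‖v‖ ⊆ Metric.ball 0 r :=
      Metric.closedBall_subset_ball (by simpa using hv)
    have hdiff : ∀ u ∈ Metric.closedBall (0 : Plane) ‖v‖, DifferentiableAt ℝ G u := fun u _ =>
      hG.1.differentiable (by simp) u
    have hbound : ∀ u ∈ Metric.closedBall (0 : Plane) ‖v‖, ‖fderiv ℝ G u‖ ≤ ε * ‖v‖ ^ k := by
      intro u hu
      obtain ⟨h0, h1⟩ := hball u (hsub hu)
      have hu' : ‖u‖ ^ k ≤ ‖v‖ ^ k := pow_le_pow_left₀ (norm_nonneg _) (by simpa using hu) _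
      rw [Real.norm_eq_abs, norm_pow, norm_norm] at h0 h1
      refine (norm_le_sum_coord _).trans ?_
      refine (add_le_add h0 h1).trans ?_
      nlinarith
    have := (convex_closedBall (0 : Plane) ‖v‖).norm_image_sub_le_of_norm_fderiv_le hdiff hbound
      (Metric.mem_closedBall_self (norm_nonneg _)) (y := v) (by simp)
    rw [hG.2.1, sub_zero, sub_zero] at this
    rwa [norm_pow, norm_norm, pow_succ, ← mul_assoc]

theorem sum_finsuppAntidiag_univ_two {M : Type*} [AddCommMonoid M] (k : ℕ)
    (f : (Fin 2 →₀ ℕ) → M) :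
    ∑ α ∈ Finset.finsuppAntidiag Finset.univ k, f α =
      ∑ q ∈ Finset.HasAntidiagonal.antidiagonal k, f (Finsupp.single 0 q.1 + Finsupp.single 1 q.2) := by
  refine Finset.sum_bij' (fun α _ => (α 0, α 1))
    (fun q _ => Finsupp.single 0 q.1 + Finsupp.single 1 q.2) ?_ ?_ ?_ ?_ ?_
  · intro α hα
    simpa using hα
  · intro q hq
    simpa using hq
  · intro α _
    ext i
    fin_cases i <;> simp
  · intro q _
    simp
  · intro α _
    congr 1
    ext i
    fin_cases i <;> simp

theorem multiD_two (α : Fin 2 →₀ ℕ) (F : Plane → ℝ) :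
    multiD α F = (partialD 0)^[α 0] ((partialD 1)^[α 1] F) := by
  simp [multiD, List.finRange_succ]

theorem jetOf_eq_jt (F : Plane → ℝ) :
    jetOf 3 F = jt (F 0) (partialD 0 F 0) (partialD 1 F 0) (partialD 0 (partialD 0 F) 0 / 2)
      (partialD 0 (partialD 1 F) 0) (partialD 1 (partialD 1 F) 0 / 2)
      (partialD 0 (partialD 0 (partialD 0 F)) 0 / 6) (partialD 0 (partialD 0 (partialD 1 F)) 0 / 2)
      (partialD 0 (partialD 1 (partialD 1 F)) 0 / 2)
      (partialD 1 (partialD 1 (partialD 1 F)) 0 / 6) := by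
  rw [jetOf, ← toJet_cubicPoly]
  congr 1
  simp only [sum_finsuppAntidiag_univ_two, multiD_two, Finset.sum_range_succ,
    Finset.Nat.antidiagonal_succ]
  have hmon : ∀ (i j : ℕ) (r : ℝ), monomial (Finsupp.single 0 i + Finsupp.single 1 j) r =
      C r * (x ^ i * y ^ j) := by
    intro i j r
    rw [X_pow_eq_monomial, X_pow_eq_monomial, monomial_mul, C_mul_monomial]
    simp
  simp [hmon, Nat.factorial, cubicPoly]
  ring

/-- Each derivative of F minus the same derivative of its Taylor cubic vanishes at 0 by the choice
of coefficients. The repeated `fin_cases` runs through the ordered derivatives of orders one, two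
and three. -/
theorem flat_sub_jetEval {F : Plane → ℝ} (hF : ContDiff ℝ 3 F) :
    Flat 3 fun v => F v - jetEval (jetOf 3 F) v := by
  have hF' : ∀ i, ContDiff ℝ 2 (partialD i F) := fun i => partialD_contDiff i (by norm_num [hF])
  have hF'' : ∀ i j, ContDiff ℝ 1 (partialD j (partialD i F)) := fun i j =>
    partialD_contDiff j (by norm_num [hF'])
  have hF''' : ∀ i j k, ContDiff ℝ 0 (partialD k (partialD j (partialD i F))) := fun i j k =>
    partialD_contDiff k (by norm_num [hF''])
  have d0 : Differentiable ℝ F := hF.differentiable (by norm_num)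
  have d1 := fun i => (hF' i).differentiable (by norm_num)
  have d2 := fun i j => (hF'' i j).differentiable (by norm_num)
  have dc : ∀ a b c d e f g h k l, Differentiable ℝ (cubicFun a b c d e f g h k l) :=
    fun a b c d e f g h k l => (contDiff_cubicFun a b c d e f g h k l (n := 1)).differentiable (by norm_num)
  have c10 := partialD_comm (hF.of_le (by norm_num)) 1 0
  have c100 := partialD_comm (hF' 0) 1 0
  have c101 := partialD_comm (hF' 1) 1 0
  simp only [jetEval_jt, jetOf_eq_jt]
  refine ⟨hF.sub (contDiff_cubicFun ..), by simp [cubicFun], fun i => ?_⟩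
  rw [partialD_sub i d0 (dc _ _ _ _ _ _ _ _ _ _)]
  fin_cases i
  all_goals
    simp only [Fin.zero_eta, Fin.mk_one, partialD_zero_cubicFun, partialD_one_cubicFun]
    refine ⟨(hF' _).sub (contDiff_cubicFun ..), by simp [cubicFun], fun i => ?_⟩
    rw [partialD_sub i (d1 _) (dc _ _ _ _ _ _ _ _ _ _)]
    fin_cases i
  all_goals
    simp only [Fin.zero_eta, Fin.mk_one, partialD_zero_cubicFun, partialD_one_cubicFun]
    refine ⟨(hF'' _ _).sub (contDiff_cubicFun ..), ?_, fun i => ?_⟩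
    · simp [cubicFun, c10]
      try ring
    rw [partialD_sub i (d2 _ _) (dc _ _ _ _ _ _ _ _ _ _)]
    fin_cases i
  all_goals
    simp only [Fin.zero_eta, Fin.mk_one, partialD_zero_cubicFun, partialD_one_cubicFun]
    refine ⟨(hF''' _ _ _).sub (contDiff_cubicFun ..), ?_⟩
    simp [cubicFun, c10, c100, c101]
    try ring

end ClosedJetIdeals

end

/-! ### Jets as third-order approximations, and the pullback homomorphism. -/

noncomputable section

namespace ClosedJetIdeals

open MvPolynomial Filter Topology Asymptotics

/-- The constant term is the limit at 0. Once it is zero, P is divided by X and N drops by one. -/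
theorem polynomial_coeff_eq_zero_of_isLittleO {N : ℕ} {P : Polynomial ℝ}
    (hP : (fun t => P.eval t) =o[𝓝[>] 0] fun t : ℝ => t ^ N) {k : ℕ} (hk : k ≤ N) :
    P.coeff k = 0 := by
  induction N generalizing P k with
  | zero =>
    obtain rfl : k = 0 := by omega
    simp only [pow_zero, isLittleO_one_iff] at hP
    have h1 : Tendsto (fun t => P.eval t) (𝓝[>] 0) (𝓝 (P.eval 0)) :=
      (P.continuous.tendsto 0).mono_left nhdsWithin_le_nhds
    rw [Polynomial.coeff_zero_eq_eval_zero]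
    exact tendsto_nhds_unique h1 hP
  | succ N ih =>
    have h0 : P.coeff 0 = 0 := by
      have hlim : Tendsto (fun t => P.eval t) (𝓝[>] 0) (𝓝 0) := by
        refine hP.trans_tendsto ?_
        have : Tendsto (fun t : ℝ => t ^ (N + 1)) (𝓝 0) (𝓝 (0 ^ (N + 1))) :=
          (continuous_pow _).tendsto 0
        rw [zero_pow (by omega)] at this
        exact this.mono_left nhdsWithin_le_nhds
      have h1 : Tendsto (fun t => P.eval t) (𝓝[>] 0) (𝓝 (P.eval 0)) :=
        (P.continuous.tendsto 0).mono_left nhdsWithin_le_nhds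
      rw [Polynomial.coeff_zero_eq_eval_zero]
      exact tendsto_nhds_unique h1 hlim
    cases k with
    | zero => exact h0
    | succ k =>
      have hX : P = Polynomial.X * P.divX := by
        conv_lhs => rw [← P.X_mul_divX_add, h0]
        simp
      have : P.divX.coeff k = 0 := by
        refine ih ?_ (by omega)
        have h2 : (fun t : ℝ => t⁻¹ * P.eval t) =o[𝓝[>] 0] fun t : ℝ => t⁻¹ * t ^ (N + 1) :=
          (isBigO_refl _ _).mul_isLittleO hP
        refine (h2.congr' ?_ ?_)
        · filter_upwards [self_mem_nhdsWithin] with t ht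
          have ht' : t ≠ 0 := ne_of_gt ht
          conv_lhs => rw [hX]
          simp [ht']
        · filter_upwards [self_mem_nhdsWithin] with t ht
          have ht' : t ≠ 0 := ne_of_gt ht
          rw [pow_succ]
          field_simp
      simpa using this

theorem coeff_eq_zero_of_isLittleO {M N : ℕ} {a : Fin M → ℝ}
    (ha : (fun t => ∑ i, a i * t ^ (i : ℕ)) =o[𝓝[>] 0] fun t : ℝ => t ^ N) {i : Fin M}
    (hi : (i : ℕ) ≤ N) : a i = 0 := by
  let P : Polynomial ℝ := ∑ i, Polynomial.C (a i) * Polynomial.X ^ (i : ℕ)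
  have hP : (fun t => P.eval t) =o[𝓝[>] 0] fun t : ℝ => t ^ N :=
    ha.congr_left fun t => by simp [P, Polynomial.eval_finsetSum]
  have := polynomial_coeff_eq_zero_of_isLittleO hP hi
  simpa [P, Polynomial.finsetSum_coeff, Polynomial.coeff_X_pow, Fin.val_inj] using this

theorem tendsto_smul_zero (v : Plane) : Tendsto (fun t : ℝ => t • v) (𝓝[>] 0) (𝓝 0) := by
  have : Tendsto (fun t : ℝ => t • v) (𝓝 0) (𝓝 ((0 : ℝ) • v)) :=
    (continuous_id.smul continuous_const).tendsto 0
  rw [zero_smul] at this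
  exact this.mono_left nhdsWithin_le_nhds

/-- On the ray through v the cubic is a polynomial in t whose coefficients are its homogeneous parts
at v, and all of these must vanish. -/
theorem cubicFun_eq_zero_of_isLittleO {a b c d e f g h k l : ℝ}
    (H : cubicFun a b c d e f g h k l =o[𝓝 0] fun v => ‖v‖ ^ 3) (v : Plane) :
    cubicFun a b c d e f g h k l v = 0 := by
  have h1 := H.comp_tendsto (tendsto_smul_zero v)
  have h2 : ((fun u : Plane => ‖u‖ ^ 3) ∘ fun t : ℝ => t • v) =O[𝓝[>] 0] fun t : ℝ => t ^ 3 := by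
    refine IsBigO.of_bound (‖v‖ ^ 3) (Eventually.of_forall fun t => ?_)
    simp [norm_smul, mul_pow, mul_comm]
  have h3 := h1.trans_isBigO h2
  let A : Fin 4 → ℝ := ![a, b * v 0 + c * v 1, d * v 0 ^ 2 + e * (v 0 * v 1) + f * v 1 ^ 2,
    g * v 0 ^ 3 + h * (v 0 ^ 2 * v 1) + k * (v 0 * v 1 ^ 2) + l * v 1 ^ 3]
  have hA : (fun t => ∑ i, A i * t ^ (i : ℕ)) =o[𝓝[>] 0] fun t : ℝ => t ^ 3 := by
    refine h3.congr_left fun t => ?_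
    simp [A, cubicFun, Fin.sum_univ_four]
    ring
  have k0 : a = 0 := coeff_eq_zero_of_isLittleO hA (i := 0) (by simp)
  have k1 := coeff_eq_zero_of_isLittleO hA (i := 1) (by simp)
  have k2 := coeff_eq_zero_of_isLittleO hA (i := 2) (by simp)
  have k3 := coeff_eq_zero_of_isLittleO hA (i := 3) (by simp)
  simp only [A, Matrix.cons_val] at k1 k2 k3
  simp only [cubicFun]
  linarith

theorem jetEval_eq_cubicFun (p : JetRing 3 2) : ∃ a b c d e f g h k l,
    p = jt a b c d e f g h k l ∧ jetEval p = cubicFun a b c d e f g h k l := by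
  obtain ⟨a, b, c, d, e, f, g, h, k, l, rfl⟩ := exists_jt p
  exact ⟨a, b, c, d, e, f, g, h, k, l, rfl, funext fun v => jetEval_jt ..⟩

theorem contDiff_jetEval {n : WithTop ℕ∞} (p : JetRing 3 2) : ContDiff ℝ n (jetEval p) := by
  obtain ⟨a, b, c, d, e, f, g, h, k, l, -, hp⟩ := jetEval_eq_cubicFun p
  rw [hp]
  exact contDiff_cubicFun ..

theorem eq_of_jetEval_sub_isLittleO {p q : JetRing 3 2}
    (H : (fun v => jetEval p v - jetEval q v) =o[𝓝 0] fun v => ‖v‖ ^ 3) : p = q := by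
  obtain ⟨a, b, c, d, e, f, g, h, k, l, rfl⟩ := exists_jt p
  obtain ⟨a', b', c', d', e', f', g', h', k', l', rfl⟩ := exists_jt q
  have key : ∀ v, cubicFun a b c d e f g h k l v - cubicFun a' b' c' d' e' f' g' h' k' l' v =
    cubicFun (a - a') (b - b') (c - c') (d - d') (e - e') (f - f') (g - g') (h - h') (k - k')
        (l - l') v := by
    intro v
    simp only [cubicFun]
    ring
  simp only [jetEval_jt, key] at H
  rw [jt_inj]
  refine cubicFun_injective fun v => ?_
  rw [← sub_eq_zero, key]
  exact cubicFun_eq_zero_of_isLittleO H v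

theorem sub_jetEval_jetOf_isLittleO {F : Plane → ℝ} (hF : ContDiff ℝ 3 F) :
    (fun v => F v - jetEval (jetOf 3 F) v) =o[𝓝 0] fun v => ‖v‖ ^ 3 :=
  (flat_sub_jetEval hF).isLittleO

/-- This characterisation of the jet replaces computations with derivatives in the algebraic rules
that follow. -/
theorem jetOf_eq_of_isLittleO {F : Plane → ℝ} (hF : ContDiff ℝ 3 F) {p : JetRing 3 2}
    (H : (fun v => F v - jetEval p v) =o[𝓝 0] fun v => ‖v‖ ^ 3) : jetOf 3 F = p := by
  refine eq_of_jetEval_sub_isLittleO ((H.sub (sub_jetEval_jetOf_isLittleO hF)).congr_left ?_)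
  intro v
  ring

theorem jetOf_eq_jetOf_of_isLittleO {F G : Plane → ℝ} (hF : ContDiff ℝ 3 F) (hG : ContDiff ℝ 3 G)
    (H : (fun v => F v - G v) =o[𝓝 0] fun v => ‖v‖ ^ 3) : jetOf 3 F = jetOf 3 G := by
  refine jetOf_eq_of_isLittleO hF ((H.add (sub_jetEval_jetOf_isLittleO hG)).congr_left ?_)
  intro v
  ring

theorem toJet_jetPoly (p : JetRing 3 2) : toJet 3 (jetPoly p) = p := by
  obtain ⟨a, b, c, d, e, f, g, h, k, l, rfl⟩ := exists_jt p
  rw [jetPoly_jt, toJet_cubicPoly]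

theorem continuous_eval_coord (P : MvPolynomial (Fin 2) ℝ) :
    Continuous fun v : Plane => eval (fun i => v i) P :=
  (MvPolynomial.continuous_eval P).comp (continuous_pi fun i => (contDiff_coord i).continuous (n := 0))

theorem contDiff_eval_coord {n : WithTop ℕ∞} (P : MvPolynomial (Fin 2) ℝ) :
    ContDiff ℝ n fun v : Plane => eval (fun i => v i) P := by
  induction P using MvPolynomial.induction_on with
  | C r => simpa using contDiff_const
  | add P Q hP hQ => simpa using hP.add hQ
  | mul_X P i hP => simpa using hP.mul (contDiff_coord i)

theorem eval_isLittleO_of_mem {P : MvPolynomial (Fin 2) ℝ}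
    (hP : P ∈ idealOfVars (Fin 2) ℝ ^ 4) :
    (fun v : Plane => eval (fun i => v i) P) =o[𝓝 0] fun v => ‖v‖ ^ 3 := by
  rw [pow_idealOfVars_eq_span] at hP
  induction hP using Submodule.span_induction with
  | mem P h =>
    obtain ⟨α, hα, rfl⟩ := h
    have hdeg : α 0 + α 1 = 4 := by
      have : Finsupp.degree α = 4 := hα
      rw [Finsupp.degree_eq_sum, Fin.sum_univ_two] at this
      exact this
    have hO : (fun v : Plane => eval (fun i => v i) (monomial α 1)) =O[𝓝 0] fun v => ‖v‖ ^ 4 := by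
      refine IsBigO.of_bound 1 (Eventually.of_forall fun v => ?_)
      have h0 : |v 0| ≤ ‖v‖ := PiLp.norm_apply_le v 0
      have h1 : |v 1| ≤ ‖v‖ := PiLp.norm_apply_le v 1
      rw [eval_monomial, Finsupp.prod_fintype _ _ (by simp), Fin.prod_univ_two, one_mul, one_mul,
        norm_mul, norm_pow, norm_pow, norm_pow, norm_norm, ← hdeg, pow_add]
      gcongr <;> assumption
    refine hO.trans_isLittleO ?_
    exact ((isLittleO_pow_pow (𝕜 := ℝ) (by norm_num : 3 < 4)).comp_tendsto
      (tendsto_norm_zero (E := Plane)))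
  | zero => simp
  | add P Q _ _ hP hQ => simpa using hP.add hQ
  | smul R P _ hP =>
    have hO : (fun v : Plane => eval (fun i => v i) R) =O[𝓝 0] fun _ => (1 : ℝ) :=
      ((continuous_eval_coord R).tendsto 0).isBigO_one ℝ
    simpa using hO.mul_isLittleO hP

theorem jetOf_eval (P : MvPolynomial (Fin 2) ℝ) :
    jetOf 3 (fun v : Plane => eval (fun i => v i) P) = toJet 3 P := by
  refine jetOf_eq_of_isLittleO (contDiff_eval_coord P) ?_
  have : P - jetPoly (toJet 3 P) ∈ idealOfVars (Fin 2) ℝ ^ 4 := by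
    rw [← Ideal.Quotient.eq_zero_iff_mem, map_sub, sub_eq_zero]
    exact (toJet_jetPoly _).symm
  simpa [jetEval] using eval_isLittleO_of_mem this

theorem jetOf_jetEval (p : JetRing 3 2) : jetOf 3 (jetEval p) = p := by
  conv_rhs => rw [← toJet_jetPoly p, ← jetOf_eval]
  rfl

theorem jetOf_add {F G : Plane → ℝ} (hF : ContDiff ℝ 3 F) (hG : ContDiff ℝ 3 G) :
    jetOf 3 (fun v => F v + G v) = jetOf 3 F + jetOf 3 G := by
  refine jetOf_eq_of_isLittleO (hF.add hG) ?_
  refine ((sub_jetEval_jetOf_isLittleO hF).add (sub_jetEval_jetOf_isLittleO hG)).congr_left ?_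
  intro v
  obtain ⟨a, b, c, d, e, f, g, h, k, l, hp⟩ := exists_jt (jetOf 3 F)
  obtain ⟨a', b', c', d', e', f', g', h', k', l', hq⟩ := exists_jt (jetOf 3 G)
  rw [hp, hq, jt_add, jetEval_jt, jetEval_jt, jetEval_jt]
  simp only [cubicFun]
  ring

/-- With Taylor cubics P and Q, FG − PQ = F(G − Q) + Q(F − P), a bounded factor times o(|v|³) in
each term. The jet of the polynomial PQ is its class in the quotient ring. -/
theorem jetOf_mul {F G : Plane → ℝ} (hF : ContDiff ℝ 3 F) (hG : ContDiff ℝ 3 G) :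
    jetOf 3 (fun v => F v * G v) = jetOf 3 F * jetOf 3 G := by
  have hP : jetOf 3 (fun v => jetEval (jetOf 3 F) v * jetEval (jetOf 3 G) v) =
      jetOf 3 F * jetOf 3 G := by
    have := jetOf_eval (jetPoly (jetOf 3 F) * jetPoly (jetOf 3 G))
    simp only [map_mul, toJet_jetPoly] at this
    exact this
  rw [← hP]
  refine jetOf_eq_jetOf_of_isLittleO (hF.mul hG)
    ((contDiff_jetEval _).mul (contDiff_jetEval _)) ?_
  have hO1 : F =O[𝓝 0] fun _ => (1 : ℝ) := (hF.continuous.tendsto 0).isBigO_one ℝ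
  have hO2 : jetEval (jetOf 3 G) =O[𝓝 0] fun _ => (1 : ℝ) :=
    ((contDiff_jetEval (n := 0) _).continuous.tendsto 0).isBigO_one ℝ
  have h1 := hO1.mul_isLittleO (sub_jetEval_jetOf_isLittleO hG)
  have h2 := hO2.mul_isLittleO (sub_jetEval_jetOf_isLittleO hF)
  simp only [one_mul] at h1 h2
  refine (h1.add h2).congr_left fun v => ?_
  ring

/-- Since φ is differentiable and fixes the origin, φ(v) = O(v), so composing with φ preserves
o(|v|³). -/
theorem jetOf_comp_congr {F G : Plane → ℝ} {φ : Plane → Plane} (hF : ContDiff ℝ 3 F)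
    (hG : ContDiff ℝ 3 G) (hφ : ContDiff ℝ 3 φ) (h0 : φ 0 = 0) (H : jetOf 3 F = jetOf 3 G) :
    jetOf 3 (F ∘ φ) = jetOf 3 (G ∘ φ) := by
  refine jetOf_eq_jetOf_of_isLittleO (hF.comp hφ) (hG.comp hφ) ?_
  have h1 : (fun v => F v - G v) =o[𝓝 0] fun v => ‖v‖ ^ 3 := by
    have := (sub_jetEval_jetOf_isLittleO hF).sub (sub_jetEval_jetOf_isLittleO hG)
    rw [H] at this
    exact this.congr_left fun v => by ring
  have ht : Tendsto φ (𝓝 0) (𝓝 0) := by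
    have := hφ.continuous.tendsto 0
    rwa [h0] at this
  have hO : φ =O[𝓝 0] fun v => v := by
    have := ((hφ.differentiable (by norm_num)) 0).isBigO_sub
    simpa [h0] using this
  exact (h1.comp_tendsto ht).trans_isBigO (hO.norm_norm.pow 3)

theorem jetOf_const_one : jetOf 3 (fun _ : Plane => (1 : ℝ)) = 1 := by
  have := jetOf_eval 1
  simpa only [map_one] using this

theorem jetOf_const_zero : jetOf 3 (fun _ : Plane => (0 : ℝ)) = 0 := by
  have := jetOf_eval 0
  simpa only [map_zero] using this

theorem jetOf_comp_add (p q : JetRing 3 2) {φ : Plane → Plane} (hφ : ContDiff ℝ 3 φ)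
    (h0 : φ 0 = 0) : jetOf 3 (jetEval (p + q) ∘ φ) =
      jetOf 3 (jetEval p ∘ φ) + jetOf 3 (jetEval q ∘ φ) := by
  have hp : ContDiff ℝ 3 (jetEval p) := contDiff_jetEval p
  have hq : ContDiff ℝ 3 (jetEval q) := contDiff_jetEval q
  have H : jetOf 3 (jetEval (p + q)) = jetOf 3 fun v => jetEval p v + jetEval q v := by
    rw [jetOf_add hp hq, jetOf_jetEval, jetOf_jetEval, jetOf_jetEval]
  exact (jetOf_comp_congr (contDiff_jetEval _) (hp.add hq) hφ h0 H).trans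
    (jetOf_add (hp.comp hφ) (hq.comp hφ))

theorem jetOf_comp_mul (p q : JetRing 3 2) {φ : Plane → Plane} (hφ : ContDiff ℝ 3 φ)
    (h0 : φ 0 = 0) : jetOf 3 (jetEval (p * q) ∘ φ) =
      jetOf 3 (jetEval p ∘ φ) * jetOf 3 (jetEval q ∘ φ) := by
  have hp : ContDiff ℝ 3 (jetEval p) := contDiff_jetEval p
  have hq : ContDiff ℝ 3 (jetEval q) := contDiff_jetEval q
  have H : jetOf 3 (jetEval (p * q)) = jetOf 3 fun v => jetEval p v * jetEval q v := by
    rw [jetOf_mul hp hq, jetOf_jetEval, jetOf_jetEval, jetOf_jetEval]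
  exact (jetOf_comp_congr (contDiff_jetEval _) (hp.mul hq) hφ h0 H).trans
    (jetOf_mul (hp.comp hφ) (hq.comp hφ))

theorem jetEval_one : jetEval (1 : JetRing 3 2) = fun _ => 1 := by
  ext v
  rw [← jt_one, jetEval_jt]
  simp [cubicFun]

theorem jetEval_zero : jetEval (0 : JetRing 3 2) = fun _ => 0 := by
  ext v
  rw [← jt_zero, jetEval_jt]
  simp [cubicFun]

/-- The ring homomorphism `p ↦ J³(p ∘ φ)`. -/
def pullback (φ : Plane → Plane) (hφ : ContDiff ℝ 3 φ) (h0 : φ 0 = 0) :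
    JetRing 3 2 →+* JetRing 3 2 where
  toFun p := jetOf 3 (jetEval p ∘ φ)
  map_one' := (congrArg (fun F => jetOf 3 (F ∘ φ)) jetEval_one).trans jetOf_const_one
  map_zero' := (congrArg (fun F => jetOf 3 (F ∘ φ)) jetEval_zero).trans jetOf_const_zero
  map_add' p q := jetOf_comp_add p q hφ h0
  map_mul' p q := jetOf_comp_mul p q hφ h0

theorem pullback_apply (φ : Plane → Plane) (hφ : ContDiff ℝ 3 φ) (h0 : φ 0 = 0) (p : JetRing 3 2) :
    pullback φ hφ h0 p = jetOf 3 (jetEval p ∘ φ) := rfl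

theorem pullback_pullback {φ ψ : Plane → Plane} (hφ : ContDiff ℝ 3 φ) (h0 : φ 0 = 0)
    (hψ : ContDiff ℝ 3 ψ) (h0' : ψ 0 = 0) (p : JetRing 3 2) :
    pullback ψ hψ h0' (pullback φ hφ h0 p) = jetOf 3 (jetEval p ∘ φ ∘ ψ) := by
  have hp : ContDiff ℝ 3 (jetEval p ∘ φ) := (contDiff_jetEval p).comp hφ
  have H : jetOf 3 (jetEval (jetOf 3 (jetEval p ∘ φ))) = jetOf 3 (jetEval p ∘ φ) := jetOf_jetEval _
  have key := jetOf_comp_congr (contDiff_jetEval _) hp hψ h0' H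
  rw [pullback_apply, pullback_apply, key, Function.comp_assoc]

end ClosedJetIdeals

end

/-! ### Diffeomorphisms fixing the origin and equivalence of ideals. -/

noncomputable section

namespace ClosedJetIdeals

open MvPolynomial Filter Topology Asymptotics

/-- The `C³`-diffeomorphisms of the plane that fix the origin. -/
structure OriginDiffeo where
  toEquiv : Plane ≃ Plane
  contDiff : ContDiff ℝ 3 toEquiv
  contDiff_symm : ContDiff ℝ 3 toEquiv.symm
  map_zero : toEquiv 0 = 0

namespace OriginDiffeo

variable (φ ψ : OriginDiffeo)

theorem symm_map_zero : φ.toEquiv.symm 0 = 0 := by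
  rw [Equiv.symm_apply_eq, φ.map_zero]

def symm : OriginDiffeo := ⟨φ.toEquiv.symm, φ.contDiff_symm, φ.contDiff, φ.symm_map_zero⟩

def trans : OriginDiffeo where
  toEquiv := φ.toEquiv.trans ψ.toEquiv
  contDiff := ψ.contDiff.comp φ.contDiff
  contDiff_symm := φ.contDiff_symm.comp ψ.contDiff_symm
  map_zero := by simp [φ.map_zero, ψ.map_zero]

def pullbackHom : JetRing 3 2 →+* JetRing 3 2 := pullback φ.toEquiv φ.contDiff φ.map_zero

theorem pullbackHom_apply (p : JetRing 3 2) :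
    φ.pullbackHom p = jetOf 3 (jetEval p ∘ φ.toEquiv) := rfl

theorem pullbackHom_pullbackHom (p : JetRing 3 2) :
    φ.pullbackHom (ψ.pullbackHom p) = (φ.trans ψ).pullbackHom p := by
  rw [pullbackHom, pullbackHom, pullback_pullback, pullbackHom_apply]
  rfl

theorem pullbackHom_of_eq_id (h : ∀ v, φ.toEquiv v = v) (p : JetRing 3 2) :
    φ.pullbackHom p = p := by
  have : jetEval p ∘ φ.toEquiv = jetEval p := funext fun v => congrArg (jetEval p) (h v)
  rw [pullbackHom_apply, this, jetOf_jetEval]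

/-- The automorphism `p ↦ J³(p ∘ φ)` of the ring of jets. -/
def pull : JetRing 3 2 ≃+* JetRing 3 2 :=
  RingEquiv.ofRingHom φ.pullbackHom φ.symm.pullbackHom
    (RingHom.ext fun p => by
      rw [RingHom.comp_apply, pullbackHom_pullbackHom, pullbackHom_of_eq_id _ fun v => ?_]
      · rfl
      · exact φ.toEquiv.symm_apply_apply v)
    (RingHom.ext fun p => by
      rw [RingHom.comp_apply, pullbackHom_pullbackHom, pullbackHom_of_eq_id _ fun v => ?_]
      · rfl
      · exact φ.toEquiv.apply_symm_apply v)

theorem pull_apply (p : JetRing 3 2) : φ.pull p = jetOf 3 (jetEval p ∘ φ.toEquiv) := rfl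

theorem pull_trans (p : JetRing 3 2) : (φ.trans ψ).pull p = φ.pull (ψ.pull p) :=
  (pullbackHom_pullbackHom φ ψ p).symm

end OriginDiffeo

/-- Pullback by a diffeomorphism is a ring automorphism, so the set-theoretic image of an ideal is
already the image ideal. -/
theorem equivalent_iff {I I' : Ideal (JetRing 3 2)} :
    Equivalent I I' ↔ ∃ φ : OriginDiffeo, I' = I.map φ.pull := by
  have key : ∀ φ : OriginDiffeo, ((I.map φ.pull : Ideal (JetRing 3 2)) : Set (JetRing 3 2)) =
      (fun p : JetRing 3 2 => jetOf 3 (jetEval p ∘ φ.toEquiv)) '' (I : Set (JetRing 3 2)) := by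
    intro φ
    ext q
    rw [SetLike.mem_coe, Ideal.mem_map_iff_of_surjective _ φ.pull.surjective]
    rfl
  constructor
  · rintro ⟨φ, h1, h2, h3, h⟩
    refine ⟨⟨φ, h1, h2, h3⟩, SetLike.coe_injective ?_⟩
    rw [h, key]
  · rintro ⟨φ, rfl⟩
    exact ⟨φ.toEquiv, φ.contDiff, φ.contDiff_symm, φ.map_zero, key φ⟩

theorem equivalent_map (I : Ideal (JetRing 3 2)) (φ : OriginDiffeo) :
    Equivalent I (I.map φ.pull) := equivalent_iff.2 ⟨φ, rfl⟩

theorem mem_map_pull {I : Ideal (JetRing 3 2)} {φ : OriginDiffeo} {q : JetRing 3 2} :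
    q ∈ I.map φ.pull ↔ ∃ p ∈ I, φ.pull p = q :=
  Ideal.mem_map_iff_of_surjective _ φ.pull.surjective

theorem Equivalent.trans {I J K : Ideal (JetRing 3 2)} (h : Equivalent I J)
    (h' : Equivalent J K) : Equivalent I K := by
  rw [equivalent_iff] at *
  obtain ⟨φ, rfl⟩ := h
  obtain ⟨ψ, rfl⟩ := h'
  refine ⟨ψ.trans φ, ?_⟩
  ext q
  simp only [mem_map_pull, OriginDiffeo.pull_trans]
  constructor
  · rintro ⟨_, ⟨p, hp, rfl⟩, rfl⟩
    exact ⟨p, hp, rfl⟩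
  · rintro ⟨p, hp, rfl⟩
    exact ⟨_, ⟨p, hp, rfl⟩, rfl⟩

theorem pull_mem_map {I : Ideal (JetRing 3 2)} (φ : OriginDiffeo) {p : JetRing 3 2} :
    φ.pull p ∈ I.map φ.pull ↔ p ∈ I := by
  rw [mem_map_pull]
  constructor
  · rintro ⟨q, hq, h⟩
    rwa [← φ.pull.injective h]
  · intro h
    exact ⟨p, h, rfl⟩

/-- A pullback is determined by its values on constants, x and y. This computes the pullbacks by
shears, where composition produces terms of degree above three. -/
theorem jt_eq_linear_combination (a b c d e f g h k l : ℝ) :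
    jt a b c d e f g h k l = jt a 0 0 0 0 0 0 0 0 0 + jt b 0 0 0 0 0 0 0 0 0 * jt 0 1 0 0 0 0 0 0 0 0 +
      jt c 0 0 0 0 0 0 0 0 0 * jt 0 0 1 0 0 0 0 0 0 0 +
      jt d 0 0 0 0 0 0 0 0 0 * (jt 0 1 0 0 0 0 0 0 0 0 * jt 0 1 0 0 0 0 0 0 0 0) +
      jt e 0 0 0 0 0 0 0 0 0 * (jt 0 1 0 0 0 0 0 0 0 0 * jt 0 0 1 0 0 0 0 0 0 0) +
      jt f 0 0 0 0 0 0 0 0 0 * (jt 0 0 1 0 0 0 0 0 0 0 * jt 0 0 1 0 0 0 0 0 0 0) +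
      jt g 0 0 0 0 0 0 0 0 0 *
        (jt 0 1 0 0 0 0 0 0 0 0 * (jt 0 1 0 0 0 0 0 0 0 0 * jt 0 1 0 0 0 0 0 0 0 0)) +
      jt h 0 0 0 0 0 0 0 0 0 *
        (jt 0 1 0 0 0 0 0 0 0 0 * (jt 0 1 0 0 0 0 0 0 0 0 * jt 0 0 1 0 0 0 0 0 0 0)) +
      jt k 0 0 0 0 0 0 0 0 0 *
        (jt 0 1 0 0 0 0 0 0 0 0 * (jt 0 0 1 0 0 0 0 0 0 0 * jt 0 0 1 0 0 0 0 0 0 0)) +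
      jt l 0 0 0 0 0 0 0 0 0 *
        (jt 0 0 1 0 0 0 0 0 0 0 * (jt 0 0 1 0 0 0 0 0 0 0 * jt 0 0 1 0 0 0 0 0 0 0)) := by
  simp only [jt_mul, jt_add]
  apply jt_congr <;> ring

theorem pull_of_forall_eq (φ : OriginDiffeo) (p : JetRing 3 2) {a b c d e f g h k l : ℝ}
    (H : ∀ v, jetEval p (φ.toEquiv v) = cubicFun a b c d e f g h k l v) :
    φ.pull p = jt a b c d e f g h k l := by
  have h1 : jetEval p ∘ φ.toEquiv = jetEval (jt a b c d e f g h k l) := by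
    ext v
    rw [jetEval_jt]
    exact H v
  rw [OriginDiffeo.pull_apply, h1, jetOf_jetEval]

theorem pull_jt_const (φ : OriginDiffeo) (a : ℝ) :
    φ.pull (jt a 0 0 0 0 0 0 0 0 0) = jt a 0 0 0 0 0 0 0 0 0 :=
  pull_of_forall_eq φ _ fun v => by rw [jetEval_jt]; simp [cubicFun]

/-- The linear map with the given matrix. -/
def linearDiffeo (α β γ δ : ℝ) (hdet : α * δ - β * γ ≠ 0) : OriginDiffeo where
  toEquiv :=
    { toFun := fun v => !₂[α * v 0 + β * v 1, γ * v 0 + δ * v 1]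
      invFun := fun v => !₂[(δ * v 0 - β * v 1) / (α * δ - β * γ),
        (α * v 1 - γ * v 0) / (α * δ - β * γ)]
      left_inv := fun v => by
        ext i
        fin_cases i
        · simp
          rw [div_eq_iff hdet]
          ring
        · simp
          rw [div_eq_iff hdet]
          ring
      right_inv := fun v => by
        ext i
        fin_cases i
        · simp
          rw [← mul_div_assoc, ← mul_div_assoc, ← add_div, div_eq_iff hdet]
          ring
        · simp
          rw [← mul_div_assoc, ← mul_div_assoc, ← add_div, div_eq_iff hdet]
          ring }
  contDiff := by
    have h0 := contDiff_coord (n := 3) 0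
    have h1 := contDiff_coord (n := 3) 1
    refine contDiff_euclidean.2 fun i => ?_
    fin_cases i <;> simp <;> fun_prop
  contDiff_symm := by
    have h0 := contDiff_coord (n := 3) 0
    have h1 := contDiff_coord (n := 3) 1
    refine contDiff_euclidean.2 fun i => ?_
    fin_cases i <;> simp <;> fun_prop
  map_zero := by
    ext i
    fin_cases i <;> simp

/-- The map `(x, y) ↦ (x + αy² + βy³, y)`. -/
def shearFst (α β : ℝ) : OriginDiffeo where
  toEquiv :=
    { toFun := fun v => !₂[v 0 + α * v 1 ^ 2 + β * v 1 ^ 3, v 1]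
      invFun := fun v => !₂[v 0 - α * v 1 ^ 2 - β * v 1 ^ 3, v 1]
      left_inv := fun v => by
        ext i
        fin_cases i <;> simp <;> ring
      right_inv := fun v => by
        ext i
        fin_cases i <;> simp <;> ring }
  contDiff := by
    have h0 := contDiff_coord (n := 3) 0
    have h1 := contDiff_coord (n := 3) 1
    refine contDiff_euclidean.2 fun i => ?_
    fin_cases i <;> simp <;> fun_prop
  contDiff_symm := by
    have h0 := contDiff_coord (n := 3) 0
    have h1 := contDiff_coord (n := 3) 1
    refine contDiff_euclidean.2 fun i => ?_
    fin_cases i <;> simp <;> fun_prop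
  map_zero := by
    ext i
    fin_cases i <;> simp

/-- The map `(x, y) ↦ (x, y + αx²)`. -/
def shearSnd (α : ℝ) : OriginDiffeo where
  toEquiv :=
    { toFun := fun v => !₂[v 0, v 1 + α * v 0 ^ 2]
      invFun := fun v => !₂[v 0, v 1 - α * v 0 ^ 2]
      left_inv := fun v => by
        ext i
        fin_cases i <;> simp
      right_inv := fun v => by
        ext i
        fin_cases i <;> simp }
  contDiff := by
    have h0 := contDiff_coord (n := 3) 0
    have h1 := contDiff_coord (n := 3) 1
    refine contDiff_euclidean.2 fun i => ?_
    fin_cases i <;> simp <;> fun_prop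
  contDiff_symm := by
    have h0 := contDiff_coord (n := 3) 0
    have h1 := contDiff_coord (n := 3) 1
    refine contDiff_euclidean.2 fun i => ?_
    fin_cases i <;> simp <;> fun_prop
  map_zero := by
    ext i
    fin_cases i <;> simp

/-- The new coefficients of x^j and y^j are the values of the degree-j part at the columns (α, γ)
and (β, δ). Moving a common zero to an axis therefore means using it as a column. -/
theorem pull_linearDiffeo {α β γ δ : ℝ} (hdet : α * δ - β * γ ≠ 0) (a b c d e f g h k l : ℝ) :
    (linearDiffeo α β γ δ hdet).pull (jt a b c d e f g h k l) =
      jt a (b * α + c * γ) (b * β + c * δ)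
        (d * α ^ 2 + e * α * γ + f * γ ^ 2)
        (2 * d * α * β + e * (α * δ + β * γ) + 2 * f * γ * δ)
        (d * β ^ 2 + e * β * δ + f * δ ^ 2)
        (g * α ^ 3 + h * α ^ 2 * γ + k * α * γ ^ 2 + l * γ ^ 3)
        (3 * g * α ^ 2 * β + h * (α ^ 2 * δ + 2 * α * β * γ) + k * (2 * α * γ * δ + β * γ ^ 2) +
          3 * l * γ ^ 2 * δ)
        (3 * g * α * β ^ 2 + h * (2 * α * β * δ + β ^ 2 * γ) + k * (α * δ ^ 2 + 2 * β * γ * δ) +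
          3 * l * γ * δ ^ 2)
        (g * β ^ 3 + h * β ^ 2 * δ + k * β * δ ^ 2 + l * δ ^ 3) := by
  refine pull_of_forall_eq _ _ fun v => ?_
  rw [jetEval_jt]
  simp [linearDiffeo, cubicFun]
  ring

theorem jetEval_pull_linearDiffeo {α β γ δ : ℝ} (hdet : α * δ - β * γ ≠ 0) (p : JetRing 3 2)
    (v : Plane) : jetEval ((linearDiffeo α β γ δ hdet).pull p) v =
      jetEval p ((linearDiffeo α β γ δ hdet).toEquiv v) := by
  obtain ⟨a, b, c, d, e, f, g, h, k, l, rfl⟩ := exists_jt p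
  rw [pull_linearDiffeo, jetEval_jt, jetEval_jt]
  simp [linearDiffeo, cubicFun]
  ring

theorem pull_shearFst (α β : ℝ) (a b c d e f g h k l : ℝ) :
    (shearFst α β).pull (jt a b c d e f g h k l) =
      jt a b c d e (f + b * α) g h (k + 2 * d * α) (l + b * β + e * α) := by
  have hx : (shearFst α β).pull (jt 0 1 0 0 0 0 0 0 0 0) = jt 0 1 0 0 0 α 0 0 0 β :=
    pull_of_forall_eq _ _ fun v => by rw [jetEval_jt]; simp [shearFst, cubicFun]
  have hy : (shearFst α β).pull (jt 0 0 1 0 0 0 0 0 0 0) = jt 0 0 1 0 0 0 0 0 0 0 :=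
    pull_of_forall_eq _ _ fun v => by rw [jetEval_jt]; simp [shearFst, cubicFun]
  rw [jt_eq_linear_combination a b c d e f g h k l]
  simp only [map_add, map_mul]
  simp only [hx, hy, pull_jt_const, jt_mul, jt_add]
  apply jt_congr <;> ring

theorem pull_shearSnd (α : ℝ) (a b c d e f g h k l : ℝ) :
    (shearSnd α).pull (jt a b c d e f g h k l) =
      jt a b c (d + c * α) e f (g + e * α) (h + 2 * f * α) k l := by
  have hx : (shearSnd α).pull (jt 0 1 0 0 0 0 0 0 0 0) = jt 0 1 0 0 0 0 0 0 0 0 :=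
    pull_of_forall_eq _ _ fun v => by rw [jetEval_jt]; simp [shearSnd, cubicFun]
  have hy : (shearSnd α).pull (jt 0 0 1 0 0 0 0 0 0 0) = jt 0 0 1 α 0 0 0 0 0 0 :=
    pull_of_forall_eq _ _ fun v => by
      rw [jetEval_jt]
      simp [shearSnd, cubicFun]
  rw [jt_eq_linear_combination a b c d e f g h k l]
  simp only [map_add, map_mul]
  simp only [hx, hy, pull_jt_const, jt_mul, jt_add]
  apply jt_congr <;> ring

end ClosedJetIdeals

end

/-! ### The models as linear conditions on coefficients. -/

noncomputable section

namespace ClosedJetIdeals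

open MvPolynomial Filter Topology Asymptotics

theorem toJet_eq_jt {P : MvPolynomial (Fin 2) ℝ} {a b c d e f g h k l : ℝ}
    (H : P = cubicPoly a b c d e f g h k l) : toJet 3 P = jt a b c d e f g h k l := by
  rw [H, toJet_cubicPoly]

theorem models_1_eq_span : models 1 = Ideal.span {jt 0 1 0 0 0 0 0 0 0 0} := by
  change Ideal.span (toJet 3 '' {x}) = _
  have h0 : toJet 3 (x) = jt 0 1 0 0 0 0 0 0 0 0 :=
    toJet_eq_jt (by simp [cubicPoly])
  rw [Set.image_singleton, h0]

theorem models_2_eq_span : models 2 = Ideal.span {jt 0 0 0 1 0 0 0 0 0 0} := by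
  change Ideal.span (toJet 3 '' {x ^ 2}) = _
  have h0 : toJet 3 (x ^ 2) = jt 0 0 0 1 0 0 0 0 0 0 :=
    toJet_eq_jt (by simp [cubicPoly])
  rw [Set.image_singleton, h0]

theorem models_3_eq_span : models 3 = Ideal.span {jt 0 0 0 0 0 0 1 0 0 0} := by
  change Ideal.span (toJet 3 '' {x ^ 3}) = _
  have h0 : toJet 3 (x ^ 3) = jt 0 0 0 0 0 0 1 0 0 0 :=
    toJet_eq_jt (by simp [cubicPoly])
  rw [Set.image_singleton, h0]

theorem models_4_eq_span : models 4 = Ideal.span {jt 0 0 0 0 1 0 0 0 0 0} := by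
  change Ideal.span (toJet 3 '' {x * y}) = _
  have h0 : toJet 3 (x * y) = jt 0 0 0 0 1 0 0 0 0 0 :=
    toJet_eq_jt (by simp [cubicPoly])
  rw [Set.image_singleton, h0]

theorem models_5_eq_span : models 5 = Ideal.span {jt 0 0 0 0 0 0 0 1 0 0} := by
  change Ideal.span (toJet 3 '' {y * x ^ 2}) = _
  have h0 : toJet 3 (y * x ^ 2) = jt 0 0 0 0 0 0 0 1 0 0 :=
    toJet_eq_jt (by simp [cubicPoly]; ring)
  rw [Set.image_singleton, h0]

theorem models_6_eq_span : models 6 = Ideal.span {jt 0 0 0 0 0 0 0 1 1 0} := by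
  change Ideal.span (toJet 3 '' {x * y * (x + y)}) = _
  have h0 : toJet 3 (x * y * (x + y)) = jt 0 0 0 0 0 0 0 1 1 0 :=
    toJet_eq_jt (by simp [cubicPoly]; ring)
  rw [Set.image_singleton, h0]

theorem models_7_eq_span : models 7 = Ideal.span {jt 0 0 0 1 0 0 0 0 0 (-1)} := by
  change Ideal.span (toJet 3 '' {x ^ 2 - y ^ 3}) = _
  have h0 : toJet 3 (x ^ 2 - y ^ 3) = jt 0 0 0 1 0 0 0 0 0 (-1) :=
    toJet_eq_jt (by simp [cubicPoly]; ring)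
  rw [Set.image_singleton, h0]

theorem models_8_eq_span : models 8 = Ideal.span {jt 0 0 0 1 0 0 0 0 0 0, jt 0 0 0 0 1 0 0 0 0 0} :=
      by
  change Ideal.span (toJet 3 '' {x ^ 2, x * y}) = _
  have h0 : toJet 3 (x ^ 2) = jt 0 0 0 1 0 0 0 0 0 0 :=
    toJet_eq_jt (by simp [cubicPoly])
  have h1 : toJet 3 (x * y) = jt 0 0 0 0 1 0 0 0 0 0 :=
    toJet_eq_jt (by simp [cubicPoly])
  rw [Set.image_pair, h0, h1]

theorem models_9_eq_span : models 9 = Ideal.span {jt 0 0 0 1 0 0 0 0 0 0, jt 0 0 0 0 0 0 0 0 1 0} :=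
      by
  change Ideal.span (toJet 3 '' {x ^ 2, x * y ^ 2}) = _
  have h0 : toJet 3 (x ^ 2) = jt 0 0 0 1 0 0 0 0 0 0 :=
    toJet_eq_jt (by simp [cubicPoly])
  have h1 : toJet 3 (x * y ^ 2) = jt 0 0 0 0 0 0 0 0 1 0 :=
    toJet_eq_jt (by simp [cubicPoly])
  rw [Set.image_pair, h0, h1]

theorem models_10_eq_span : models 10 = Ideal.span {jt 0 0 0 0 0 0 0 1 0 0, jt 0 0 0 0 0 0 0 0 1 0}
      := by
  change Ideal.span (toJet 3 '' {x ^ 2 * y, x * y ^ 2}) = _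
  have h0 : toJet 3 (x ^ 2 * y) = jt 0 0 0 0 0 0 0 1 0 0 :=
    toJet_eq_jt (by simp [cubicPoly])
  have h1 : toJet 3 (x * y ^ 2) = jt 0 0 0 0 0 0 0 0 1 0 :=
    toJet_eq_jt (by simp [cubicPoly])
  rw [Set.image_pair, h0, h1]

theorem models_11_eq_span : models 11 = Ideal.span {jt 0 0 0 0 0 0 1 0 0 0, jt 0 0 0 0 0 0 0 1 0 0}
      := by
  change Ideal.span (toJet 3 '' {x ^ 3, x ^ 2 * y}) = _
  have h0 : toJet 3 (x ^ 3) = jt 0 0 0 0 0 0 1 0 0 0 :=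
    toJet_eq_jt (by simp [cubicPoly])
  have h1 : toJet 3 (x ^ 2 * y) = jt 0 0 0 0 0 0 0 1 0 0 :=
    toJet_eq_jt (by simp [cubicPoly])
  rw [Set.image_pair, h0, h1]

theorem models_12_eq_span : models 12 = Ideal.span {jt 0 0 0 1 0 0 0 0 0 (-1), jt 0 0 0 0 0 0 0 0 1
      0} := by
  change Ideal.span (toJet 3 '' {x ^ 2 - y ^ 3, x * y ^ 2}) = _
  have h0 : toJet 3 (x ^ 2 - y ^ 3) = jt 0 0 0 1 0 0 0 0 0 (-1) :=
    toJet_eq_jt (by simp [cubicPoly]; ring)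
  have h1 : toJet 3 (x * y ^ 2) = jt 0 0 0 0 0 0 0 0 1 0 :=
    toJet_eq_jt (by simp [cubicPoly])
  rw [Set.image_pair, h0, h1]

theorem models_13_eq_span : models 13 = Ideal.span {jt 0 1 0 0 0 0 0 0 0 0, jt 0 0 1 0 0 0 0 0 0 0}
      := by
  change (Ideal.span (Set.range (X : Fin 2 → MvPolynomial (Fin 2) ℝ))).map (toJet 3) = _
  have hr : Set.range (X : Fin 2 → MvPolynomial (Fin 2) ℝ) = {x, y} := by
    ext P
    simp [eq_comm]
  rw [Ideal.map_span, hr, Set.image_pair]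
  congr 2
  · exact toJet_eq_jt (by simp [cubicPoly])
  · congr 1
    exact toJet_eq_jt (by simp [cubicPoly])

theorem models_14_eq_span : models 14 = Ideal.span {jt 0 0 0 0 0 0 1 0 0 0, jt 0 0 0 0 0 0 0 1 0 0,
      jt 0 0 0 0 0 0 0 0 1 0} := by
  change Ideal.span (toJet 3 '' {x ^ 3, x ^ 2 * y, x * y ^ 2}) = _
  have h0 : toJet 3 (x ^ 3) = jt 0 0 0 0 0 0 1 0 0 0 :=
    toJet_eq_jt (by simp [cubicPoly])
  have h1 : toJet 3 (x ^ 2 * y) = jt 0 0 0 0 0 0 0 1 0 0 :=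
    toJet_eq_jt (by simp [cubicPoly])
  have h2 : toJet 3 (x * y ^ 2) = jt 0 0 0 0 0 0 0 0 1 0 :=
    toJet_eq_jt (by simp [cubicPoly])
  rw [Set.image_insert_eq, Set.image_pair, h0, h1, h2]

theorem jt_mem_models_0 {a b c d e f g h k l : ℝ} : jt a b c d e f g h k l ∈ models 0 ↔
    a = 0 ∧ b = 0 ∧ c = 0 ∧ d = 0 ∧ e = 0 ∧ f = 0 ∧ g = 0 ∧ h = 0 ∧ k = 0 ∧ l = 0
      := by
  change _ ∈ (⊥ : Ideal (JetRing 3 2)) ↔ _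
  rw [Ideal.mem_bot, ← jt_zero, jt_inj]

/-- In this and the next lemmas, multiplying the generators by arbitrary jets gives the conditions,
and conversely the cofactors are read off from the free coefficients. -/
theorem jt_mem_models_1 {a b c d e f g h k l : ℝ} : jt a b c d e f g h k l ∈ models 1 ↔
    a = 0 ∧ c = 0 ∧ f = 0 ∧ l = 0 := by
  rw [models_1_eq_span, Ideal.mem_span_singleton']
  constructor
  · rintro ⟨s₁, H⟩
    obtain ⟨a₁, b₁, c₁, d₁, e₁, f₁, g₁, h₁, k₁, l₁, rfl⟩ := exists_jt s₁
    simp only [jt_mul, jt_inj] at H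
    obtain ⟨h0, h1, h2, h3, h4, h5, h6, h7, h8, h9⟩ := H
    refine ⟨?_, ?_, ?_, ?_⟩ <;> linarith
  · rintro ⟨rfl, rfl, rfl, rfl⟩
    refine ⟨jt b d e g h k 0 0 0 0, ?_⟩
    simp only [jt_mul]
    apply jt_congr <;> ring

theorem jt_mem_models_2 {a b c d e f g h k l : ℝ} : jt a b c d e f g h k l ∈ models 2 ↔
    a = 0 ∧ b = 0 ∧ c = 0 ∧ e = 0 ∧ f = 0 ∧ k = 0 ∧ l = 0 := by
  rw [models_2_eq_span, Ideal.mem_span_singleton']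
  constructor
  · rintro ⟨s₁, H⟩
    obtain ⟨a₁, b₁, c₁, d₁, e₁, f₁, g₁, h₁, k₁, l₁, rfl⟩ := exists_jt s₁
    simp only [jt_mul, jt_inj] at H
    obtain ⟨h0, h1, h2, h3, h4, h5, h6, h7, h8, h9⟩ := H
    refine ⟨?_, ?_, ?_, ?_, ?_, ?_, ?_⟩ <;> linarith
  · rintro ⟨rfl, rfl, rfl, rfl, rfl, rfl, rfl⟩
    refine ⟨jt d g h 0 0 0 0 0 0 0, ?_⟩
    simp only [jt_mul]
    apply jt_congr <;> ring

theorem jt_mem_models_3 {a b c d e f g h k l : ℝ} : jt a b c d e f g h k l ∈ models 3 ↔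
    a = 0 ∧ b = 0 ∧ c = 0 ∧ d = 0 ∧ e = 0 ∧ f = 0 ∧ h = 0 ∧ k = 0 ∧ l = 0 := by
  rw [models_3_eq_span, Ideal.mem_span_singleton']
  constructor
  · rintro ⟨s₁, H⟩
    obtain ⟨a₁, b₁, c₁, d₁, e₁, f₁, g₁, h₁, k₁, l₁, rfl⟩ := exists_jt s₁
    simp only [jt_mul, jt_inj] at H
    obtain ⟨h0, h1, h2, h3, h4, h5, h6, h7, h8, h9⟩ := H
    refine ⟨?_, ?_, ?_, ?_, ?_, ?_, ?_, ?_, ?_⟩ <;> linarith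
  · rintro ⟨rfl, rfl, rfl, rfl, rfl, rfl, rfl, rfl, rfl⟩
    refine ⟨jt g 0 0 0 0 0 0 0 0 0, ?_⟩
    simp only [jt_mul]
    apply jt_congr <;> ring

theorem jt_mem_models_4 {a b c d e f g h k l : ℝ} : jt a b c d e f g h k l ∈ models 4 ↔
    a = 0 ∧ b = 0 ∧ c = 0 ∧ d = 0 ∧ f = 0 ∧ g = 0 ∧ l = 0 := by
  rw [models_4_eq_span, Ideal.mem_span_singleton']
  constructor
  · rintro ⟨s₁, H⟩
    obtain ⟨a₁, b₁, c₁, d₁, e₁, f₁, g₁, h₁, k₁, l₁, rfl⟩ := exists_jt s₁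
    simp only [jt_mul, jt_inj] at H
    obtain ⟨h0, h1, h2, h3, h4, h5, h6, h7, h8, h9⟩ := H
    refine ⟨?_, ?_, ?_, ?_, ?_, ?_, ?_⟩ <;> linarith
  · rintro ⟨rfl, rfl, rfl, rfl, rfl, rfl, rfl⟩
    refine ⟨jt e h k 0 0 0 0 0 0 0, ?_⟩
    simp only [jt_mul]
    apply jt_congr <;> ring

theorem jt_mem_models_5 {a b c d e f g h k l : ℝ} : jt a b c d e f g h k l ∈ models 5 ↔
    a = 0 ∧ b = 0 ∧ c = 0 ∧ d = 0 ∧ e = 0 ∧ f = 0 ∧ g = 0 ∧ k = 0 ∧ l = 0 := by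
  rw [models_5_eq_span, Ideal.mem_span_singleton']
  constructor
  · rintro ⟨s₁, H⟩
    obtain ⟨a₁, b₁, c₁, d₁, e₁, f₁, g₁, h₁, k₁, l₁, rfl⟩ := exists_jt s₁
    simp only [jt_mul, jt_inj] at H
    obtain ⟨h0, h1, h2, h3, h4, h5, h6, h7, h8, h9⟩ := H
    refine ⟨?_, ?_, ?_, ?_, ?_, ?_, ?_, ?_, ?_⟩ <;> linarith
  · rintro ⟨rfl, rfl, rfl, rfl, rfl, rfl, rfl, rfl, rfl⟩
    refine ⟨jt h 0 0 0 0 0 0 0 0 0, ?_⟩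
    simp only [jt_mul]
    apply jt_congr <;> ring

theorem jt_mem_models_6 {a b c d e f g h k l : ℝ} : jt a b c d e f g h k l ∈ models 6 ↔
    a = 0 ∧ b = 0 ∧ c = 0 ∧ d = 0 ∧ e = 0 ∧ f = 0 ∧ g = 0 ∧ l = 0 ∧ k = h := by
  rw [models_6_eq_span, Ideal.mem_span_singleton']
  constructor
  · rintro ⟨s₁, H⟩
    obtain ⟨a₁, b₁, c₁, d₁, e₁, f₁, g₁, h₁, k₁, l₁, rfl⟩ := exists_jt s₁
    simp only [jt_mul, jt_inj] at H
    obtain ⟨h0, h1, h2, h3, h4, h5, h6, h7, h8, h9⟩ := H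
    refine ⟨?_, ?_, ?_, ?_, ?_, ?_, ?_, ?_, ?_⟩ <;> linarith
  · rintro ⟨rfl, rfl, rfl, rfl, rfl, rfl, rfl, rfl, rfl⟩
    refine ⟨jt k 0 0 0 0 0 0 0 0 0, ?_⟩
    simp only [jt_mul]
    apply jt_congr <;> ring

theorem jt_mem_models_7 {a b c d e f g h k l : ℝ} : jt a b c d e f g h k l ∈ models 7 ↔
    a = 0 ∧ b = 0 ∧ c = 0 ∧ e = 0 ∧ f = 0 ∧ k = 0 ∧ l = -d := by
  rw [models_7_eq_span, Ideal.mem_span_singleton']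
  constructor
  · rintro ⟨s₁, H⟩
    obtain ⟨a₁, b₁, c₁, d₁, e₁, f₁, g₁, h₁, k₁, l₁, rfl⟩ := exists_jt s₁
    simp only [jt_mul, jt_inj] at H
    obtain ⟨h0, h1, h2, h3, h4, h5, h6, h7, h8, h9⟩ := H
    refine ⟨?_, ?_, ?_, ?_, ?_, ?_, ?_⟩ <;> linarith
  · rintro ⟨rfl, rfl, rfl, rfl, rfl, rfl, rfl⟩
    refine ⟨jt d g h 0 0 0 0 0 0 0, ?_⟩
    simp only [jt_mul]
    apply jt_congr <;> ring

theorem jt_mem_models_8 {a b c d e f g h k l : ℝ} : jt a b c d e f g h k l ∈ models 8 ↔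
    a = 0 ∧ b = 0 ∧ c = 0 ∧ f = 0 ∧ l = 0 := by
  rw [models_8_eq_span, Ideal.mem_span_pair]
  constructor
  · rintro ⟨s₁, s₂, H⟩
    obtain ⟨a₁, b₁, c₁, d₁, e₁, f₁, g₁, h₁, k₁, l₁, rfl⟩ := exists_jt s₁
    obtain ⟨a₂, b₂, c₂, d₂, e₂, f₂, g₂, h₂, k₂, l₂, rfl⟩ := exists_jt s₂
    simp only [jt_mul, jt_add, jt_inj] at H
    obtain ⟨h0, h1, h2, h3, h4, h5, h6, h7, h8, h9⟩ := H
    refine ⟨?_, ?_, ?_, ?_, ?_⟩ <;> linarith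
  · rintro ⟨rfl, rfl, rfl, rfl, rfl⟩
    refine ⟨jt d g h 0 0 0 0 0 0 0, jt e 0 k 0 0 0 0 0 0 0, ?_⟩
    simp only [jt_mul, jt_add]
    apply jt_congr <;> ring

theorem jt_mem_models_9 {a b c d e f g h k l : ℝ} : jt a b c d e f g h k l ∈ models 9 ↔
    a = 0 ∧ b = 0 ∧ c = 0 ∧ e = 0 ∧ f = 0 ∧ l = 0 := by
  rw [models_9_eq_span, Ideal.mem_span_pair]
  constructor
  · rintro ⟨s₁, s₂, H⟩
    obtain ⟨a₁, b₁, c₁, d₁, e₁, f₁, g₁, h₁, k₁, l₁, rfl⟩ := exists_jt s₁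
    obtain ⟨a₂, b₂, c₂, d₂, e₂, f₂, g₂, h₂, k₂, l₂, rfl⟩ := exists_jt s₂
    simp only [jt_mul, jt_add, jt_inj] at H
    obtain ⟨h0, h1, h2, h3, h4, h5, h6, h7, h8, h9⟩ := H
    refine ⟨?_, ?_, ?_, ?_, ?_, ?_⟩ <;> linarith
  · rintro ⟨rfl, rfl, rfl, rfl, rfl, rfl⟩
    refine ⟨jt d g h 0 0 0 0 0 0 0, jt k 0 0 0 0 0 0 0 0 0, ?_⟩
    simp only [jt_mul, jt_add]
    apply jt_congr <;> ring

theorem jt_mem_models_10 {a b c d e f g h k l : ℝ} : jt a b c d e f g h k l ∈ models 10 ↔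
    a = 0 ∧ b = 0 ∧ c = 0 ∧ d = 0 ∧ e = 0 ∧ f = 0 ∧ g = 0 ∧ l = 0 := by
  rw [models_10_eq_span, Ideal.mem_span_pair]
  constructor
  · rintro ⟨s₁, s₂, H⟩
    obtain ⟨a₁, b₁, c₁, d₁, e₁, f₁, g₁, h₁, k₁, l₁, rfl⟩ := exists_jt s₁
    obtain ⟨a₂, b₂, c₂, d₂, e₂, f₂, g₂, h₂, k₂, l₂, rfl⟩ := exists_jt s₂
    simp only [jt_mul, jt_add, jt_inj] at H
    obtain ⟨h0, h1, h2, h3, h4, h5, h6, h7, h8, h9⟩ := H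
    refine ⟨?_, ?_, ?_, ?_, ?_, ?_, ?_, ?_⟩ <;> linarith
  · rintro ⟨rfl, rfl, rfl, rfl, rfl, rfl, rfl, rfl⟩
    refine ⟨jt h 0 0 0 0 0 0 0 0 0, jt k 0 0 0 0 0 0 0 0 0, ?_⟩
    simp only [jt_mul, jt_add]
    apply jt_congr <;> ring

theorem jt_mem_models_11 {a b c d e f g h k l : ℝ} : jt a b c d e f g h k l ∈ models 11 ↔
    a = 0 ∧ b = 0 ∧ c = 0 ∧ d = 0 ∧ e = 0 ∧ f = 0 ∧ k = 0 ∧ l = 0 := by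
  rw [models_11_eq_span, Ideal.mem_span_pair]
  constructor
  · rintro ⟨s₁, s₂, H⟩
    obtain ⟨a₁, b₁, c₁, d₁, e₁, f₁, g₁, h₁, k₁, l₁, rfl⟩ := exists_jt s₁
    obtain ⟨a₂, b₂, c₂, d₂, e₂, f₂, g₂, h₂, k₂, l₂, rfl⟩ := exists_jt s₂
    simp only [jt_mul, jt_add, jt_inj] at H
    obtain ⟨h0, h1, h2, h3, h4, h5, h6, h7, h8, h9⟩ := H
    refine ⟨?_, ?_, ?_, ?_, ?_, ?_, ?_, ?_⟩ <;> linarith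
  · rintro ⟨rfl, rfl, rfl, rfl, rfl, rfl, rfl, rfl⟩
    refine ⟨jt g 0 0 0 0 0 0 0 0 0, jt h 0 0 0 0 0 0 0 0 0, ?_⟩
    simp only [jt_mul, jt_add]
    apply jt_congr <;> ring

theorem jt_mem_models_12 {a b c d e f g h k l : ℝ} : jt a b c d e f g h k l ∈ models 12 ↔
    a = 0 ∧ b = 0 ∧ c = 0 ∧ e = 0 ∧ f = 0 ∧ l = -d := by
  rw [models_12_eq_span, Ideal.mem_span_pair]
  constructor
  · rintro ⟨s₁, s₂, H⟩
    obtain ⟨a₁, b₁, c₁, d₁, e₁, f₁, g₁, h₁, k₁, l₁, rfl⟩ := exists_jt s₁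
    obtain ⟨a₂, b₂, c₂, d₂, e₂, f₂, g₂, h₂, k₂, l₂, rfl⟩ := exists_jt s₂
    simp only [jt_mul, jt_add, jt_inj] at H
    obtain ⟨h0, h1, h2, h3, h4, h5, h6, h7, h8, h9⟩ := H
    refine ⟨?_, ?_, ?_, ?_, ?_, ?_⟩ <;> linarith
  · rintro ⟨rfl, rfl, rfl, rfl, rfl, rfl⟩
    refine ⟨jt d g h 0 0 0 0 0 0 0, jt k 0 0 0 0 0 0 0 0 0, ?_⟩
    simp only [jt_mul, jt_add]
    apply jt_congr <;> ring

theorem jt_mem_models_13 {a b c d e f g h k l : ℝ} : jt a b c d e f g h k l ∈ models 13 ↔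
    a = 0 := by
  rw [models_13_eq_span, Ideal.mem_span_pair]
  constructor
  · rintro ⟨s₁, s₂, H⟩
    obtain ⟨a₁, b₁, c₁, d₁, e₁, f₁, g₁, h₁, k₁, l₁, rfl⟩ := exists_jt s₁
    obtain ⟨a₂, b₂, c₂, d₂, e₂, f₂, g₂, h₂, k₂, l₂, rfl⟩ := exists_jt s₂
    simp only [jt_mul, jt_add, jt_inj] at H
    obtain ⟨h0, h1, h2, h3, h4, h5, h6, h7, h8, h9⟩ := H
    linarith
  · rintro rfl
    refine ⟨jt b d e g h k 0 0 0 0, jt c 0 f 0 0 l 0 0 0 0, ?_⟩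
    simp only [jt_mul, jt_add]
    apply jt_congr <;> ring

theorem jt_mem_models_14 {a b c d e f g h k l : ℝ} : jt a b c d e f g h k l ∈ models 14 ↔
    a = 0 ∧ b = 0 ∧ c = 0 ∧ d = 0 ∧ e = 0 ∧ f = 0 ∧ l = 0 := by
  rw [models_14_eq_span, Ideal.mem_span_insert]
  simp only [Ideal.mem_span_pair]
  constructor
  · rintro ⟨s₁, _, ⟨s₂, s₃, rfl⟩, H⟩
    obtain ⟨a₁, b₁, c₁, d₁, e₁, f₁, g₁, h₁, k₁, l₁, rfl⟩ := exists_jt s₁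
    obtain ⟨a₂, b₂, c₂, d₂, e₂, f₂, g₂, h₂, k₂, l₂, rfl⟩ := exists_jt s₂
    obtain ⟨a₃, b₃, c₃, d₃, e₃, f₃, g₃, h₃, k₃, l₃, rfl⟩ := exists_jt s₃
    simp only [jt_mul, jt_add, jt_inj] at H
    obtain ⟨h0, h1, h2, h3, h4, h5, h6, h7, h8, h9⟩ := H
    refine ⟨?_, ?_, ?_, ?_, ?_, ?_, ?_⟩ <;> linarith
  · rintro ⟨rfl, rfl, rfl, rfl, rfl, rfl, rfl⟩
    refine ⟨jt g 0 0 0 0 0 0 0 0 0, _, ⟨jt h 0 0 0 0 0 0 0 0 0, jt k 0 0 0 0 0 0 0 0 0, rfl⟩,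
      ?_⟩
    simp only [jt_mul, jt_add]
    apply jt_congr <;> ring

end ClosedJetIdeals

end

/-! ### Ring-theoretic invariants and non-equivalence of the models. -/

noncomputable section

namespace ClosedJetIdeals

section RingInvariants

variable {R : Type*} [CommRing R]

/-- In the ring of `3`-jets: the jets that vanish at the origin. -/
def IsSmall (p : R) : Prop := p * p * (p * p) = 0

/-- In the ring of `3`-jets: the jets of order exactly one. -/
def IsParameter (p : R) : Prop := IsSmall p ∧ ∃ q r, IsSmall q ∧ IsSmall r ∧ p * q * r ≠ 0

/-- In the ring of `3`-jets: the cubic forms. -/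
def IsSocle (p : R) : Prop := IsSmall p ∧ ∀ q, IsSmall q → p * q = 0

/-- Being a jet of order one is a ring-theoretic notion, so this and the following properties
survive ring automorphisms. In each positive case below the witnesses are x and y. -/
def HasParameter (I : Ideal R) : Prop := ∃ u ∈ I, IsParameter u

def HasSquare (I : Ideal R) : Prop := ∃ u, IsParameter u ∧ u * u ∈ I

def HasProduct (I : Ideal R) : Prop := ∃ u v, IsParameter u ∧ IsParameter v ∧ u * v ∈ I

def HasCube (I : Ideal R) : Prop := ∃ u, IsParameter u ∧ u * u * u ∈ I

def HasSquareProduct (I : Ideal R) : Prop :=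
  ∃ u v, IsParameter u ∧ IsParameter v ∧ u * u * v ∈ I

def HasAllMultiples (I : Ideal R) : Prop := ∃ u, IsParameter u ∧ ∀ q, IsSmall q → u * q ∈ I

def HasAllDoubleMultiples (I : Ideal R) : Prop :=
  ∃ u, IsParameter u ∧ ∀ q r, IsSmall q → IsSmall r → u * q * r ∈ I

def HasSquareMultiples (I : Ideal R) : Prop :=
  ∃ u, IsParameter u ∧ ∀ q, IsSmall q → u * u * q ∈ I

def HasProductMultiples (I : Ideal R) : Prop :=
  ∃ u v, IsParameter u ∧ IsParameter v ∧ ∀ q, IsSmall q → u * v * q ∈ I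

open Classical in
/-- A number attached to an ideal of a ring in terms of the ring structure alone. It tells the
fifteen model ideals apart. -/
def invariantKey (I : Ideal R) : ℕ :=
  if ∀ p ∈ I, IsSocle p then
    if ∀ p ∈ I, p = 0 then 0
    -- The tests are not mutually exclusive and their order matters: `models 11` and `models 14`
    -- also contain a cube, so they are split off before the cube test.
    else if HasAllDoubleMultiples I then 14
    else if HasSquareMultiples I then 11
    else if HasCube I then 3
    else if HasProductMultiples I then 10
    else if HasSquareProduct I then 5
    else 6
  else if HasParameter I then
    if ∀ p, IsSmall p → p ∈ I then 13 else 1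
  else if HasSquare I then
    if HasAllMultiples I then 8 else if HasAllDoubleMultiples I then 9 else 2
  else if HasProduct I then 4
  else if HasAllDoubleMultiples I then 12
  else 7

theorem isSmall_map_iff (Φ : R ≃+* R) (p : R) : IsSmall (Φ p) ↔ IsSmall p := by
  simp only [IsSmall, ← map_mul, map_eq_zero_iff Φ Φ.injective]

variable {Φ : R ≃+* R} {I J : Ideal R}

/-- Every small element is the image of a small element, so universally quantified conditions
transport along an isomorphism. -/
theorem forall_isSmall_of_map (Φ : R ≃+* R) {P : R → Prop}
    (H : ∀ q, IsSmall q → P (Φ q)) (q : R) (hq : IsSmall q) : P q := by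
  have := H (Φ.symm q) ((isSmall_map_iff Φ.symm q).2 hq)
  rwa [RingEquiv.apply_symm_apply] at this

theorem IsParameter.map {p : R} (hp : IsParameter p) (Φ : R ≃+* R) : IsParameter (Φ p) := by
  obtain ⟨hs, q, r, hq, hr, H⟩ := hp
  refine ⟨(isSmall_map_iff Φ p).2 hs, Φ q, Φ r, (isSmall_map_iff Φ q).2 hq,
    (isSmall_map_iff Φ r).2 hr, ?_⟩
  rwa [← map_mul, ← map_mul, map_ne_zero_iff Φ Φ.injective]

theorem IsSocle.map {p : R} (hp : IsSocle p) (Φ : R ≃+* R) : IsSocle (Φ p) := by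
  refine ⟨(isSmall_map_iff Φ p).2 hp.1, forall_isSmall_of_map Φ fun q hq => ?_⟩
  rw [← map_mul, hp.2 q hq, map_zero]

theorem mem_iff_symm (h : ∀ p, Φ p ∈ J ↔ p ∈ I) (p : R) : Φ.symm p ∈ I ↔ p ∈ J := by
  rw [← h, RingEquiv.apply_symm_apply]

theorem forall_isSocle_map (h : ∀ p, Φ p ∈ J ↔ p ∈ I) (H : ∀ p ∈ I, IsSocle p) :
    ∀ p ∈ J, IsSocle p := fun p hp => by
  have := (H _ ((mem_iff_symm h p).2 hp)).map Φ
  rwa [RingEquiv.apply_symm_apply] at this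

theorem forall_eq_zero_map (h : ∀ p, Φ p ∈ J ↔ p ∈ I) (H : ∀ p ∈ I, p = 0) :
    ∀ p ∈ J, p = 0 := fun p hp =>
  (map_eq_zero_iff Φ.symm Φ.symm.injective).1 (H _ ((mem_iff_symm h p).2 hp))

theorem forall_isSmall_mem_map (h : ∀ p, Φ p ∈ J ↔ p ∈ I) (H : ∀ p, IsSmall p → p ∈ I) :
    ∀ p, IsSmall p → p ∈ J :=
  forall_isSmall_of_map Φ fun p hp => (h p).2 (H p hp)

theorem HasParameter.map (h : ∀ p, Φ p ∈ J ↔ p ∈ I) : HasParameter I → HasParameter J :=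
  fun ⟨u, hu, H⟩ => ⟨Φ u, (h u).2 hu, H.map Φ⟩

theorem HasSquare.map (h : ∀ p, Φ p ∈ J ↔ p ∈ I) : HasSquare I → HasSquare J :=
  fun ⟨u, hu, H⟩ => ⟨Φ u, hu.map Φ, by rwa [← map_mul, h]⟩

theorem HasProduct.map (h : ∀ p, Φ p ∈ J ↔ p ∈ I) : HasProduct I → HasProduct J :=
  fun ⟨u, v, hu, hv, H⟩ => ⟨Φ u, Φ v, hu.map Φ, hv.map Φ, by rwa [← map_mul, h]⟩

theorem HasCube.map (h : ∀ p, Φ p ∈ J ↔ p ∈ I) : HasCube I → HasCube J :=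
  fun ⟨u, hu, H⟩ => ⟨Φ u, hu.map Φ, by rwa [← map_mul, ← map_mul, h]⟩

theorem HasSquareProduct.map (h : ∀ p, Φ p ∈ J ↔ p ∈ I) :
    HasSquareProduct I → HasSquareProduct J :=
  fun ⟨u, v, hu, hv, H⟩ => ⟨Φ u, Φ v, hu.map Φ, hv.map Φ, by rwa [← map_mul, ← map_mul, h]⟩

theorem HasAllMultiples.map (h : ∀ p, Φ p ∈ J ↔ p ∈ I) :
    HasAllMultiples I → HasAllMultiples J :=
  fun ⟨u, hu, H⟩ => ⟨Φ u, hu.map Φ, forall_isSmall_of_map Φ fun q hq => by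
    rw [← map_mul, h]
    exact H q hq⟩

theorem HasAllDoubleMultiples.map (h : ∀ p, Φ p ∈ J ↔ p ∈ I) :
    HasAllDoubleMultiples I → HasAllDoubleMultiples J :=
  fun ⟨u, hu, H⟩ => ⟨Φ u, hu.map Φ, fun q r hq => forall_isSmall_of_map Φ (P := fun r => Φ u * q * r ∈ J) (fun r hr =>
    forall_isSmall_of_map Φ (P := fun q => Φ u * q * Φ r ∈ J) (fun q hq => by
      rw [← map_mul, ← map_mul, h]
      exact H q r hq hr) q hq) r⟩

theorem HasSquareMultiples.map (h : ∀ p, Φ p ∈ J ↔ p ∈ I) :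
    HasSquareMultiples I → HasSquareMultiples J :=
  fun ⟨u, hu, H⟩ => ⟨Φ u, hu.map Φ, forall_isSmall_of_map Φ fun q hq => by
    rw [← map_mul, ← map_mul, h]
    exact H q hq⟩

theorem HasProductMultiples.map (h : ∀ p, Φ p ∈ J ↔ p ∈ I) :
    HasProductMultiples I → HasProductMultiples J :=
  fun ⟨u, v, hu, hv, H⟩ => ⟨Φ u, Φ v, hu.map Φ, hv.map Φ, forall_isSmall_of_map Φ fun q hq => by
    rw [← map_mul, ← map_mul, h]
    exact H q hq⟩

theorem invariantKey_eq (Φ : R ≃+* R) (h : ∀ p, Φ p ∈ J ↔ p ∈ I) :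
    invariantKey J = invariantKey I := by
  have h' := mem_iff_symm h
  have e1 : (∀ p ∈ J, IsSocle p) ↔ ∀ p ∈ I, IsSocle p :=
    ⟨forall_isSocle_map h', forall_isSocle_map h⟩
  have e2 : (∀ p ∈ J, p = 0) ↔ ∀ p ∈ I, p = 0 := ⟨forall_eq_zero_map h', forall_eq_zero_map h⟩
  have e3 : (∀ p, IsSmall p → p ∈ J) ↔ ∀ p, IsSmall p → p ∈ I :=
    ⟨forall_isSmall_mem_map h', forall_isSmall_mem_map h⟩
  have e4 : HasParameter J ↔ HasParameter I := ⟨.map h', .map h⟩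
  have e5 : HasSquare J ↔ HasSquare I := ⟨.map h', .map h⟩
  have e6 : HasProduct J ↔ HasProduct I := ⟨.map h', .map h⟩
  have e7 : HasCube J ↔ HasCube I := ⟨.map h', .map h⟩
  have e8 : HasSquareProduct J ↔ HasSquareProduct I := ⟨.map h', .map h⟩
  have e9 : HasAllMultiples J ↔ HasAllMultiples I := ⟨.map h', .map h⟩
  have e10 : HasAllDoubleMultiples J ↔ HasAllDoubleMultiples I := ⟨.map h', .map h⟩
  have e11 : HasSquareMultiples J ↔ HasSquareMultiples I := ⟨.map h', .map h⟩
  have e12 : HasProductMultiples J ↔ HasProductMultiples I := ⟨.map h', .map h⟩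
  classical
  exact if_congr e1
    (if_congr e2 rfl (if_congr e10 rfl (if_congr e11 rfl (if_congr e7 rfl (if_congr e12 rfl
      (if_congr e8 rfl rfl))))))
    (if_congr e4 (if_congr e3 rfl rfl) (if_congr e5 (if_congr e9 rfl (if_congr e10 rfl rfl))
      (if_congr e6 rfl (if_congr e10 rfl rfl))))

end RingInvariants

theorem Equivalent.invariantKey_eq {I J : Ideal (JetRing 3 2)} (h : Equivalent I J) :
    invariantKey J = invariantKey I := by
  obtain ⟨φ, rfl⟩ := equivalent_iff.1 h
  exact ClosedJetIdeals.invariantKey_eq φ.pull fun p => pull_mem_map φ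

theorem jt_eq_zero {a b c d e f g h k l : ℝ} : jt a b c d e f g h k l = 0 ↔
    a = 0 ∧ b = 0 ∧ c = 0 ∧ d = 0 ∧ e = 0 ∧ f = 0 ∧ g = 0 ∧ h = 0 ∧ k = 0 ∧ l = 0 := by
  rw [← jt_zero, jt_inj]

theorem isSmall_jt {a b c d e f g h k l : ℝ} : IsSmall (jt a b c d e f g h k l) ↔ a = 0 := by
  simp only [IsSmall, jt_mul, jt_eq_zero]
  constructor
  · rintro ⟨H, -⟩
    simpa using H
  · rintro rfl
    simp

theorem isSmall_fst : IsSmall (jt 0 1 0 0 0 0 0 0 0 0) := isSmall_jt.2 rfl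

theorem isSmall_snd : IsSmall (jt 0 0 1 0 0 0 0 0 0 0) := isSmall_jt.2 rfl

/-- A jet of order at least two times two small jets has order at least four. If the linear part is
not zero, the product with x² or y² is a non-zero cubic. -/
theorem isParameter_jt {a b c d e f g h k l : ℝ} :
    IsParameter (jt a b c d e f g h k l) ↔ a = 0 ∧ (b ≠ 0 ∨ c ≠ 0) := by
  rw [IsParameter, isSmall_jt]
  refine and_congr_right ?_
  rintro rfl
  constructor
  · rintro ⟨q, r, hq, hr, H⟩
    obtain ⟨a₁, b₁, c₁, d₁, e₁, f₁, g₁, h₁, k₁, l₁, rfl⟩ := exists_jt q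
    obtain ⟨a₂, b₂, c₂, d₂, e₂, f₂, g₂, h₂, k₂, l₂, rfl⟩ := exists_jt r
    obtain rfl := isSmall_jt.1 hq
    obtain rfl := isSmall_jt.1 hr
    by_contra! hbc
    obtain ⟨rfl, rfl⟩ := hbc
    apply H
    simp only [jt_mul, jt_eq_zero]
    simp
  · rintro (H | H)
    · refine ⟨_, _, isSmall_fst, isSmall_fst, ?_⟩
      simp [jt_mul, jt_eq_zero, H]
    · refine ⟨_, _, isSmall_snd, isSmall_snd, ?_⟩
      simp [jt_mul, jt_eq_zero, H]

theorem isSocle_jt {a b c d e f g h k l : ℝ} : IsSocle (jt a b c d e f g h k l) ↔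
    a = 0 ∧ b = 0 ∧ c = 0 ∧ d = 0 ∧ e = 0 ∧ f = 0 := by
  rw [IsSocle, isSmall_jt]
  constructor
  · rintro ⟨rfl, H⟩
    have h1 := H _ isSmall_fst
    have h2 := H _ isSmall_snd
    simp [jt_mul, jt_eq_zero] at h1 h2
    simp_all
  · rintro ⟨rfl, rfl, rfl, rfl, rfl, rfl⟩
    refine ⟨rfl, fun q hq => ?_⟩
    obtain ⟨a₁, b₁, c₁, d₁, e₁, f₁, g₁, h₁, k₁, l₁, rfl⟩ := exists_jt q
    obtain rfl := isSmall_jt.1 hq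
    simp [jt_mul, jt_eq_zero]

theorem isParameter_fst : IsParameter (jt 0 1 0 0 0 0 0 0 0 0) := isParameter_jt.2 (by simp)

theorem isParameter_snd : IsParameter (jt 0 0 1 0 0 0 0 0 0 0) := isParameter_jt.2 (by simp)

theorem invariantKey_models_0 : invariantKey (models 0) = 0 := by
  rw [invariantKey, if_pos ?_, if_pos ?_]
  · exact fun p hp => hp
  · intro p hp
    obtain ⟨a, b, c, d, e, f, g, h, k, l, rfl⟩ := exists_jt p
    rw [jt_mem_models_0] at hp
    rw [isSocle_jt]
    simp [hp]

theorem invariantKey_models_1 : invariantKey (models 1) = 1 := by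
  rw [invariantKey, if_neg ?_, if_pos ?_, if_neg ?_]
  · intro H
    have := jt_mem_models_1.1 (H _ isSmall_snd)
    simp at this
  · exact ⟨_, jt_mem_models_1.2 (by simp), isParameter_fst⟩
  · intro H
    have := isSocle_jt.1 (H (jt 0 1 0 0 0 0 0 0 0 0) (jt_mem_models_1.2 (by simp)))
    simp at this

theorem invariantKey_models_2 : invariantKey (models 2) = 2 := by
  rw [invariantKey, if_neg ?_, if_neg ?_, if_pos ?_, if_neg ?_, if_neg ?_]
  · rintro ⟨u, hu, H⟩
    obtain ⟨a, b, c, d, e, f, g, h, k, l, rfl⟩ := exists_jt u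
    obtain ⟨rfl, hu⟩ := isParameter_jt.1 hu
    -- Testing against monomials in x and y is enough: it gives polynomial equations that force the
    -- linear part of u to vanish. The other negative cases argue alike.
    have h1 := H _ _ isSmall_fst isSmall_fst
    have h2 := H _ _ isSmall_fst isSmall_snd
    have h3 := H _ _ isSmall_snd isSmall_snd
    simp [jt_mul, jt_mem_models_2] at h1 h2 h3
    clear H
    grind
  · rintro ⟨u, hu, H⟩
    obtain ⟨a, b, c, d, e, f, g, h, k, l, rfl⟩ := exists_jt u
    obtain ⟨rfl, hu⟩ := isParameter_jt.1 hu
    have h1 := H _ isSmall_fst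
    have h2 := H _ isSmall_snd
    simp [jt_mul, jt_mem_models_2] at h1 h2
    clear H
    grind
  · refine ⟨_, isParameter_fst, ?_⟩
    simp [jt_mul, jt_mem_models_2]
  · rintro ⟨u, H, hu⟩
    obtain ⟨a, b, c, d, e, f, g, h, k, l, rfl⟩ := exists_jt u
    obtain ⟨rfl, hu⟩ := isParameter_jt.1 hu
    simp [jt_mem_models_2] at H
    grind
  · intro H
    have := isSocle_jt.1 (H (jt 0 0 0 1 0 0 0 0 0 0) (jt_mem_models_2.2 (by simp)))
    simp at this

theorem invariantKey_models_3 : invariantKey (models 3) = 3 := by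
  rw [invariantKey, if_pos ?_, if_neg ?_, if_neg ?_, if_neg ?_, if_pos ?_]
  · refine ⟨_, isParameter_fst, ?_⟩
    simp [jt_mul, jt_mem_models_3]
  · rintro ⟨u, hu, H⟩
    obtain ⟨a, b, c, d, e, f, g, h, k, l, rfl⟩ := exists_jt u
    obtain ⟨rfl, hu⟩ := isParameter_jt.1 hu
    have h1 := H _ isSmall_fst
    have h2 := H _ isSmall_snd
    simp [jt_mul, jt_mem_models_3] at h1 h2
    clear H
    grind
  · rintro ⟨u, hu, H⟩
    obtain ⟨a, b, c, d, e, f, g, h, k, l, rfl⟩ := exists_jt u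
    obtain ⟨rfl, hu⟩ := isParameter_jt.1 hu
    have h1 := H _ _ isSmall_fst isSmall_fst
    have h2 := H _ _ isSmall_fst isSmall_snd
    have h3 := H _ _ isSmall_snd isSmall_snd
    simp [jt_mul, jt_mem_models_3] at h1 h2 h3
    clear H
    grind
  · intro H
    have := jt_eq_zero.1 (H (jt 0 0 0 0 0 0 1 0 0 0) (jt_mem_models_3.2 (by simp)))
    simp at this
  · intro p hp
    obtain ⟨a, b, c, d, e, f, g, h, k, l, rfl⟩ := exists_jt p
    rw [jt_mem_models_3] at hp
    rw [isSocle_jt]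
    simp [hp]

theorem invariantKey_models_4 : invariantKey (models 4) = 4 := by
  rw [invariantKey, if_neg ?_, if_neg ?_, if_neg ?_, if_pos ?_]
  · refine ⟨_, _, isParameter_fst, isParameter_snd, ?_⟩
    simp [jt_mul, jt_mem_models_4]
  · rintro ⟨u, hu, H⟩
    obtain ⟨a, b, c, d, e, f, g, h, k, l, rfl⟩ := exists_jt u
    obtain ⟨rfl, hu⟩ := isParameter_jt.1 hu
    simp [jt_mul, jt_mem_models_4] at H
    grind
  · rintro ⟨u, H, hu⟩
    obtain ⟨a, b, c, d, e, f, g, h, k, l, rfl⟩ := exists_jt u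
    obtain ⟨rfl, hu⟩ := isParameter_jt.1 hu
    simp [jt_mem_models_4] at H
    grind
  · intro H
    have := isSocle_jt.1 (H (jt 0 0 0 0 1 0 0 0 0 0) (jt_mem_models_4.2 (by simp)))
    simp at this

theorem invariantKey_models_5 : invariantKey (models 5) = 5 := by
  rw [invariantKey, if_pos ?_, if_neg ?_, if_neg ?_, if_neg ?_, if_neg ?_, if_neg ?_, if_pos ?_]
  · refine ⟨_, _, isParameter_fst, isParameter_snd, ?_⟩
    simp [jt_mul, jt_mem_models_5]
  · rintro ⟨u, v, hu, hv, H⟩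
    obtain ⟨a, b, c, d, e, f, g, h, k, l, rfl⟩ := exists_jt u
    obtain ⟨rfl, hu⟩ := isParameter_jt.1 hu
    obtain ⟨a', b', c', d', e', f', g', h', k', l', rfl⟩ := exists_jt v
    obtain ⟨rfl, hv⟩ := isParameter_jt.1 hv
    have h1 := H _ isSmall_fst
    have h2 := H _ isSmall_snd
    simp [jt_mul, jt_mem_models_5] at h1 h2
    clear H
    grind
  · rintro ⟨u, hu, H⟩
    obtain ⟨a, b, c, d, e, f, g, h, k, l, rfl⟩ := exists_jt u
    obtain ⟨rfl, hu⟩ := isParameter_jt.1 hu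
    simp [jt_mul, jt_mem_models_5] at H
    grind
  · rintro ⟨u, hu, H⟩
    obtain ⟨a, b, c, d, e, f, g, h, k, l, rfl⟩ := exists_jt u
    obtain ⟨rfl, hu⟩ := isParameter_jt.1 hu
    have h1 := H _ isSmall_fst
    have h2 := H _ isSmall_snd
    simp [jt_mul, jt_mem_models_5] at h1 h2
    clear H
    grind
  · rintro ⟨u, hu, H⟩
    obtain ⟨a, b, c, d, e, f, g, h, k, l, rfl⟩ := exists_jt u
    obtain ⟨rfl, hu⟩ := isParameter_jt.1 hu
    have h1 := H _ _ isSmall_fst isSmall_fst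
    have h2 := H _ _ isSmall_fst isSmall_snd
    have h3 := H _ _ isSmall_snd isSmall_snd
    simp [jt_mul, jt_mem_models_5] at h1 h2 h3
    clear H
    grind
  · intro H
    have := jt_eq_zero.1 (H (jt 0 0 0 0 0 0 0 1 0 0) (jt_mem_models_5.2 (by simp)))
    simp at this
  · intro p hp
    obtain ⟨a, b, c, d, e, f, g, h, k, l, rfl⟩ := exists_jt p
    rw [jt_mem_models_5] at hp
    rw [isSocle_jt]
    simp [hp]

theorem invariantKey_models_6 : invariantKey (models 6) = 6 := by
  rw [invariantKey, if_pos ?_, if_neg ?_, if_neg ?_, if_neg ?_, if_neg ?_, if_neg ?_, if_neg ?_]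
  · rintro ⟨u, v, hu, hv, H⟩
    obtain ⟨a, b, c, d, e, f, g, h, k, l, rfl⟩ := exists_jt u
    obtain ⟨rfl, hu⟩ := isParameter_jt.1 hu
    obtain ⟨a', b', c', d', e', f', g', h', k', l', rfl⟩ := exists_jt v
    obtain ⟨rfl, hv⟩ := isParameter_jt.1 hv
    simp [jt_mul, jt_mem_models_6] at H
    grind
  · rintro ⟨u, v, hu, hv, H⟩
    obtain ⟨a, b, c, d, e, f, g, h, k, l, rfl⟩ := exists_jt u
    obtain ⟨rfl, hu⟩ := isParameter_jt.1 hu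
    obtain ⟨a', b', c', d', e', f', g', h', k', l', rfl⟩ := exists_jt v
    obtain ⟨rfl, hv⟩ := isParameter_jt.1 hv
    have h1 := H _ isSmall_fst
    have h2 := H _ isSmall_snd
    simp [jt_mul, jt_mem_models_6] at h1 h2
    clear H
    grind
  · rintro ⟨u, hu, H⟩
    obtain ⟨a, b, c, d, e, f, g, h, k, l, rfl⟩ := exists_jt u
    obtain ⟨rfl, hu⟩ := isParameter_jt.1 hu
    simp [jt_mul, jt_mem_models_6] at H
    grind
  · rintro ⟨u, hu, H⟩
    obtain ⟨a, b, c, d, e, f, g, h, k, l, rfl⟩ := exists_jt u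
    obtain ⟨rfl, hu⟩ := isParameter_jt.1 hu
    have h1 := H _ isSmall_fst
    have h2 := H _ isSmall_snd
    simp [jt_mul, jt_mem_models_6] at h1 h2
    clear H
    grind
  · rintro ⟨u, hu, H⟩
    obtain ⟨a, b, c, d, e, f, g, h, k, l, rfl⟩ := exists_jt u
    obtain ⟨rfl, hu⟩ := isParameter_jt.1 hu
    have h1 := H _ _ isSmall_fst isSmall_fst
    have h2 := H _ _ isSmall_fst isSmall_snd
    have h3 := H _ _ isSmall_snd isSmall_snd
    simp [jt_mul, jt_mem_models_6] at h1 h2 h3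
    clear H
    grind
  · intro H
    have := jt_eq_zero.1 (H (jt 0 0 0 0 0 0 0 1 1 0) (jt_mem_models_6.2 (by simp)))
    simp at this
  · intro p hp
    obtain ⟨a, b, c, d, e, f, g, h, k, l, rfl⟩ := exists_jt p
    rw [jt_mem_models_6] at hp
    rw [isSocle_jt]
    simp [hp]

theorem invariantKey_models_7 : invariantKey (models 7) = 7 := by
  rw [invariantKey, if_neg ?_, if_neg ?_, if_neg ?_, if_neg ?_, if_neg ?_]
  · rintro ⟨u, hu, H⟩
    obtain ⟨a, b, c, d, e, f, g, h, k, l, rfl⟩ := exists_jt u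
    obtain ⟨rfl, hu⟩ := isParameter_jt.1 hu
    have h1 := H _ _ isSmall_fst isSmall_fst
    have h2 := H _ _ isSmall_fst isSmall_snd
    have h3 := H _ _ isSmall_snd isSmall_snd
    simp [jt_mul, jt_mem_models_7] at h1 h2 h3
    clear H
    grind
  · rintro ⟨u, v, hu, hv, H⟩
    obtain ⟨a, b, c, d, e, f, g, h, k, l, rfl⟩ := exists_jt u
    obtain ⟨rfl, hu⟩ := isParameter_jt.1 hu
    obtain ⟨a', b', c', d', e', f', g', h', k', l', rfl⟩ := exists_jt v
    obtain ⟨rfl, hv⟩ := isParameter_jt.1 hv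
    simp [jt_mul, jt_mem_models_7] at H
    grind
  · rintro ⟨u, hu, H⟩
    obtain ⟨a, b, c, d, e, f, g, h, k, l, rfl⟩ := exists_jt u
    obtain ⟨rfl, hu⟩ := isParameter_jt.1 hu
    simp [jt_mul, jt_mem_models_7] at H
    grind
  · rintro ⟨u, H, hu⟩
    obtain ⟨a, b, c, d, e, f, g, h, k, l, rfl⟩ := exists_jt u
    obtain ⟨rfl, hu⟩ := isParameter_jt.1 hu
    simp [jt_mem_models_7] at H
    grind
  · intro H
    have := isSocle_jt.1 (H (jt 0 0 0 1 0 0 0 0 0 (-1)) (jt_mem_models_7.2 (by simp)))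
    simp at this

theorem invariantKey_models_8 : invariantKey (models 8) = 8 := by
  rw [invariantKey, if_neg ?_, if_neg ?_, if_pos ?_, if_pos ?_]
  · refine ⟨_, isParameter_fst, fun q hq => ?_⟩
    obtain ⟨a, b, c, d, e, f, g, h, k, l, rfl⟩ := exists_jt q
    obtain rfl := isSmall_jt.1 hq
    simp [jt_mul, jt_mem_models_8]
  · refine ⟨_, isParameter_fst, ?_⟩
    simp [jt_mul, jt_mem_models_8]
  · rintro ⟨u, H, hu⟩
    obtain ⟨a, b, c, d, e, f, g, h, k, l, rfl⟩ := exists_jt u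
    obtain ⟨rfl, hu⟩ := isParameter_jt.1 hu
    simp [jt_mem_models_8] at H
    grind
  · intro H
    have := isSocle_jt.1 (H (jt 0 0 0 1 0 0 0 0 0 0) (jt_mem_models_8.2 (by simp)))
    simp at this

theorem invariantKey_models_9 : invariantKey (models 9) = 9 := by
  rw [invariantKey, if_neg ?_, if_neg ?_, if_pos ?_, if_neg ?_, if_pos ?_]
  · refine ⟨_, isParameter_fst, fun q r hq hr => ?_⟩
    obtain ⟨a, b, c, d, e, f, g, h, k, l, rfl⟩ := exists_jt q
    obtain rfl := isSmall_jt.1 hq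
    obtain ⟨a', b', c', d', e', f', g', h', k', l', rfl⟩ := exists_jt r
    obtain rfl := isSmall_jt.1 hr
    simp [jt_mul, jt_mem_models_9]
  · rintro ⟨u, hu, H⟩
    obtain ⟨a, b, c, d, e, f, g, h, k, l, rfl⟩ := exists_jt u
    obtain ⟨rfl, hu⟩ := isParameter_jt.1 hu
    have h1 := H _ isSmall_fst
    have h2 := H _ isSmall_snd
    simp [jt_mul, jt_mem_models_9] at h1 h2
    clear H
    grind
  · refine ⟨_, isParameter_fst, ?_⟩
    simp [jt_mul, jt_mem_models_9]
  · rintro ⟨u, H, hu⟩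
    obtain ⟨a, b, c, d, e, f, g, h, k, l, rfl⟩ := exists_jt u
    obtain ⟨rfl, hu⟩ := isParameter_jt.1 hu
    simp [jt_mem_models_9] at H
    grind
  · intro H
    have := isSocle_jt.1 (H (jt 0 0 0 1 0 0 0 0 0 0) (jt_mem_models_9.2 (by simp)))
    simp at this

theorem invariantKey_models_10 : invariantKey (models 10) = 10 := by
  rw [invariantKey, if_pos ?_, if_neg ?_, if_neg ?_, if_neg ?_, if_neg ?_, if_pos ?_]
  · refine ⟨_, _, isParameter_fst, isParameter_snd, fun q hq => ?_⟩
    obtain ⟨a, b, c, d, e, f, g, h, k, l, rfl⟩ := exists_jt q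
    obtain rfl := isSmall_jt.1 hq
    simp [jt_mul, jt_mem_models_10]
  · rintro ⟨u, hu, H⟩
    obtain ⟨a, b, c, d, e, f, g, h, k, l, rfl⟩ := exists_jt u
    obtain ⟨rfl, hu⟩ := isParameter_jt.1 hu
    simp [jt_mul, jt_mem_models_10] at H
    grind
  · rintro ⟨u, hu, H⟩
    obtain ⟨a, b, c, d, e, f, g, h, k, l, rfl⟩ := exists_jt u
    obtain ⟨rfl, hu⟩ := isParameter_jt.1 hu
    have h1 := H _ isSmall_fst
    have h2 := H _ isSmall_snd
    simp [jt_mul, jt_mem_models_10] at h1 h2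
    clear H
    grind
  · rintro ⟨u, hu, H⟩
    obtain ⟨a, b, c, d, e, f, g, h, k, l, rfl⟩ := exists_jt u
    obtain ⟨rfl, hu⟩ := isParameter_jt.1 hu
    have h1 := H _ _ isSmall_fst isSmall_fst
    have h2 := H _ _ isSmall_fst isSmall_snd
    have h3 := H _ _ isSmall_snd isSmall_snd
    simp [jt_mul, jt_mem_models_10] at h1 h2 h3
    clear H
    grind
  · intro H
    have := jt_eq_zero.1 (H (jt 0 0 0 0 0 0 0 1 0 0) (jt_mem_models_10.2 (by simp)))
    simp at this
  · intro p hp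
    obtain ⟨a, b, c, d, e, f, g, h, k, l, rfl⟩ := exists_jt p
    rw [jt_mem_models_10] at hp
    rw [isSocle_jt]
    simp [hp]

theorem invariantKey_models_11 : invariantKey (models 11) = 11 := by
  rw [invariantKey, if_pos ?_, if_neg ?_, if_neg ?_, if_pos ?_]
  · refine ⟨_, isParameter_fst, fun q hq => ?_⟩
    obtain ⟨a, b, c, d, e, f, g, h, k, l, rfl⟩ := exists_jt q
    obtain rfl := isSmall_jt.1 hq
    simp [jt_mul, jt_mem_models_11]
  · rintro ⟨u, hu, H⟩
    obtain ⟨a, b, c, d, e, f, g, h, k, l, rfl⟩ := exists_jt u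
    obtain ⟨rfl, hu⟩ := isParameter_jt.1 hu
    have h1 := H _ _ isSmall_fst isSmall_fst
    have h2 := H _ _ isSmall_fst isSmall_snd
    have h3 := H _ _ isSmall_snd isSmall_snd
    simp [jt_mul, jt_mem_models_11] at h1 h2 h3
    clear H
    grind
  · intro H
    have := jt_eq_zero.1 (H (jt 0 0 0 0 0 0 1 0 0 0) (jt_mem_models_11.2 (by simp)))
    simp at this
  · intro p hp
    obtain ⟨a, b, c, d, e, f, g, h, k, l, rfl⟩ := exists_jt p
    rw [jt_mem_models_11] at hp
    rw [isSocle_jt]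
    simp [hp]

theorem invariantKey_models_12 : invariantKey (models 12) = 12 := by
  rw [invariantKey, if_neg ?_, if_neg ?_, if_neg ?_, if_neg ?_, if_pos ?_]
  · refine ⟨_, isParameter_fst, fun q r hq hr => ?_⟩
    obtain ⟨a, b, c, d, e, f, g, h, k, l, rfl⟩ := exists_jt q
    obtain rfl := isSmall_jt.1 hq
    obtain ⟨a', b', c', d', e', f', g', h', k', l', rfl⟩ := exists_jt r
    obtain rfl := isSmall_jt.1 hr
    simp [jt_mul, jt_mem_models_12]
  · rintro ⟨u, v, hu, hv, H⟩
    obtain ⟨a, b, c, d, e, f, g, h, k, l, rfl⟩ := exists_jt u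
    obtain ⟨rfl, hu⟩ := isParameter_jt.1 hu
    obtain ⟨a', b', c', d', e', f', g', h', k', l', rfl⟩ := exists_jt v
    obtain ⟨rfl, hv⟩ := isParameter_jt.1 hv
    simp [jt_mul, jt_mem_models_12] at H
    grind
  · rintro ⟨u, hu, H⟩
    obtain ⟨a, b, c, d, e, f, g, h, k, l, rfl⟩ := exists_jt u
    obtain ⟨rfl, hu⟩ := isParameter_jt.1 hu
    simp [jt_mul, jt_mem_models_12] at H
    grind
  · rintro ⟨u, H, hu⟩
    obtain ⟨a, b, c, d, e, f, g, h, k, l, rfl⟩ := exists_jt u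
    obtain ⟨rfl, hu⟩ := isParameter_jt.1 hu
    simp [jt_mem_models_12] at H
    grind
  · intro H
    have := isSocle_jt.1 (H (jt 0 0 0 1 0 0 0 0 0 (-1)) (jt_mem_models_12.2 (by simp)))
    simp at this

theorem invariantKey_models_13 : invariantKey (models 13) = 13 := by
  rw [invariantKey, if_neg ?_, if_pos ?_, if_pos ?_]
  · intro p hp
    obtain ⟨a, b, c, d, e, f, g, h, k, l, rfl⟩ := exists_jt p
    exact jt_mem_models_13.2 (isSmall_jt.1 hp)
  · exact ⟨_, jt_mem_models_13.2 (by simp), isParameter_fst⟩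
  · intro H
    have := isSocle_jt.1 (H (jt 0 1 0 0 0 0 0 0 0 0) (jt_mem_models_13.2 (by simp)))
    simp at this

theorem invariantKey_models_14 : invariantKey (models 14) = 14 := by
  rw [invariantKey, if_pos ?_, if_neg ?_, if_pos ?_]
  · refine ⟨_, isParameter_fst, fun q r hq hr => ?_⟩
    obtain ⟨a, b, c, d, e, f, g, h, k, l, rfl⟩ := exists_jt q
    obtain rfl := isSmall_jt.1 hq
    obtain ⟨a', b', c', d', e', f', g', h', k', l', rfl⟩ := exists_jt r
    obtain rfl := isSmall_jt.1 hr
    simp [jt_mul, jt_mem_models_14]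
  · intro H
    have := jt_eq_zero.1 (H (jt 0 0 0 0 0 0 1 0 0 0) (jt_mem_models_14.2 (by simp)))
    simp at this
  · intro p hp
    obtain ⟨a, b, c, d, e, f, g, h, k, l, rfl⟩ := exists_jt p
    rw [jt_mem_models_14] at hp
    rw [isSocle_jt]
    simp [hp]

theorem invariantKey_models (i : Fin 15) : invariantKey (models i) = i := by
  fin_cases i
  · exact invariantKey_models_0
  · exact invariantKey_models_1
  · exact invariantKey_models_2
  · exact invariantKey_models_3
  · exact invariantKey_models_4
  · exact invariantKey_models_5
  · exact invariantKey_models_6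
  · exact invariantKey_models_7
  · exact invariantKey_models_8
  · exact invariantKey_models_9
  · exact invariantKey_models_10
  · exact invariantKey_models_11
  · exact invariantKey_models_12
  · exact invariantKey_models_13
  · exact invariantKey_models_14

theorem not_equivalent_models {i j : Fin 15} (hij : i ≠ j) :
    ¬ Equivalent (models i) (models j) := by
  intro H
  have := H.invariantKey_eq
  rw [invariantKey_models, invariantKey_models] at this
  exact hij (Fin.ext this.symm)

end ClosedJetIdeals

end

/-! ### Tools for computing vanishing ideals. -/

noncomputable section

namespace ClosedJetIdeals

open MvPolynomial Filter Topology Asymptotics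

/-- The jets of the functions that vanish on `E`, as an ideal. -/
def vanishingIdeal (E : Set Plane) : Ideal (JetRing 3 2) where
  carrier := vanishingJets 3 E
  add_mem' := by
    rintro _ _ ⟨F, hF, hFE, rfl⟩ ⟨G, hG, hGE, rfl⟩
    exact ⟨fun v => F v + G v, hF.add hG, fun v hv => by simp [hFE v hv, hGE v hv],
      jetOf_add hF hG⟩
  zero_mem' := ⟨fun _ => 0, contDiff_const, fun _ _ => rfl, jetOf_const_zero⟩
  smul_mem' := by
    rintro r _ ⟨F, hF, hFE, rfl⟩
    have hr : ContDiff ℝ 3 (jetEval r) := contDiff_jetEval r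
    refine ⟨fun v => jetEval r v * F v, hr.mul hF, fun v hv => by simp [hFE v hv], ?_⟩
    rw [jetOf_mul hr hF, jetOf_jetEval, smul_eq_mul]

theorem eq_vanishingJets {I : Ideal (JetRing 3 2)} {E : Set Plane} (h1 : I ≤ vanishingIdeal E)
    (h2 : ∀ F : Plane → ℝ, ContDiff ℝ 3 F → (∀ v ∈ E, F v = 0) → jetOf 3 F ∈ I) :
    (I : Set (JetRing 3 2)) = vanishingJets 3 E := by
  refine Set.Subset.antisymm h1 ?_
  rintro _ ⟨F, hF, hFE, rfl⟩
  exact h2 F hF hFE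

/-- Subtracting G makes the cubic vanish on E without changing its jet. -/
theorem jt_mem_vanishingIdeal {E : Set Plane} {a b c d e f g h k l : ℝ} (G : Plane → ℝ)
    (hG : ContDiff ℝ 3 G) (hGo : G =o[𝓝 0] fun v => ‖v‖ ^ 3)
    (hE : ∀ v ∈ E, cubicFun a b c d e f g h k l v = G v) :
    jt a b c d e f g h k l ∈ vanishingIdeal E := by
  refine ⟨fun v => cubicFun a b c d e f g h k l v - G v, (contDiff_cubicFun ..).sub hG,
    fun v hv => by simp [hE v hv], ?_⟩
  refine jetOf_eq_of_isLittleO ((contDiff_cubicFun ..).sub hG) (hGo.neg_left.congr_left fun v => ?_)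
  rw [jetEval_jt]
  ring

theorem jt_mem_vanishingIdeal_of_eq_zero {E : Set Plane} {a b c d e f g h k l : ℝ}
    (hE : ∀ v ∈ E, cubicFun a b c d e f g h k l v = 0) :
    jt a b c d e f g h k l ∈ vanishingIdeal E :=
  jt_mem_vanishingIdeal (fun _ => 0) contDiff_const (isLittleO_zero _ _) hE

theorem sqrt_pow_add_two (n : ℕ) (t : ℝ) : √t ^ (n + 3) = √t ^ (n + 1) * t := by
  rcases le_or_gt 0 t with ht | ht
  · rw [pow_add √t n 3, pow_add √t n 1, mul_assoc]
    congr 1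
    nth_rewrite 3 [← Real.sq_sqrt ht]
    ring
  · simp [Real.sqrt_eq_zero_of_nonpos ht.le]

/-- The function is t^((n+3)/2) extended by zero to t < 0, because the square root of a negative
number is 0. At t = 0 the difference quotient is √t^(n+1), which tends to 0. -/
theorem hasDerivAt_sqrt_pow (n : ℕ) (t : ℝ) :
    HasDerivAt (fun s => √s ^ (n + 3)) ((n + 3) / 2 * √t ^ (n + 1)) t := by
  rcases lt_trichotomy t 0 with ht | rfl | ht
  · have h0 : (fun s => √s ^ (n + 3)) =ᶠ[𝓝 t] fun _ => 0 := by
      filter_upwards [eventually_lt_nhds ht] with s hs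
      simp [Real.sqrt_eq_zero_of_nonpos hs.le]
    rw [Real.sqrt_eq_zero_of_nonpos ht.le]
    simpa using (hasDerivAt_const t (0 : ℝ)).congr_of_eventuallyEq h0
  · rw [hasDerivAt_iff_isLittleO]
    have h1 : (fun s : ℝ => √s ^ (n + 1)) =o[𝓝 0] fun _ => (1 : ℝ) := by
      rw [isLittleO_one_iff]
      have : Tendsto (fun s : ℝ => √s ^ (n + 1)) (𝓝 0) (𝓝 (√0 ^ (n + 1))) :=
        (Real.continuous_sqrt.pow _).tendsto 0
      simpa using this
    have h2 := h1.mul_isBigO (isBigO_refl (fun s : ℝ => s) (𝓝 0))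
    simpa [sqrt_pow_add_two] using h2
  · have h1 := (Real.hasDerivAt_sqrt ht.ne').pow (n + 3)
    refine h1.congr_deriv ?_
    have h2 : √t ≠ 0 := (Real.sqrt_pos.2 ht).ne'
    simp
    field_simp
    ring

/-- Each derivative lowers the exponent by two, and one positive power must remain for continuity.
For class C³ this asks for exponent at least 7, which is also what makes the function o(|t|³). -/
theorem contDiff_sqrt_pow (m n : ℕ) (h : 2 * m < n) : ContDiff ℝ m fun t => √t ^ n := by
  induction m generalizing n with
  | zero => exact contDiff_zero.2 (Real.continuous_sqrt.pow n)
  | succ m ih =>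
    obtain ⟨n, rfl⟩ : ∃ k, n = k + 3 := ⟨n - 3, by omega⟩
    have hd : deriv (fun t => √t ^ (n + 3)) = fun t => (n + 3) / 2 * √t ^ (n + 1) :=
      funext fun t => (hasDerivAt_sqrt_pow n t).deriv
    push_cast
    rw [contDiff_succ_iff_deriv]
    refine ⟨fun t => (hasDerivAt_sqrt_pow n t).differentiableAt, by simp, ?_⟩
    rw [hd]
    exact contDiff_const.mul (ih (n + 1) (by omega))

theorem sqrt_pow_isLittleO (n : ℕ) (h : 7 ≤ n) : (fun t => √t ^ n) =o[𝓝 0] fun t => ‖t‖ ^ 3 := by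
  obtain ⟨n, rfl⟩ : ∃ k, n = k + 7 := ⟨n - 7, by omega⟩
  have h1 : (fun s : ℝ => √s ^ (n + 1)) =o[𝓝 0] fun _ => (1 : ℝ) := by
    rw [isLittleO_one_iff]
    have : Tendsto (fun s : ℝ => √s ^ (n + 1)) (𝓝 0) (𝓝 (√0 ^ (n + 1))) :=
      (Real.continuous_sqrt.pow _).tendsto 0
    simpa using this
  have h2 := h1.mul_isBigO (isBigO_refl (fun s : ℝ => s ^ 3) (𝓝 0))
  simp only [one_mul] at h2
  refine (h2.norm_right.congr_right fun t => norm_pow _ _).congr_left fun t => ?_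
  rw [sqrt_pow_add_two (n + 4), sqrt_pow_add_two (n + 2), sqrt_pow_add_two n]
  ring

theorem coord_isBigO (i : Fin 2) : (fun v : Plane => v i) =O[𝓝 0] fun v => v :=
  IsBigO.of_bound 1 (Eventually.of_forall fun v => by simpa using PiLp.norm_apply_le v i)

theorem tendsto_coord_zero (i : Fin 2) : Tendsto (fun v : Plane => v i) (𝓝 0) (𝓝 0) := by
  have := (contDiff_coord (n := 0) i).continuous.tendsto 0
  simpa using this

theorem comp_coord_isLittleO {u : ℝ → ℝ} (hu : u =o[𝓝 0] fun t => ‖t‖ ^ 3) (i : Fin 2) :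
    (fun v : Plane => u (v i)) =o[𝓝 0] fun v => ‖v‖ ^ 3 :=
  (hu.comp_tendsto (tendsto_coord_zero i)).trans_isBigO ((coord_isBigO i).norm_norm.pow 3)

theorem comp_neg_isLittleO {u : ℝ → ℝ} (hu : u =o[𝓝 0] fun t => ‖t‖ ^ 3) :
    (fun t => u (-t)) =o[𝓝 0] fun t => ‖t‖ ^ 3 := by
  have h1 : Tendsto (fun t : ℝ => -t) (𝓝 0) (𝓝 0) := by
    have := (continuous_neg (G := ℝ)).tendsto 0
    simpa using this
  refine (hu.comp_tendsto h1).congr_right fun t => ?_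
  simp

theorem contDiff_sqrt_pow_coord {n : ℕ} (h : 7 ≤ n) (i : Fin 2) :
    ContDiff ℝ 3 fun v : Plane => √(v i) ^ n :=
  (contDiff_sqrt_pow 3 n (by omega)).comp (contDiff_coord i)

theorem contDiff_sqrt_pow_neg_coord {n : ℕ} (h : 7 ≤ n) (i : Fin 2) :
    ContDiff ℝ 3 fun v : Plane => √(-v i) ^ n :=
  (contDiff_sqrt_pow 3 n (by omega)).comp (contDiff_coord i).neg

theorem sqrt_pow_coord_isLittleO {n : ℕ} (h : 7 ≤ n) (i : Fin 2) :
    (fun v : Plane => √(v i) ^ n) =o[𝓝 0] fun v => ‖v‖ ^ 3 :=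
  comp_coord_isLittleO (sqrt_pow_isLittleO n h) i

theorem sqrt_pow_neg_coord_isLittleO {n : ℕ} (h : 7 ≤ n) (i : Fin 2) :
    (fun v : Plane => √(-v i) ^ n) =o[𝓝 0] fun v => ‖v‖ ^ 3 :=
  comp_coord_isLittleO (comp_neg_isLittleO (sqrt_pow_isLittleO n h)) i

theorem pow_coord_isLittleO {n : ℕ} (h : 4 ≤ n) (i : Fin 2) :
    (fun v : Plane => v i ^ n) =o[𝓝 0] fun v => ‖v‖ ^ 3 :=
  comp_coord_isLittleO (u := fun t => t ^ n)
    ((isLittleO_pow_pow (by omega)).norm_right.congr_right fun t => norm_pow _ _) i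

theorem coord_mul_isLittleO {G : Plane → ℝ} (hG : G =o[𝓝 0] fun v => ‖v‖ ^ 3) (i : Fin 2) :
    (fun v => v i * G v) =o[𝓝 0] fun v => ‖v‖ ^ 3 := by
  have h1 : (fun v : Plane => v i) =O[𝓝 0] fun _ => (1 : ℝ) := (tendsto_coord_zero i).isBigO_one ℝ
  simpa using h1.mul_isLittleO hG

/-- The curve `t ↦ (u t, w t)` has size `O(t^m)` near zero. -/
theorem isBigO_curve {u w : ℝ → ℝ} {m : ℕ} (hu : u =O[𝓝[>] 0] fun t => t ^ m)
    (hw : w =O[𝓝[>] 0] fun t => t ^ m) :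
    (fun t => (!₂[u t, w t] : Plane)) =O[𝓝[>] 0] fun t => t ^ m := by
  have h := hu.norm_left.add hw.norm_left
  refine IsBigO.trans (IsBigO.of_bound 1 (Eventually.of_forall fun t => ?_)) h
  rw [one_mul, Real.norm_of_nonneg (by positivity), EuclideanSpace.norm_eq, Fin.sum_univ_two]
  refine (Real.sqrt_le_sqrt (?_ : _ ≤ (‖u t‖ + ‖w t‖) ^ 2)).trans
    (Real.sqrt_sq (by positivity)).le
  simp
  nlinarith [abs_nonneg (u t), abs_nonneg (w t), sq_abs (u t), sq_abs (w t),
    mul_nonneg (abs_nonneg (u t)) (abs_nonneg (w t))]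

theorem tendsto_pow_zero {m : ℕ} (hm : m ≠ 0) : Tendsto (fun t : ℝ => t ^ m) (𝓝[>] 0) (𝓝 0) := by
  have : Tendsto (fun t : ℝ => t ^ m) (𝓝 0) (𝓝 (0 ^ m)) := (continuous_pow m).tendsto 0
  rw [zero_pow hm] at this
  exact this.mono_left nhdsWithin_le_nhds

/-- The Taylor polynomial of a function that vanishes along a curve of size `O(t^m)` is
`o(t^{3m})` along the curve. -/
theorem cubicFun_curve_isLittleO {F : Plane → ℝ} (hF : ContDiff ℝ 3 F) {a b c d e f g h k l : ℝ}
    (hp : jetOf 3 F = jt a b c d e f g h k l) {u w : ℝ → ℝ} {m : ℕ} (hm : m ≠ 0)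
    (hu : u =O[𝓝[>] 0] fun t => t ^ m) (hw : w =O[𝓝[>] 0] fun t => t ^ m)
    (h0 : ∀ t > 0, F !₂[u t, w t] = 0) :
    (fun t => cubicFun a b c d e f g h k l !₂[u t, w t]) =o[𝓝[>] 0] fun t => t ^ (3 * m) := by
  have hO := isBigO_curve hu hw
  have ht := hO.trans_tendsto (tendsto_pow_zero hm)
  have h1 := (sub_jetEval_jetOf_isLittleO hF).comp_tendsto ht
  have h2 := h1.trans_isBigO (hO.norm_left.pow 3)
  simp only [← pow_mul, mul_comm m 3] at h2
  refine (h2.neg_left).congr' ?_ EventuallyEq.rfl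
  filter_upwards [self_mem_nhdsWithin] with t ht
  simp only [Function.comp_apply, h0 t ht, hp, jetEval_jt]
  ring

theorem hasDerivAt_fst_line {G : Plane → ℝ} (hG : Differentiable ℝ G) (s r : ℝ) :
    HasDerivAt (fun s => G !₂[s, r]) (partialD 0 G !₂[s, r]) s := by
  have h1 : HasDerivAt (fun s : ℝ => (!₂[0, r] : Plane) + s • EuclideanSpace.single 0 (1 : ℝ))
      (EuclideanSpace.single 0 (1 : ℝ)) s := by
    simpa using ((hasDerivAt_id s).smul_const (EuclideanSpace.single (0 : Fin 2) (1 : ℝ))).const_add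
      (!₂[0, r] : Plane)
  have h2 : ∀ s : ℝ, (!₂[0, r] : Plane) + s • EuclideanSpace.single 0 (1 : ℝ) = !₂[s, r] := by
    intro s
    ext i
    fin_cases i <;> simp
  have h3 := (hG !₂[s, r]).hasFDerivAt
  rw [← h2 s] at h3
  have h4 := h3.comp_hasDerivAt s h1
  rw [h2 s] at h4
  refine h4.congr_of_eventuallyEq (Eventually.of_forall fun s => ?_)
  simp only [Function.comp_apply, h2]

/-- A bound, uniform on segments, for a function that is `o(|v|^n)`. -/
theorem eventually_segment_bound {H : Plane → ℝ} {n : ℕ} (hH : H =o[𝓝 0] fun v => ‖v‖ ^ n)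
    {p m : ℕ} (hm : m ≠ 0) (hpm : m ≤ p) {ε : ℝ} (hε : 0 < ε) :
    ∀ᶠ t in 𝓝[>] (0 : ℝ), ∀ s, |s| ≤ t ^ p → |H !₂[s, t ^ m]| ≤ ε * t ^ (m * n) := by
  -- The points of the segment have norm at most 2t^m, and the factor 2^n absorbs this 2.
  have hε' : 0 < ε / 2 ^ n := by positivity
  obtain ⟨r, hr, hball⟩ := Metric.eventually_nhds_iff_ball.1 (hH.bound hε')
  have hsmall : ∀ᶠ t in 𝓝[>] (0 : ℝ), 2 * t ^ m < r := by
    have h1 : Tendsto (fun t : ℝ => 2 * t ^ m) (𝓝[>] 0) (𝓝 (2 * 0)) :=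
      (tendsto_pow_zero hm).const_mul 2
    rw [mul_zero] at h1
    exact h1.eventually_lt_const hr
  have hone : ∀ᶠ t in 𝓝[>] (0 : ℝ), t < 1 :=
    nhdsWithin_le_nhds (eventually_lt_nhds (by norm_num))
  filter_upwards [hsmall, hone, self_mem_nhdsWithin] with t ht ht1 ht0 s hs
  have ht0' : (0 : ℝ) < t := ht0
  have hs' : |s| ≤ t ^ m := hs.trans (pow_le_pow_of_le_one ht0'.le ht1.le hpm)
  have hnorm : ‖(!₂[s, t ^ m] : Plane)‖ ≤ 2 * t ^ m := by
    rw [EuclideanSpace.norm_eq, Fin.sum_univ_two]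
    refine (Real.sqrt_le_sqrt (?_ : _ ≤ (2 * t ^ m) ^ 2)).trans (Real.sqrt_sq (by positivity)).le
    simp [abs_of_pos ht0']
    have := sq_le_sq' (by linarith [neg_abs_le s, abs_nonneg s]) hs'
    rw [sq_abs] at this
    nlinarith [sq_nonneg (t ^ m)]
  have h1 := hball !₂[s, t ^ m] (by simpa using hnorm.trans_lt ht)
  rw [Real.norm_eq_abs, norm_pow, norm_norm] at h1
  refine h1.trans ?_
  calc ε / 2 ^ n * ‖(!₂[s, t ^ m] : Plane)‖ ^ n ≤ ε / 2 ^ n * (2 * t ^ m) ^ n := by gcongr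
    _ = ε * t ^ (m * n) := by
      rw [mul_pow, pow_mul]
      field_simp

/-- The mean value inequality on a segment of length 2t^p, where ∂G/∂x is o(t^(mn)). When G is flat
of order 3 and p > m, the gain t^p is better than the direct estimate o(t^(3m)). -/
theorem first_difference_isLittleO {G : Plane → ℝ} (hG : Differentiable ℝ G) {n : ℕ}
    (hH : partialD 0 G =o[𝓝 0] fun v => ‖v‖ ^ n) {p m : ℕ} (hm : m ≠ 0) (hpm : m ≤ p) :
    (fun t => G !₂[t ^ p, t ^ m] - G !₂[-t ^ p, t ^ m]) =o[𝓝[>] 0] fun t => t ^ (p + m * n) := by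
  rw [isLittleO_iff]
  intro ε hε
  filter_upwards [eventually_segment_bound hH hm hpm (half_pos hε), self_mem_nhdsWithin]
    with t ht ht0
  have ht0' : (0 : ℝ) < t := ht0
  have htp : 0 < t ^ p := by positivity
  have h1 := (convex_Icc (-t ^ p) (t ^ p)).norm_image_sub_le_of_norm_hasDerivWithin_le
    (f := fun s => G !₂[s, t ^ m]) (C := ε / 2 * t ^ (m * n))
    (fun s _ => (hasDerivAt_fst_line hG s (t ^ m)).hasDerivWithinAt)
    (fun s hs => ht s (abs_le.2 hs)) (x := -t ^ p) (y := t ^ p)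
    ⟨le_rfl, by linarith⟩ ⟨by linarith, le_rfl⟩
  refine h1.trans (le_of_eq ?_)
  rw [Real.norm_of_nonneg (by linarith), Real.norm_of_nonneg (by positivity), pow_add]
  ring

/-- The even function G(s, ·) + G(−s, ·) has as derivative a first difference of ∂G/∂x. Two
applications of the mean value inequality give the factor t^(2p). -/
theorem second_difference_isLittleO {G : Plane → ℝ} (hG : Differentiable ℝ G)
    (hG' : Differentiable ℝ (partialD 0 G)) {n : ℕ}
    (hH : partialD 0 (partialD 0 G) =o[𝓝 0] fun v => ‖v‖ ^ n) {p m : ℕ} (hm : m ≠ 0)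
    (hpm : m ≤ p) :
    (fun t => G !₂[t ^ p, t ^ m] + G !₂[-t ^ p, t ^ m] - 2 * G !₂[0, t ^ m]) =o[𝓝[>] 0]
      fun t => t ^ (2 * p + m * n) := by
  rw [isLittleO_iff]
  intro ε hε
  filter_upwards [eventually_segment_bound hH hm hpm (half_pos hε), self_mem_nhdsWithin]
    with t ht ht0
  have ht0' : (0 : ℝ) < t := ht0
  have htp : 0 < t ^ p := by positivity
  have hd : ∀ s, HasDerivAt (fun s => G !₂[s, t ^ m] + G !₂[-s, t ^ m])
      (partialD 0 G !₂[s, t ^ m] - partialD 0 G !₂[-s, t ^ m]) s := fun s => by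
    have h1 := hasDerivAt_fst_line hG s (t ^ m)
    have h2 := (hasDerivAt_fst_line hG (-s) (t ^ m)).scomp s (hasDerivAt_neg s)
    exact (h1.add h2).congr_deriv (by simp [sub_eq_add_neg])
  have hbound : ∀ s ∈ Set.Icc 0 (t ^ p),
      ‖partialD 0 G !₂[s, t ^ m] - partialD 0 G !₂[-s, t ^ m]‖ ≤
        ε / 2 * t ^ (m * n) * (2 * t ^ p) := by
    intro s hs
    have h1 := (convex_Icc (-t ^ p) (t ^ p)).norm_image_sub_le_of_norm_hasDerivWithin_le
      (f := fun s => partialD 0 G !₂[s, t ^ m]) (C := ε / 2 * t ^ (m * n))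
      (fun s _ => (hasDerivAt_fst_line hG' s (t ^ m)).hasDerivWithinAt)
      (fun s hs => ht s (abs_le.2 hs)) (x := -s) (y := s)
      ⟨by linarith [hs.2], by linarith [hs.1]⟩ ⟨by linarith [hs.1], hs.2⟩
    refine h1.trans ?_
    rw [Real.norm_of_nonneg (by linarith [hs.1])]
    gcongr
    linarith [hs.2]
  have h1 := (convex_Icc 0 (t ^ p)).norm_image_sub_le_of_norm_hasDerivWithin_le
    (fun s _ => (hd s).hasDerivWithinAt) hbound (x := 0) (y := t ^ p)
    ⟨le_rfl, htp.le⟩ ⟨htp.le, le_rfl⟩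
  rw [neg_zero, ← two_mul] at h1
  refine h1.trans (le_of_eq ?_)
  rw [Real.norm_of_nonneg (by linarith), Real.norm_of_nonneg (by positivity), pow_add, pow_mul']
  ring

theorem cubicFun_first_difference_isLittleO {F : Plane → ℝ} (hF : ContDiff ℝ 3 F)
    {a b c d e f g h k l : ℝ} (hp : jetOf 3 F = jt a b c d e f g h k l) {p m : ℕ} (hm : m ≠ 0)
    (hpm : m ≤ p) (h0 : ∀ t > 0, F !₂[t ^ p, t ^ m] = 0) (h1 : ∀ t > 0, F !₂[-t ^ p, t ^ m] = 0) :
    (fun t => cubicFun a b c d e f g h k l !₂[t ^ p, t ^ m] -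
      cubicFun a b c d e f g h k l !₂[-t ^ p, t ^ m]) =o[𝓝[>] 0] fun t => t ^ (p + m * 2) := by
  have hflat := flat_sub_jetEval hF
  have h2 := first_difference_isLittleO (hflat.1.differentiable (by norm_num))
    (hflat.2.2 0).isLittleO hm hpm
  refine (h2.neg_left).congr' ?_ EventuallyEq.rfl
  filter_upwards [self_mem_nhdsWithin] with t ht
  simp only [h0 t ht, h1 t ht, hp, jetEval_jt]
  ring

theorem cubicFun_second_difference_isLittleO {F : Plane → ℝ} (hF : ContDiff ℝ 3 F)
    {a b c d e f g h k l : ℝ} (hp : jetOf 3 F = jt a b c d e f g h k l) {p m : ℕ} (hm : m ≠ 0)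
    (hpm : m ≤ p) (h0 : ∀ t > 0, F !₂[t ^ p, t ^ m] = 0) (h1 : ∀ t > 0, F !₂[-t ^ p, t ^ m] = 0)
    (h2 : ∀ t > 0, F !₂[0, t ^ m] = 0) :
    (fun t => cubicFun a b c d e f g h k l !₂[t ^ p, t ^ m] +
      cubicFun a b c d e f g h k l !₂[-t ^ p, t ^ m] -
      2 * cubicFun a b c d e f g h k l !₂[0, t ^ m]) =o[𝓝[>] 0]
        fun t => t ^ (2 * p + m * 1) := by
  have hflat := flat_sub_jetEval hF
  have h3 := second_difference_isLittleO (hflat.1.differentiable (by norm_num))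
    ((hflat.2.2 0).1.differentiable (by norm_num)) ((hflat.2.2 0).2.2 0).isLittleO hm hpm
  refine (h3.neg_left).congr' ?_ EventuallyEq.rfl
  filter_upwards [self_mem_nhdsWithin] with t ht
  simp only [h0 t ht, h1 t ht, h2 t ht, hp, jetEval_jt]
  ring

end ClosedJetIdeals

end

/-! ### Coefficient relations forced by vanishing along curves. -/

noncomputable section

namespace ClosedJetIdeals

open MvPolynomial Filter Topology Asymptotics

theorem isSemialgebraic_eq (P Q : MvPolynomial (Fin 2) ℝ) :
    IsSemialgebraic {v : Plane | eval (fun i => v i) P = eval (fun i => v i) Q} := by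
  have h := IsSemialgebraic.eq_zero (P - Q)
  simpa only [map_sub, sub_eq_zero] using h

theorem isSemialgebraic_le (P Q : MvPolynomial (Fin 2) ℝ) :
    IsSemialgebraic {v : Plane | eval (fun i => v i) P ≤ eval (fun i => v i) Q} := by
  have h := (IsSemialgebraic.pos (P - Q)).compl
  simpa only [map_sub, sub_pos, Set.compl_ofPred, not_lt] using h

theorem isBigO_const_mul_pow (σ : ℝ) {p m : ℕ} (h : m ≤ p) :
    (fun t : ℝ => σ * t ^ p) =O[𝓝[>] 0] fun t => t ^ m := by
  have h1 : (fun t : ℝ => t ^ p) =O[𝓝[>] 0] fun t => t ^ m := by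
    have hone : ∀ᶠ t in 𝓝[>] (0 : ℝ), t < 1 :=
      nhdsWithin_le_nhds (eventually_lt_nhds (by norm_num))
    refine IsBigO.of_bound 1 ?_
    filter_upwards [hone, self_mem_nhdsWithin] with t ht1 ht0
    rw [one_mul, norm_pow, norm_pow, Real.norm_of_nonneg (le_of_lt ht0)]
    exact pow_le_pow_of_le_one (le_of_lt ht0) ht1.le h
  exact h1.const_mul_left σ

/-- In each lemma of this kind, `A` lists the coefficients of the powers of t in the Taylor cubic
along the curve. Those up to the order of the error term must vanish. -/
theorem coeffs_of_vanish_ray {F : Plane → ℝ} (hF : ContDiff ℝ 3 F) {a b c d e f g h k l : ℝ}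
    (hp : jetOf 3 F = jt a b c d e f g h k l) {σ τ : ℝ}
    (h0 : ∀ t > 0, F !₂[σ * t ^ 1, τ * t ^ 1] = 0) :
    a = 0 ∧ b * σ + c * τ = 0 ∧ d * σ ^ 2 + e * (σ * τ) + f * τ ^ 2 = 0 ∧
      g * σ ^ 3 + h * (σ ^ 2 * τ) + k * (σ * τ ^ 2) + l * τ ^ 3 = 0 := by
  have H := cubicFun_curve_isLittleO hF hp one_ne_zero (isBigO_const_mul_pow σ le_rfl)
    (isBigO_const_mul_pow τ le_rfl) h0
  let A : Fin 4 → ℝ := ![a, b * σ + c * τ, d * σ ^ 2 + e * (σ * τ) + f * τ ^ 2,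
    g * σ ^ 3 + h * (σ ^ 2 * τ) + k * (σ * τ ^ 2) + l * τ ^ 3]
  have HA : (fun t => ∑ i, A i * t ^ (i : ℕ)) =o[𝓝[>] 0] fun t : ℝ => t ^ (3 * 1) := by
    refine H.congr_left fun t => ?_
    simp [A, cubicFun, Fin.sum_univ_succ]
    ring
  exact ⟨coeff_eq_zero_of_isLittleO HA (i := 0) (by simp),
    coeff_eq_zero_of_isLittleO HA (i := 1) (by simp),
    coeff_eq_zero_of_isLittleO HA (i := 2) (by simp),
    coeff_eq_zero_of_isLittleO HA (i := 3) (by simp)⟩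

theorem coeffs_of_vanish_parabola {F : Plane → ℝ} (hF : ContDiff ℝ 3 F) {a b c d e f g h k l : ℝ}
    (hp : jetOf 3 F = jt a b c d e f g h k l) {σ τ : ℝ}
    (h0 : ∀ t > 0, F !₂[σ * t ^ 2, τ * t ^ 1] = 0) :
    a = 0 ∧ c * τ = 0 ∧ b * σ + f * τ ^ 2 = 0 ∧ e * (σ * τ) + l * τ ^ 3 = 0 := by
  have H := cubicFun_curve_isLittleO hF hp one_ne_zero (isBigO_const_mul_pow σ one_le_two)
    (isBigO_const_mul_pow τ le_rfl) h0
  let A : Fin 7 → ℝ := ![a, c * τ, b * σ + f * τ ^ 2, e * (σ * τ) + l * τ ^ 3,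
    d * σ ^ 2 + k * (σ * τ ^ 2), h * (σ ^ 2 * τ), g * σ ^ 3]
  have HA : (fun t => ∑ i, A i * t ^ (i : ℕ)) =o[𝓝[>] 0] fun t : ℝ => t ^ (3 * 1) := by
    refine H.congr_left fun t => ?_
    simp [A, cubicFun, Fin.sum_univ_succ]
    ring
  exact ⟨coeff_eq_zero_of_isLittleO HA (i := 0) (by simp),
    coeff_eq_zero_of_isLittleO HA (i := 1) (by simp),
    coeff_eq_zero_of_isLittleO HA (i := 2) (by simp),
    coeff_eq_zero_of_isLittleO HA (i := 3) (by simp)⟩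

theorem coeffs_of_vanish_parabola' {F : Plane → ℝ} (hF : ContDiff ℝ 3 F) {a b c d e f g h k l : ℝ}
    (hp : jetOf 3 F = jt a b c d e f g h k l) {σ τ : ℝ}
    (h0 : ∀ t > 0, F !₂[σ * t ^ 1, τ * t ^ 2] = 0) :
    a = 0 ∧ b * σ = 0 ∧ c * τ + d * σ ^ 2 = 0 ∧ e * (σ * τ) + g * σ ^ 3 = 0 := by
  have H := cubicFun_curve_isLittleO hF hp one_ne_zero (isBigO_const_mul_pow σ le_rfl)
    (isBigO_const_mul_pow τ one_le_two) h0
  let A : Fin 7 → ℝ := ![a, b * σ, c * τ + d * σ ^ 2, e * (σ * τ) + g * σ ^ 3,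
    f * τ ^ 2 + h * (σ ^ 2 * τ), k * (σ * τ ^ 2), l * τ ^ 3]
  have HA : (fun t => ∑ i, A i * t ^ (i : ℕ)) =o[𝓝[>] 0] fun t : ℝ => t ^ (3 * 1) := by
    refine H.congr_left fun t => ?_
    simp [A, cubicFun, Fin.sum_univ_succ]
    ring
  exact ⟨coeff_eq_zero_of_isLittleO HA (i := 0) (by simp),
    coeff_eq_zero_of_isLittleO HA (i := 1) (by simp),
    coeff_eq_zero_of_isLittleO HA (i := 2) (by simp),
    coeff_eq_zero_of_isLittleO HA (i := 3) (by simp)⟩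

theorem coeffs_of_vanish_cusp {F : Plane → ℝ} (hF : ContDiff ℝ 3 F) {a b c d e f g h k l : ℝ}
    (hp : jetOf 3 F = jt a b c d e f g h k l) {σ τ : ℝ}
    (h0 : ∀ t > 0, F !₂[σ * t ^ 3, τ * t ^ 2] = 0) :
    a = 0 ∧ c * τ = 0 ∧ b * σ = 0 ∧ f * τ ^ 2 = 0 ∧ e * (σ * τ) = 0 ∧
      d * σ ^ 2 + l * τ ^ 3 = 0 := by
  have H := cubicFun_curve_isLittleO hF hp two_ne_zero
    (isBigO_const_mul_pow σ (Nat.le_succ 2)) (isBigO_const_mul_pow τ le_rfl) h0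
  let A : Fin 10 → ℝ := ![a, 0, c * τ, b * σ, f * τ ^ 2, e * (σ * τ), d * σ ^ 2 + l * τ ^ 3,
    k * (σ * τ ^ 2), h * (σ ^ 2 * τ), g * σ ^ 3]
  have HA : (fun t => ∑ i, A i * t ^ (i : ℕ)) =o[𝓝[>] 0] fun t : ℝ => t ^ (3 * 2) := by
    refine H.congr_left fun t => ?_
    simp [A, cubicFun, Fin.sum_univ_succ]
    ring
  exact ⟨coeff_eq_zero_of_isLittleO HA (i := 0) (by simp),
    coeff_eq_zero_of_isLittleO HA (i := 2) (by simp),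
    coeff_eq_zero_of_isLittleO HA (i := 3) (by simp),
    coeff_eq_zero_of_isLittleO HA (i := 4) (by simp),
    coeff_eq_zero_of_isLittleO HA (i := 5) (by simp),
    coeff_eq_zero_of_isLittleO HA (i := 6) (by simp)⟩

theorem coeffs_of_vanish_quintic {F : Plane → ℝ} (hF : ContDiff ℝ 3 F) {a b c d e f g h k l : ℝ}
    (hp : jetOf 3 F = jt a b c d e f g h k l) {σ τ : ℝ}
    (h0 : ∀ t > 0, F !₂[σ * t ^ 5, τ * t ^ 2] = 0) : b * σ = 0 := by
  have H := cubicFun_curve_isLittleO hF hp two_ne_zero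
    (isBigO_const_mul_pow σ (by norm_num)) (isBigO_const_mul_pow τ le_rfl) h0
  let A : Fin 16 → ℝ := ![a, 0, c * τ, 0, f * τ ^ 2, b * σ, l * τ ^ 3, e * (σ * τ), 0,
    k * (σ * τ ^ 2), d * σ ^ 2, 0, h * (σ ^ 2 * τ), 0, 0, g * σ ^ 3]
  have HA : (fun t => ∑ i, A i * t ^ (i : ℕ)) =o[𝓝[>] 0] fun t : ℝ => t ^ (3 * 2) := by
    refine H.congr_left fun t => ?_
    simp [A, cubicFun, Fin.sum_univ_succ]
    ring
  exact coeff_eq_zero_of_isLittleO HA (i := 5) (by simp)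

/-- The difference is o(t⁴) rather than o(t³), so it also detects xy², which has size t⁴ on the
parabolas. -/
theorem coeffs_of_vanish_two_parabolas {F : Plane → ℝ} (hF : ContDiff ℝ 3 F) {a b c d e f g h k l : ℝ}
    (hp : jetOf 3 F = jt a b c d e f g h k l)
    (h0 : ∀ t > 0, F !₂[t ^ 2, t ^ 1] = 0)
    (h1 : ∀ t > 0, F !₂[-t ^ 2, t ^ 1] = 0) : b = 0 ∧ e = 0 ∧ k = 0 := by
  have H := cubicFun_first_difference_isLittleO hF hp one_ne_zero one_le_two h0 h1
  let A : Fin 7 → ℝ := ![0, 0, 2 * b, 2 * e, 2 * k, 0, 2 * g]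
  have HA : (fun t => ∑ i, A i * t ^ (i : ℕ)) =o[𝓝[>] 0] fun t : ℝ => t ^ (2 + 1 * 2) := by
    refine H.congr_left fun t => ?_
    simp [A, cubicFun, Fin.sum_univ_succ]
    ring
  have hb : 2 * b = 0 := coeff_eq_zero_of_isLittleO HA (i := 2) (by simp)
  have he : 2 * e = 0 := coeff_eq_zero_of_isLittleO HA (i := 3) (by simp)
  have hk : 2 * k = 0 := coeff_eq_zero_of_isLittleO HA (i := 4) (by simp)
  refine ⟨?_, ?_, ?_⟩ <;> linarith

/-- The difference of the two branches is o(t⁷), exactly enough to detect xy². A single branch only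
gives o(t⁶). -/
theorem coeffs_of_vanish_two_cusps {F : Plane → ℝ} (hF : ContDiff ℝ 3 F) {a b c d e f g h k l : ℝ}
    (hp : jetOf 3 F = jt a b c d e f g h k l)
    (h0 : ∀ t > 0, F !₂[t ^ 3, t ^ 2] = 0)
    (h1 : ∀ t > 0, F !₂[-t ^ 3, t ^ 2] = 0) : b = 0 ∧ e = 0 ∧ k = 0 := by
  have H := cubicFun_first_difference_isLittleO hF hp two_ne_zero (Nat.le_succ 2) h0 h1
  let A : Fin 10 → ℝ := ![0, 0, 0, 2 * b, 0, 2 * e, 0, 2 * k, 0, 2 * g]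
  have HA : (fun t => ∑ i, A i * t ^ (i : ℕ)) =o[𝓝[>] 0] fun t : ℝ => t ^ (3 + 2 * 2) := by
    refine H.congr_left fun t => ?_
    simp [A, cubicFun, Fin.sum_univ_succ]
    ring
  have hb : 2 * b = 0 := coeff_eq_zero_of_isLittleO HA (i := 3) (by simp)
  have he : 2 * e = 0 := coeff_eq_zero_of_isLittleO HA (i := 5) (by simp)
  have hk : 2 * k = 0 := coeff_eq_zero_of_isLittleO HA (i := 7) (by simp)
  refine ⟨?_, ?_, ?_⟩ <;> linarith

/-- The second difference is o(t⁵), so it detects x²y, of size t⁵. -/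
theorem coeffs_of_vanish_three_parabolas {F : Plane → ℝ} (hF : ContDiff ℝ 3 F) {a b c d e f g h k l : ℝ}
    (hp : jetOf 3 F = jt a b c d e f g h k l)
    (h0 : ∀ t > 0, F !₂[t ^ 2, t ^ 1] = 0)
    (h1 : ∀ t > 0, F !₂[-t ^ 2, t ^ 1] = 0) (h2 : ∀ t > 0, F !₂[0, t ^ 1] = 0) :
    d = 0 ∧ h = 0 := by
  have H := cubicFun_second_difference_isLittleO hF hp one_ne_zero one_le_two h0 h1 h2
  let A : Fin 6 → ℝ := ![0, 0, 0, 0, 2 * d, 2 * h]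
  have HA : (fun t => ∑ i, A i * t ^ (i : ℕ)) =o[𝓝[>] 0] fun t : ℝ => t ^ (2 * 2 + 1 * 1) := by
    refine H.congr_left fun t => ?_
    simp [A, cubicFun, Fin.sum_univ_succ]
    ring
  have hd : 2 * d = 0 := coeff_eq_zero_of_isLittleO HA (i := 4) (by simp)
  have hh : 2 * h = 0 := coeff_eq_zero_of_isLittleO HA (i := 5) (by simp)
  refine ⟨?_, ?_⟩ <;> linarith

theorem eq_sqrt_pow {s z : ℝ} {n : ℕ} (hs : 0 ≤ s) (hz : 0 ≤ z) (h : s ^ 2 = z ^ n) :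
    s = √z ^ n := by
  refine (pow_left_inj₀ hs (by positivity) two_ne_zero).1 ?_
  rw [h, ← pow_mul, mul_comm, pow_mul, Real.sq_sqrt hz]

end ClosedJetIdeals

end

/-! ### Realisation of the fifteen models by semi-algebraic sets. -/

noncomputable section

namespace ClosedJetIdeals

open MvPolynomial Filter Topology Asymptotics

/-- The ideal is the ideal of jets of functions vanishing on a semi-algebraic set through the
origin. -/
def IsRealizable (I : Ideal (JetRing 3 2)) : Prop :=
  ∃ E : Set Plane, IsSemialgebraic E ∧ (0 : Plane) ∈ E ∧
    (I : Set (JetRing 3 2)) = vanishingJets 3 E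

theorem isRealizable_of {I : Ideal (JetRing 3 2)} {E : Set Plane} (hE : IsSemialgebraic E)
    (h0 : (0 : Plane) ∈ E) (h1 : I ≤ vanishingIdeal E)
    (h2 : ∀ (F : Plane → ℝ) (a b c d e f g h k l : ℝ), ContDiff ℝ 3 F → (∀ v ∈ E, F v = 0) →
      jetOf 3 F = jt a b c d e f g h k l → jt a b c d e f g h k l ∈ I) : IsRealizable I := by
  refine ⟨E, hE, h0, eq_vanishingJets h1 fun F hF hFE => ?_⟩
  obtain ⟨a, b, c, d, e, f, g, h, k, l, hp⟩ := exists_jt (jetOf 3 F)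
  rw [hp]
  exact h2 F a b c d e f g h k l hF hFE hp

theorem span_singleton_le {R : Type*} [CommRing R] {I : Ideal R} {p : R} (hp : p ∈ I) :
    Ideal.span {p} ≤ I := by
  simpa [Ideal.span_le] using hp

theorem span_pair_le {R : Type*} [CommRing R] {I : Ideal R} {p q : R} (hp : p ∈ I) (hq : q ∈ I) :
    Ideal.span {p, q} ≤ I := by
  rw [Ideal.span_le]
  rintro _ (rfl | rfl)
  exacts [hp, hq]

theorem span_triple_le {R : Type*} [CommRing R] {I : Ideal R} {p q r : R} (hp : p ∈ I)
    (hq : q ∈ I) (hr : r ∈ I) : Ideal.span {p, q, r} ≤ I := by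
  rw [Ideal.span_le]
  rintro _ (rfl | rfl | rfl)
  exacts [hp, hq, hr]

theorem isRealizable_models_0 : IsRealizable (models 0) := by
  refine isRealizable_of (E := Set.univ) ?_ trivial bot_le ?_
  · have := isSemialgebraic_eq 0 0
    simpa using this
  · intro F a b c d e f g h k l hF hE hp
    have hF0 : F = fun _ => 0 := funext fun v => hE v trivial
    rw [hF0, jetOf_const_zero] at hp
    rw [← hp]
    exact zero_mem _

theorem isRealizable_models_1 : IsRealizable (models 1) := by
  refine isRealizable_of (E := {v | v 0 = 0}) ?_ (by simp) ?_ ?_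
  · simpa using isSemialgebraic_eq x 0
  · rw [models_1_eq_span]
    refine span_singleton_le (jt_mem_vanishingIdeal_of_eq_zero fun v hv => ?_)
    simpa [cubicFun] using hv
  · intro F a b c d e f g h k l hF hE hp
    have h1 := coeffs_of_vanish_ray hF hp (σ := 0) (τ := 1) fun t ht => hE _ (by simp)
    simpa [jt_mem_models_1] using h1

/-- On the two parabolas x = ±y² one has x² = y⁴ = o(|v|³). Comparing the two excludes xy². -/
theorem isRealizable_models_2 : IsRealizable (models 2) := by
  refine isRealizable_of (E := {v | v 0 ^ 2 = v 1 ^ 4}) ?_ (by simp) ?_ ?_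
  · have h1 := isSemialgebraic_eq (x ^ 2) (y ^ 4)
    simpa only [map_pow, map_mul, eval_X] using h1
  · rw [models_2_eq_span]
    refine span_singleton_le (jt_mem_vanishingIdeal _ ((contDiff_coord 1).pow 4)
      (pow_coord_isLittleO le_rfl 1) fun v hv => ?_)
    simpa [cubicFun] using hv
  · intro F a b c d e f g h k l hF hE hp
    have h1 := coeffs_of_vanish_parabola hF hp (σ := 1) (τ := 1) fun t ht => hE _ (by simp; ring)
    have h2 := coeffs_of_vanish_two_parabolas hF hp
      (fun t ht => hE _ (by simp; ring)) (fun t ht => hE _ (by simp; ring))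
    simp only [jt_mem_models_2]
    grind

/-- The axis x = 0 between the parabolas x = ±y² makes the second difference available, which
excludes x² and x²y. -/
theorem isRealizable_models_3 : IsRealizable (models 3) := by
  refine isRealizable_of (E := {v | v 0 * v 0 ^ 2 = v 0 * v 1 ^ 4}) ?_ (by simp) ?_ ?_
  · have h1 := isSemialgebraic_eq (x * x ^ 2) (x * y ^ 4)
    simpa only [map_pow, map_mul, eval_X] using h1
  · rw [models_3_eq_span]
    refine span_singleton_le (jt_mem_vanishingIdeal (fun v => v 0 * v 1 ^ 4)
      ((contDiff_coord 0).mul ((contDiff_coord 1).pow 4))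
      (coord_mul_isLittleO (pow_coord_isLittleO le_rfl 1) 0) fun v hv => ?_)
    have hv' : v 0 * v 0 ^ 2 = v 0 * v 1 ^ 4 := hv
    simp [cubicFun]
    linarith
  · intro F a b c d e f g h k l hF hE hp
    have h1 := coeffs_of_vanish_ray hF hp (σ := 0) (τ := 1) fun t ht => hE _ (by simp)
    have h2 := coeffs_of_vanish_two_parabolas hF hp
      (fun t ht => hE _ (by simp; ring_nf; simp)) (fun t ht => hE _ (by simp; ring_nf; simp))
    have h3 := coeffs_of_vanish_three_parabolas hF hp
      (fun t ht => hE _ (by simp; ring_nf; simp)) (fun t ht => hE _ (by simp; ring_nf; simp))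
      (fun t ht => hE _ (by simp))
    simp only [jt_mem_models_3]
    grind

theorem isRealizable_models_4 : IsRealizable (models 4) := by
  refine isRealizable_of (E := {v | v 0 * v 1 = 0}) ?_ (by simp) ?_ ?_
  · simpa using isSemialgebraic_eq (x * y) 0
  · rw [models_4_eq_span]
    refine span_singleton_le (jt_mem_vanishingIdeal_of_eq_zero fun v hv => ?_)
    simpa [cubicFun] using hv
  · intro F a b c d e f g h k l hF hE hp
    have h1 := coeffs_of_vanish_ray hF hp (σ := 0) (τ := 1) fun t ht => hE _ (by simp)
    have h2 := coeffs_of_vanish_ray hF hp (σ := 1) (τ := 0) fun t ht => hE _ (by simp)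
    simp only [jt_mem_models_4]
    grind

/-- Two tangent parabolas x = ±y² play the role of the double line of yx², and the line y = 0 is the
simple factor. -/
theorem isRealizable_models_5 : IsRealizable (models 5) := by
  refine isRealizable_of (E := {v | v 1 * v 0 ^ 2 = v 1 ^ 5}) ?_ (by simp) ?_ ?_
  · have h1 := isSemialgebraic_eq (y * x ^ 2) (y ^ 5)
    simpa only [map_pow, map_mul, eval_X] using h1
  · rw [models_5_eq_span]
    refine span_singleton_le (jt_mem_vanishingIdeal _ ((contDiff_coord 1).pow 5)
      (pow_coord_isLittleO (by norm_num) 1) fun v hv => ?_)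
    have hv' : v 1 * v 0 ^ 2 = v 1 ^ 5 := hv
    simp [cubicFun]
    linarith
  · intro F a b c d e f g h k l hF hE hp
    have h1 := coeffs_of_vanish_parabola hF hp (σ := 1) (τ := 1) fun t ht => hE _ (by simp; ring)
    have h2 := coeffs_of_vanish_two_parabolas hF hp
      (fun t ht => hE _ (by simp; ring)) (fun t ht => hE _ (by simp; ring))
    have h3 := coeffs_of_vanish_ray hF hp (σ := 1) (τ := 0) fun t ht => hE _ (by simp)
    simp only [jt_mem_models_5]
    grind

theorem isRealizable_models_6 : IsRealizable (models 6) := by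
  refine isRealizable_of (E := {v | v 0 * v 1 * (v 0 + v 1) = 0}) ?_ (by simp) ?_ ?_
  · simpa using isSemialgebraic_eq (x * y * (x + y)) 0
  · rw [models_6_eq_span]
    refine span_singleton_le (jt_mem_vanishingIdeal_of_eq_zero fun v hv => ?_)
    have hv' : v 0 * v 1 * (v 0 + v 1) = 0 := hv
    simp [cubicFun]
    linarith
  · intro F a b c d e f g h k l hF hE hp
    have h1 := coeffs_of_vanish_ray hF hp (σ := 0) (τ := 1) fun t ht => hE _ (by simp)
    have h2 := coeffs_of_vanish_ray hF hp (σ := 1) (τ := 0) fun t ht => hE _ (by simp)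
    have h3 := coeffs_of_vanish_ray hF hp (σ := 1) (τ := -1) fun t ht => hE _ (by simp)
    simp only [jt_mem_models_6]
    grind

/-- Both branches of the cusp are needed: their difference excludes xy². -/
theorem isRealizable_models_7 : IsRealizable (models 7) := by
  refine isRealizable_of (E := {v | v 0 ^ 2 = v 1 ^ 3}) ?_ (by simp) ?_ ?_
  · have h1 := isSemialgebraic_eq (x ^ 2) (y ^ 3)
    simpa only [map_pow, map_mul, eval_X] using h1
  · rw [models_7_eq_span]
    refine span_singleton_le (jt_mem_vanishingIdeal_of_eq_zero fun v hv => ?_)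
    have hv' : v 0 ^ 2 = v 1 ^ 3 := hv
    simp [cubicFun]
    linarith
  · intro F a b c d e f g h k l hF hE hp
    have h1 := coeffs_of_vanish_cusp hF hp (σ := 1) (τ := 1) fun t ht => hE _ (by simp; ring)
    have h2 := coeffs_of_vanish_two_cusps hF hp
      (fun t ht => hE _ (by simp; ring)) (fun t ht => hE _ (by simp; ring))
    simp only [jt_mem_models_7]
    grind

/-- A half-line continued by x = s⁵, y = −s² with s = √(-y). Then x² = s¹⁰ and xy = −s⁷ are C³ and
o(|v|³), whereas x = |y|^(5/2) is too large. -/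
theorem isRealizable_models_8 : IsRealizable (models 8) := by
  refine isRealizable_of
    (E := {v | v 0 = 0 ∧ 0 ≤ v 1 ∨ v 1 ≤ 0 ∧ 0 ≤ v 0 ∧ v 0 ^ 2 = -v 1 ^ 5}) ?_ (by simp) ?_ ?_
  · have h1 := isSemialgebraic_eq x 0
    have h2 := isSemialgebraic_le 0 y
    have h3 := isSemialgebraic_le y 0
    have h4 := isSemialgebraic_le 0 x
    have h5 := isSemialgebraic_eq (x ^ 2) (-y ^ 5)
    simp at h1 h2 h3 h4 h5
    exact (h1.inter h2).union (h3.inter (h4.inter h5))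
  · rw [models_8_eq_span]
    refine span_pair_le (jt_mem_vanishingIdeal (fun v => √(-v 1) ^ 10)
      (contDiff_sqrt_pow_neg_coord (by norm_num) 1) (sqrt_pow_neg_coord_isLittleO (by norm_num) 1)
      ?_) (jt_mem_vanishingIdeal (fun v => -√(-v 1) ^ 7)
      (contDiff_sqrt_pow_neg_coord le_rfl 1).neg (sqrt_pow_neg_coord_isLittleO le_rfl 1).neg_left
      ?_)
    all_goals
      rintro v (⟨hx, hy⟩ | ⟨hy, hx, hxy⟩)
      · simp [cubicFun, hx, Real.sqrt_eq_zero_of_nonpos (neg_nonpos.2 hy)]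
      · have hs := Real.sq_sqrt (neg_nonneg.2 hy)
        have hx' := eq_sqrt_pow (n := 5) hx (neg_nonneg.2 hy) (by rw [hxy]; ring)
        have hy' : v 1 = -√(-v 1) ^ 2 := by linarith
        generalize √(-v 1) = s at *
        simp [cubicFun]
        rw [hx']
        try rw [hy']
        ring
  · intro F a b c d e f g h k l hF hE hp
    have h1 := coeffs_of_vanish_ray hF hp (σ := 0) (τ := 1) fun t ht => hE _ (by simp [ht.le])
    have h2 := coeffs_of_vanish_quintic hF hp (σ := 1) (τ := -1) fun t ht =>
      hE _ (Or.inr ⟨by simp; positivity, by simp; positivity, by simp; ring⟩)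
    simp only [jt_mem_models_8]
    grind

/-- A half-line continued by the half-parabola x = y². There x² and xy² equal y⁴, while xy equals y³
on one side and 0 on the other, which excludes it. -/
theorem isRealizable_models_9 : IsRealizable (models 9) := by
  refine isRealizable_of
    (E := {v | v 0 = 0 ∧ 0 ≤ v 1 ∨ v 1 ≤ 0 ∧ v 0 = v 1 ^ 2}) ?_ (by simp) ?_ ?_
  · have h1 := isSemialgebraic_eq x 0
    have h2 := isSemialgebraic_le 0 y
    have h3 := isSemialgebraic_le y 0
    have h4 := isSemialgebraic_eq x (y ^ 2)
    simp at h1 h2 h3 h4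
    exact (h1.inter h2).union (h3.inter h4)
  · rw [models_9_eq_span]
    refine span_pair_le (jt_mem_vanishingIdeal (fun v => √(-v 1) ^ 8)
      (contDiff_sqrt_pow_neg_coord (by norm_num) 1) (sqrt_pow_neg_coord_isLittleO (by norm_num) 1)
      ?_) (jt_mem_vanishingIdeal (fun v => √(-v 1) ^ 8)
      (contDiff_sqrt_pow_neg_coord (by norm_num) 1) (sqrt_pow_neg_coord_isLittleO (by norm_num) 1)
      ?_)
    all_goals
      rintro v (⟨hx, hy⟩ | ⟨hy, hxy⟩)
      · simp [cubicFun, hx, Real.sqrt_eq_zero_of_nonpos (neg_nonpos.2 hy)]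
      · have hs := Real.sq_sqrt (neg_nonneg.2 hy)
        have hy' : v 1 = -√(-v 1) ^ 2 := by linarith
        generalize √(-v 1) = s at *
        simp [cubicFun]
        rw [hxy, hy']
        ring
  · intro F a b c d e f g h k l hF hE hp
    have h1 := coeffs_of_vanish_ray hF hp (σ := 0) (τ := 1) fun t ht => hE _ (by simp [ht.le])
    have h2 := coeffs_of_vanish_parabola hF hp (σ := 1) (τ := -1) fun t ht =>
      hE _ (Or.inr ⟨by simp [ht.le], by simp⟩)
    simp only [jt_mem_models_9]
    grind

/-- The two axes, with the negative x-half-axis bent into y = x². The bend excludes xy but leaves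
x²y = x⁴ and xy² = x⁵ of order above three. -/
theorem isRealizable_models_10 : IsRealizable (models 10) := by
  refine isRealizable_of
    (E := {v | v 0 = 0 ∨ v 1 = 0 ∧ 0 ≤ v 0 ∨ v 0 ≤ 0 ∧ v 1 = v 0 ^ 2}) ?_ (by simp) ?_ ?_
  · have h1 := isSemialgebraic_eq x 0
    have h2 := isSemialgebraic_eq y 0
    have h3 := isSemialgebraic_le 0 x
    have h4 := isSemialgebraic_le x 0
    have h5 := isSemialgebraic_eq y (x ^ 2)
    simp at h1 h2 h3 h4 h5
    exact h1.union ((h2.inter h3).union (h4.inter h5))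
  · rw [models_10_eq_span]
    refine span_pair_le (jt_mem_vanishingIdeal (fun v => √(-v 0) ^ 8)
      (contDiff_sqrt_pow_neg_coord (by norm_num) 0) (sqrt_pow_neg_coord_isLittleO (by norm_num) 0)
      ?_) (jt_mem_vanishingIdeal (fun v => -√(-v 0) ^ 10)
      (contDiff_sqrt_pow_neg_coord (by norm_num) 0).neg
      (sqrt_pow_neg_coord_isLittleO (by norm_num) 0).neg_left ?_)
    all_goals
      rintro v (hx | ⟨hy, hx⟩ | ⟨hx, hxy⟩)
      · simp [cubicFun, hx]
      · simp [cubicFun, hy, Real.sqrt_eq_zero_of_nonpos (neg_nonpos.2 hx)]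
      · have hs := Real.sq_sqrt (neg_nonneg.2 hx)
        have hx' : v 0 = -√(-v 0) ^ 2 := by linarith
        generalize √(-v 0) = s at *
        simp [cubicFun]
        rw [hxy, hx']
        ring
  · intro F a b c d e f g h k l hF hE hp
    have h1 := coeffs_of_vanish_ray hF hp (σ := 0) (τ := 1) fun t ht => hE _ (by simp)
    have h2 := coeffs_of_vanish_ray hF hp (σ := 1) (τ := 0) fun t ht => hE _ (by simp [ht.le])
    have h3 := coeffs_of_vanish_parabola' hF hp (σ := -1) (τ := 1) fun t ht =>
      hE _ (Or.inr (Or.inr ⟨by simp [ht.le], by simp⟩))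
    simp only [jt_mem_models_10]
    grind

/-- The half-parabolas x = ±y² in y ≥ 0 exclude xy², and the half-cusp x = |y|^(3/2) in y ≤ 0
excludes x². The correction terms have separate factors supported on the two half-planes. -/
theorem isRealizable_models_11 : IsRealizable (models 11) := by
  refine isRealizable_of
    (E := {v | 0 ≤ v 1 ∧ v 0 ^ 2 = v 1 ^ 4 ∨ v 1 ≤ 0 ∧ 0 ≤ v 0 ∧ v 0 ^ 2 = -v 1 ^ 3}) ?_
    (by simp) ?_ ?_
  · have h1 := isSemialgebraic_le 0 y
    have h2 := isSemialgebraic_eq (x ^ 2) (y ^ 4)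
    have h3 := isSemialgebraic_le y 0
    have h4 := isSemialgebraic_le 0 x
    have h5 := isSemialgebraic_eq (x ^ 2) (-y ^ 3)
    simp at h1 h2 h3 h4 h5
    exact (h1.inter h2).union (h3.inter (h4.inter h5))
  · rw [models_11_eq_span]
    refine span_pair_le (jt_mem_vanishingIdeal (fun v => v 0 * √(v 1) ^ 8 + √(-v 1) ^ 9)
      (((contDiff_coord 0).mul (contDiff_sqrt_pow_coord (by norm_num) 1)).add
        (contDiff_sqrt_pow_neg_coord (by norm_num) 1))
      ((coord_mul_isLittleO (sqrt_pow_coord_isLittleO (by norm_num) 1) 0).add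
        (sqrt_pow_neg_coord_isLittleO (by norm_num) 1)) ?_)
      (jt_mem_vanishingIdeal (fun v => √(v 1) ^ 10 - √(-v 1) ^ 8)
      ((contDiff_sqrt_pow_coord (by norm_num) 1).sub (contDiff_sqrt_pow_neg_coord (by norm_num) 1))
      ((sqrt_pow_coord_isLittleO (by norm_num) 1).sub
        (sqrt_pow_neg_coord_isLittleO (by norm_num) 1)) ?_)
    all_goals
      rintro v (⟨hy, hxy⟩ | ⟨hy, hx, hxy⟩)
      · rw [Real.sqrt_eq_zero_of_nonpos (neg_nonpos.2 hy)]
        have hs := Real.sq_sqrt hy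
        generalize √(v 1) = s at *
        simp [cubicFun]
        rw [← hs] at hxy
        try rw [← hs]
        try rw [pow_succ (v 0) 2]
        rw [hxy]
        ring
      · rw [Real.sqrt_eq_zero_of_nonpos hy]
        have hs := Real.sq_sqrt (neg_nonneg.2 hy)
        have hx' := eq_sqrt_pow (n := 3) hx (neg_nonneg.2 hy) (by rw [hxy]; ring)
        have hy' : v 1 = -√(-v 1) ^ 2 := by linarith
        generalize √(-v 1) = s at *
        simp [cubicFun]
        rw [hx']
        try rw [hy']
        ring
  · intro F a b c d e f g h k l hF hE hp
    have h1 := coeffs_of_vanish_parabola hF hp (σ := 1) (τ := 1) fun t ht =>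
      hE _ (Or.inl ⟨by simp [ht.le], by simp; ring⟩)
    have h2 := coeffs_of_vanish_two_parabolas hF hp
      (fun t ht => hE _ (Or.inl ⟨by simp [ht.le], by simp; ring⟩))
      (fun t ht => hE _ (Or.inl ⟨by simp [ht.le], by simp; ring⟩))
    have h3 := coeffs_of_vanish_cusp hF hp (σ := 1) (τ := -1) fun t ht =>
      hE _ (Or.inr ⟨by simp; positivity, by simp; positivity, by simp; ring⟩)
    simp only [jt_mem_models_11]
    grind

/-- With a single branch x = y^(3/2) there is no first difference, and xy² = √y⁷ is just small and
smooth enough to belong to the ideal. -/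
theorem isRealizable_models_12 : IsRealizable (models 12) := by
  refine isRealizable_of (E := {v | 0 ≤ v 0 ∧ v 0 ^ 2 = v 1 ^ 3}) ?_ (by simp) ?_ ?_
  · have h1 := isSemialgebraic_le 0 x
    have h2 := isSemialgebraic_eq (x ^ 2) (y ^ 3)
    simp at h1 h2
    exact h1.inter h2
  · rw [models_12_eq_span]
    refine span_pair_le (jt_mem_vanishingIdeal_of_eq_zero ?_)
      (jt_mem_vanishingIdeal (fun v => √(v 1) ^ 7)
      (contDiff_sqrt_pow_coord le_rfl 1) (sqrt_pow_coord_isLittleO le_rfl 1) ?_)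
    · rintro v ⟨hx, hxy⟩
      simp [cubicFun]
      linarith
    · rintro v ⟨hx, hxy⟩
      have hy : 0 ≤ v 1 := by
        by_contra! hy
        have h1 : v 1 ^ 3 < 0 := Odd.pow_neg (by decide) hy
        nlinarith [sq_nonneg (v 0)]
      have hs := Real.sq_sqrt hy
      have hx' := eq_sqrt_pow (n := 3) hx hy hxy
      generalize √(v 1) = s at *
      simp [cubicFun]
      rw [hx', ← hs]
      ring
  · intro F a b c d e f g h k l hF hE hp
    have h1 := coeffs_of_vanish_cusp hF hp (σ := 1) (τ := 1) fun t ht =>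
      hE _ ⟨by simp; positivity, by simp; ring⟩
    simp only [jt_mem_models_12]
    grind

theorem isRealizable_models_13 : IsRealizable (models 13) := by
  refine isRealizable_of (E := {v | v 0 = 0 ∧ v 1 = 0}) ?_ (by simp) ?_ ?_
  · have h1 := isSemialgebraic_eq x 0
    have h2 := isSemialgebraic_eq y 0
    simp at h1 h2
    exact h1.inter h2
  · rw [models_13_eq_span]
    refine span_pair_le (jt_mem_vanishingIdeal_of_eq_zero ?_) (jt_mem_vanishingIdeal_of_eq_zero ?_)
    all_goals
      rintro v ⟨hx, hy⟩
      simp [cubicFun, hx, hy]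
  · intro F a b c d e f g h k l hF hE hp
    -- The degenerate ray that stays at the origin.
    have h1 := (coeffs_of_vanish_ray hF hp (σ := 0) (τ := 0) fun t ht => hE _ (by simp)).1
    simpa [jt_mem_models_13] using h1

/-- With s = √(-y) on the half-cusp, x³, x²y and xy² are s⁹, −s⁸ and s⁷. The half-line excludes y³,
after which the half-cusp excludes x². -/
theorem isRealizable_models_14 : IsRealizable (models 14) := by
  refine isRealizable_of
    (E := {v | v 0 = 0 ∧ 0 ≤ v 1 ∨ v 1 ≤ 0 ∧ 0 ≤ v 0 ∧ v 0 ^ 2 = -v 1 ^ 3}) ?_ (by simp) ?_ ?_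
  · have h1 := isSemialgebraic_eq x 0
    have h2 := isSemialgebraic_le 0 y
    have h3 := isSemialgebraic_le y 0
    have h4 := isSemialgebraic_le 0 x
    have h5 := isSemialgebraic_eq (x ^ 2) (-y ^ 3)
    simp at h1 h2 h3 h4 h5
    exact (h1.inter h2).union (h3.inter (h4.inter h5))
  · rw [models_14_eq_span]
    refine span_triple_le (jt_mem_vanishingIdeal (fun v => √(-v 1) ^ 9)
      (contDiff_sqrt_pow_neg_coord (by norm_num) 1) (sqrt_pow_neg_coord_isLittleO (by norm_num) 1)
      ?_) (jt_mem_vanishingIdeal (fun v => -√(-v 1) ^ 8)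
      (contDiff_sqrt_pow_neg_coord (by norm_num) 1).neg
      (sqrt_pow_neg_coord_isLittleO (by norm_num) 1).neg_left ?_)
      (jt_mem_vanishingIdeal (fun v => √(-v 1) ^ 7)
      (contDiff_sqrt_pow_neg_coord le_rfl 1) (sqrt_pow_neg_coord_isLittleO le_rfl 1) ?_)
    all_goals
      rintro v (⟨hx, hy⟩ | ⟨hy, hx, hxy⟩)
      · simp [cubicFun, hx, Real.sqrt_eq_zero_of_nonpos (neg_nonpos.2 hy)]
      · have hs := Real.sq_sqrt (neg_nonneg.2 hy)
        have hx' := eq_sqrt_pow (n := 3) hx (neg_nonneg.2 hy) (by rw [hxy]; ring)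
        have hy' : v 1 = -√(-v 1) ^ 2 := by linarith
        generalize √(-v 1) = s at *
        simp [cubicFun]
        rw [hx']
        try rw [hy']
        ring
  · intro F a b c d e f g h k l hF hE hp
    have h1 := coeffs_of_vanish_ray hF hp (σ := 0) (τ := 1) fun t ht => hE _ (by simp [ht.le])
    have h2 := coeffs_of_vanish_cusp hF hp (σ := 1) (τ := -1) fun t ht =>
      hE _ (Or.inr ⟨by simp; positivity, by simp; positivity, by simp; ring⟩)
    simp only [jt_mem_models_14]
    grind

theorem isRealizable_models (i : Fin 15) : IsRealizable (models i) := by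
  fin_cases i
  exacts [isRealizable_models_0, isRealizable_models_1, isRealizable_models_2,
    isRealizable_models_3, isRealizable_models_4, isRealizable_models_5, isRealizable_models_6,
    isRealizable_models_7, isRealizable_models_8, isRealizable_models_9, isRealizable_models_10,
    isRealizable_models_11, isRealizable_models_12, isRealizable_models_13, isRealizable_models_14]

end ClosedJetIdeals

end

/-! ### Homogeneous quotients and what closedness provides. -/

noncomputable section

namespace ClosedJetIdeals

open Filter Topology Asymptotics
open scoped ContDiff

/-- The function is smooth away from the origin and positively homogeneous of degree `k`. -/
def IsSmoothHomogeneous (k : ℤ) (f : Plane → ℝ) : Prop :=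
  ContDiffOn ℝ ∞ f {0}ᶜ ∧ ∀ t > 0, ∀ v ≠ 0, f (t • v) = t ^ k * f v

theorem IsSmoothHomogeneous.contDiffAt {k : ℤ} {f : Plane → ℝ} (hf : IsSmoothHomogeneous k f)
    {v : Plane} (hv : v ≠ 0) : ContDiffAt ℝ ∞ f v :=
  hf.1.contDiffAt (isOpen_compl_singleton.mem_nhds hv)

theorem IsSmoothHomogeneous.partialDeriv {k : ℤ} {f : Plane → ℝ} (hf : IsSmoothHomogeneous k f)
    (i : Fin 2) : IsSmoothHomogeneous (k - 1) (partialD i f) := by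
  refine ⟨?_, fun t ht v hv => ?_⟩
  · have h1 : ContDiffOn ℝ ∞ (fderiv ℝ f) {0}ᶜ :=
      hf.1.fderiv_of_isOpen isOpen_compl_singleton (by simp)
    exact h1.clm_apply contDiffOn_const
  · have htv : t • v ≠ 0 := smul_ne_zero ht.ne' hv
    have h1 : (fun u => f (t • u)) =ᶠ[𝓝 v] fun u => t ^ k * f u := by
      filter_upwards [isOpen_compl_singleton.mem_nhds hv] with u hu
      exact hf.2 t ht u hu
    have hd : DifferentiableAt ℝ f v := (hf.contDiffAt hv).differentiableAt (by simp)
    have hdt : DifferentiableAt ℝ f (t • v) := (hf.contDiffAt htv).differentiableAt (by simp)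
    have h2 : HasFDerivAt (fun u => f (t • u)) ((fderiv ℝ f (t • v)).comp
        (t • ContinuousLinearMap.id ℝ Plane)) v :=
      hdt.hasFDerivAt.comp v ((hasFDerivAt_id v).const_smul t)
    have h3 : HasFDerivAt (fun u => t ^ k * f u) (t ^ k • fderiv ℝ f v) v :=
      hd.hasFDerivAt.const_mul _
    have h4 := (h2.congr_of_eventuallyEq h1.symm).unique h3
    have h5 := congrArg (fun L => L (EuclideanSpace.single i (1 : ℝ))) h4
    simp only [ContinuousLinearMap.comp_apply, smul_apply,
      ContinuousLinearMap.id_apply, map_smul, smul_eq_mul] at h5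
    rw [partialD, partialD, zpow_sub_one₀ ht.ne']
    field_simp
    linarith

theorem IsSmoothHomogeneous.iterate_partialD {k : ℤ} {f : Plane → ℝ}
    (hf : IsSmoothHomogeneous k f) (i : Fin 2) (n : ℕ) :
    IsSmoothHomogeneous (k - n) ((partialD i)^[n] f) := by
  induction n with
  | zero => simpa using hf
  | succ n ih =>
    rw [Function.iterate_succ_apply']
    have := ih.partialDeriv i
    rwa [sub_sub, ← Nat.cast_succ] at this

theorem IsSmoothHomogeneous.exists_bound {k : ℤ} {f : Plane → ℝ} (hf : IsSmoothHomogeneous k f) :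
    ∃ C ≥ 0, ∀ v ≠ 0, |f v| ≤ C * ‖v‖ ^ k := by
  have hsub : Metric.sphere (0 : Plane) 1 ⊆ {0}ᶜ := by
    rintro v hv rfl
    simp at hv
  obtain ⟨C, hC⟩ := (isCompact_sphere (0 : Plane) 1).exists_bound_of_continuousOn
    (hf.1.continuousOn.mono hsub)
  refine ⟨max C 0, le_max_right _ _, fun v hv => ?_⟩
  have hn : 0 < ‖v‖ := norm_pos_iff.2 hv
  have h1 : (‖v‖⁻¹ • v) ∈ Metric.sphere (0 : Plane) 1 := by
    simp [norm_smul, hn.ne']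
  have h2 := hC _ h1
  have h3 := hf.2 ‖v‖ hn _ (hsub h1)
  rw [smul_inv_smul₀ hn.ne'] at h3
  rw [h3, abs_mul, abs_of_pos (zpow_pos hn k), mul_comm]
  gcongr
  exact h2.trans (le_max_left _ _)

/-- A derivative of order j is homogeneous of degree −j, hence bounded by a constant times |v|^(−j)
by compactness of the circle. This is why homogeneous quotients satisfy the bounds on S in `Implies`
at every scale with one constant A. -/
theorem IsSmoothHomogeneous.exists_multiD_bound {f : Plane → ℝ} (hf : IsSmoothHomogeneous 0 f) :
    ∃ A > 0, ∀ ρ > 0, ∀ v ∈ annulus 2 4 ρ, ∀ α : Fin 2 →₀ ℕ, α.degree ≤ 3 →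
      |multiD α f v| ≤ A * (ρ ^ α.degree)⁻¹ := by
  have h1 : ∀ i j : ℕ, ∃ C ≥ 0, ∀ v ≠ 0,
      |((partialD 0)^[i] ((partialD 1)^[j] f)) v| ≤ C * ‖v‖ ^ (0 - (j : ℤ) - (i : ℤ)) := fun i j =>
    ((hf.iterate_partialD 1 j).iterate_partialD 0 i).exists_bound
  choose C hC0 hC using h1
  have hsum : 0 ≤ ∑ i ∈ Finset.range 4, ∑ j ∈ Finset.range 4, C i j :=
    Finset.sum_nonneg fun i _ => Finset.sum_nonneg fun j _ => hC0 i j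
  -- On the annulus |v| > ρ/4, which costs at most 4³ = 64; the summand 1 keeps A positive.
  refine ⟨1 + 64 * ∑ i ∈ Finset.range 4, ∑ j ∈ Finset.range 4, C i j, by positivity,
    fun ρ hρ v hv α hα => ?_⟩
  have hdeg : α.degree = α 0 + α 1 := by
    rw [Finsupp.degree_eq_sum, Fin.sum_univ_two]
  have hn : ρ / 4 < ‖v‖ := hv.1
  have hn0 : 0 < ‖v‖ := lt_trans (by positivity) hn
  have hv0 : v ≠ 0 := norm_pos_iff.1 hn0
  have h2 := hC (α 0) (α 1) v hv0
  rw [multiD_two]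
  refine h2.trans ?_
  have hexp : (0 : ℤ) - (α 1 : ℤ) - (α 0 : ℤ) = -(α.degree : ℤ) := by
    rw [hdeg]
    push_cast
    ring
  rw [hexp, zpow_neg, zpow_natCast]
  have hCle : C (α 0) (α 1) ≤ ∑ i ∈ Finset.range 4, ∑ j ∈ Finset.range 4, C i j := by
    have ha : α 0 ∈ Finset.range 4 := Finset.mem_range.2 (by omega)
    have hb : α 1 ∈ Finset.range 4 := Finset.mem_range.2 (by omega)
    exact (Finset.single_le_sum (fun j _ => hC0 (α 0) j) hb).trans
      (Finset.single_le_sum (f := fun i => ∑ j ∈ Finset.range 4, C i j)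
        (fun i _ => Finset.sum_nonneg fun j _ => hC0 i j) ha)
  have hpow : (‖v‖ ^ α.degree)⁻¹ ≤ 64 * (ρ ^ α.degree)⁻¹ := by
    calc (‖v‖ ^ α.degree)⁻¹ ≤ ((ρ / 4) ^ α.degree)⁻¹ := by gcongr
      _ = 4 ^ α.degree * (ρ ^ α.degree)⁻¹ := by rw [div_pow, inv_div, div_eq_mul_inv]
      _ ≤ 4 ^ 3 * (ρ ^ α.degree)⁻¹ := by gcongr; norm_num
      _ = 64 * (ρ ^ α.degree)⁻¹ := by norm_num
  calc C (α 0) (α 1) * (‖v‖ ^ α.degree)⁻¹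
      ≤ (∑ i ∈ Finset.range 4, ∑ j ∈ Finset.range 4, C i j) * (64 * (ρ ^ α.degree)⁻¹) := by
        gcongr
    _ ≤ _ := by
        have : 0 ≤ (ρ ^ α.degree)⁻¹ := by positivity
        nlinarith

/-- A smooth function that equals `s⁻¹` for `s ≥ ε` and vanishes near `s ≤ 0`. -/
def cutoffInv (ε s : ℝ) : ℝ := Real.smoothTransition (2 * s / ε - 1) * s⁻¹

theorem contDiff_cutoffInv {ε : ℝ} (hε : 0 < ε) : ContDiff ℝ ∞ (cutoffInv ε) := by
  rw [contDiff_iff_contDiffAt]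
  intro s
  by_cases hs : s = 0
  · subst hs
    have h1 : cutoffInv ε =ᶠ[𝓝 0] fun _ => 0 := by
      filter_upwards [eventually_lt_nhds (half_pos hε)] with s hs
      rw [cutoffInv, Real.smoothTransition.zero_of_nonpos, zero_mul]
      rw [sub_nonpos, div_le_one hε]
      linarith
    exact contDiffAt_const.congr_of_eventuallyEq h1
  · have h1 : ContDiff ℝ ∞ fun s : ℝ => Real.smoothTransition (2 * s / ε - 1) := by
      refine Real.smoothTransition.contDiff.comp ?_
      fun_prop
    exact h1.contDiffAt.mul (contDiffAt_id.inv hs)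

theorem cutoffInv_eq {ε s : ℝ} (hε : 0 < ε) (hs : ε ≤ s) : cutoffInv ε s = s⁻¹ := by
  rw [cutoffInv, Real.smoothTransition.one_of_one_le, one_mul]
  rw [le_sub_iff_add_le, le_div_iff₀ hε]
  linarith

/-- The quotient of two homogeneous functions can be extended from the cone where the denominator
is not small to a homogeneous function. -/
theorem exists_homogeneous_quotient {u w : Plane → ℝ} {d : ℕ} (hu : ContDiff ℝ ∞ u)
    (hw : ContDiff ℝ ∞ w) (hu' : ∀ t > 0, ∀ v, u (t • v) = t ^ d * u v)
    (hw' : ∀ t > 0, ∀ v, w (t • v) = t ^ d * w v) {ε : ℝ} (hε : 0 < ε) :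
    ∃ S : Plane → ℝ, IsSmoothHomogeneous 0 S ∧
      ∀ v ≠ 0, ε ≤ w (‖v‖⁻¹ • v) ^ 2 → S v * w v = u v := by
  have hN : ContDiff ℝ ∞ fun v : Plane => (‖v‖ ^ 2) ^ d := (contDiff_norm_sq ℝ).pow d
  have hN0 : ∀ v : Plane, v ≠ 0 → (‖v‖ ^ 2) ^ d ≠ 0 := fun v hv => by
    have := norm_pos_iff.2 hv
    positivity
  -- This is u/w written as uw/w², with both parts divided by |v|^(2d) to have degree zero and the
  -- reciprocal cut off where w² is small.
  refine ⟨fun v => u v * w v * ((‖v‖ ^ 2) ^ d)⁻¹ * cutoffInv ε (w v ^ 2 * ((‖v‖ ^ 2) ^ d)⁻¹),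
    ⟨?_, ?_⟩, ?_⟩
  · have hinv : ContDiffOn ℝ ∞ (fun v : Plane => ((‖v‖ ^ 2) ^ d)⁻¹) {0}ᶜ :=
      hN.contDiffOn.inv fun v hv => hN0 v hv
    exact ((hu.mul hw).contDiffOn.mul hinv).mul
      ((contDiff_cutoffInv hε).comp_contDiffOn ((hw.pow 2).contDiffOn.mul hinv))
  · intro t ht v hv
    have h1 : (‖t • v‖ ^ 2) ^ d = t ^ d * t ^ d * (‖v‖ ^ 2) ^ d := by
      rw [norm_smul, Real.norm_of_nonneg ht.le]
      ring
    have h2 := hN0 v hv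
    have h3 : t ^ d ≠ 0 := by positivity
    have h4 : w (t • v) ^ 2 * ((‖t • v‖ ^ 2) ^ d)⁻¹ = w v ^ 2 * ((‖v‖ ^ 2) ^ d)⁻¹ := by
      rw [h1, hw' t ht]
      field_simp
    simp only [h4]
    rw [h1, hw' t ht, hu' t ht, zpow_zero, one_mul]
    field_simp
  · intro v hv hε'
    have hn : 0 < ‖v‖ := norm_pos_iff.2 hv
    have h1 : w (‖v‖⁻¹ • v) ^ 2 = w v ^ 2 * ((‖v‖ ^ 2) ^ d)⁻¹ := by
      rw [hw' _ (inv_pos.2 hn), mul_pow, ← pow_mul, ← pow_mul, inv_pow, mul_comm d 2, mul_comm]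
    have h2 : w v ≠ 0 := by
      intro h
      rw [h1, h] at hε'
      simp at hε'
      linarith
    have h3 := hN0 v hv
    rw [h1] at hε'
    simp only [cutoffInv_eq hε hε']
    field_simp

/-- A sufficient condition for the direction of `v` to be forbidden. -/
def Repels (I : Ideal (JetRing 3 2)) (v : Plane) : Prop :=
  ∃ p ∈ I, ∃ q ∈ I, ∃ c > 0, ∃ r > 0, ∀ᶠ u in 𝓝 v, ∀ t : ℝ, 0 < t → t < r →
    c * t ^ 3 < |jetEval p (t • u)| + |jetEval q (t • u)|

theorem isOpen_setOf_repels (I : Ideal (JetRing 3 2)) : IsOpen {v | Repels I v} := by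
  rw [isOpen_iff_eventually]
  rintro v ⟨p, hp, q, hq, c, hc, r, hr, h⟩
  filter_upwards [h.eventually_nhds] with u hu
  exact ⟨p, hp, q, hq, c, hc, r, hr, hu⟩

theorem Repels.mem_forb {I : Ideal (JetRing 3 2)} {θ : Plane} (hθ : ‖θ‖ = 1) (h : Repels I θ) :
    θ ∈ forb I := by
  obtain ⟨p, hp, q, hq, c, hc, r, hr, h⟩ := h
  obtain ⟨δ, hδ, hball⟩ := Metric.eventually_nhds_iff.1 h
  refine ⟨hθ, 2, ![p, q], ?_, c, hc, δ, hδ, r, hr, ?_⟩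
  · intro l
    fin_cases l
    exacts [hp, hq]
  · rintro v ⟨hv0, hvr, hvδ⟩
    have := hball hvδ ‖v‖ hv0 hvr
    rw [smul_inv_smul₀ hv0.ne'] at this
    rw [Fin.sum_univ_two]
    exact this

/-- The consequences of closedness used in the classification. -/
structure IsSaturated (I : Ideal (JetRing 3 2)) : Prop where
  le : I ≤ jetsAtZero 3 2
  mem_of_mul_eq : ∀ p ∈ jetsAtZero 3 2, ∀ q ∈ I, ∀ (d : ℕ) (u w : Plane → ℝ),
    ContDiff ℝ ∞ u → ContDiff ℝ ∞ w → (∀ t > 0, ∀ v, u (t • v) = t ^ d * u v) →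
    (∀ t > 0, ∀ v, w (t • v) = t ^ d * w v) →
    (∀ v, w v * jetEval p v = u v * jetEval q v) →
    (∀ v ≠ 0, w v = 0 → Repels I v) → p ∈ I

/-- The unit vectors that are not repelled form a compact set containing the allowed directions, and
w has no zero on it. Compactness gives both the lower bound ε and the width δ. -/
theorem exists_lower_bound_near_allow {I : Ideal (JetRing 3 2)} {w : Plane → ℝ} (hw : Continuous w)
    (h : ∀ v ≠ 0, w v = 0 → Repels I v) :
    ∃ ε > 0, ∃ δ > 0, ∀ v, (∃ θ ∈ allow I, dist v θ < δ) → ε ≤ w v ^ 2 := by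
  let K : Set Plane := Metric.sphere 0 1 ∩ {v | Repels I v}ᶜ
  have hK : IsCompact K :=
    (isCompact_sphere 0 1).inter_right (isOpen_setOf_repels I).isClosed_compl
  have hallow : allow I ⊆ K := fun θ hθ =>
    ⟨by simpa using hθ.1, fun hr => hθ.2 (hr.mem_forb hθ.1)⟩
  have hpos : ∀ θ ∈ K, 0 < w θ ^ 2 := fun θ hθ => by
    have hθ0 : θ ≠ 0 := by
      rintro rfl
      simpa using hθ.1
    have : w θ ≠ 0 := fun h0 => hθ.2 (h θ hθ0 h0)
    positivity
  obtain ⟨ε, hε, hεK⟩ : ∃ ε > 0, ∀ θ ∈ K, ε < w θ ^ 2 := by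
    rcases K.eq_empty_or_nonempty with hKe | hKn
    · exact ⟨1, one_pos, by simp [hKe]⟩
    · obtain ⟨θ₀, hθ₀, hmin⟩ := hK.exists_isMinOn hKn (hw.pow 2).continuousOn
      refine ⟨w θ₀ ^ 2 / 2, half_pos (hpos θ₀ hθ₀), fun θ hθ => ?_⟩
      exact (half_lt_self (hpos θ₀ hθ₀)).trans_le (hmin hθ)
  obtain ⟨δ, hδ, hsub⟩ := hK.exists_thickening_subset_open
    (isOpen_lt continuous_const (hw.pow 2)) hεK
  refine ⟨ε, hε, δ, hδ, fun v ⟨θ, hθ, hd⟩ => ?_⟩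
  exact le_of_lt (hsub (Metric.mem_thickening_iff.2 ⟨θ, hallow hθ, hd⟩))

theorem iterate_partialD_zero (i : Fin 2) (n : ℕ) :
    (partialD i)^[n] (fun _ : Plane => (0 : ℝ)) = fun _ => 0 := by
  induction n with
  | zero => rfl
  | succ n ih =>
    rw [Function.iterate_succ_apply', ih]
    ext v
    simp [partialD]

theorem IsClosedIdeal.isSaturated {I : Ideal (JetRing 3 2)} (hI : IsClosedIdeal I) :
    IsSaturated I := by
  refine ⟨hI.1, fun p hp q hq d u w hu hw hu' hw' hpq hrep => ?_⟩
  rw [← SetLike.mem_coe, hI.2]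
  refine ⟨hp, ?_⟩
  obtain ⟨ε, hε, δ, hδ, hlow⟩ := exists_lower_bound_near_allow hw.continuous hrep
  obtain ⟨S, hS, hSw⟩ := exists_homogeneous_quotient hu hw hu' hw' hε
  obtain ⟨A, hA, hbound⟩ := hS.exists_multiD_bound
  -- The error term F is zero and S does not depend on ρ, so the choices serve every ε' at once.
  refine ⟨A, hA, 1, fun _ => q, fun _ => hq, fun ε' hε' => ⟨δ, hδ, 1, one_pos, fun ρ hρ _ => ?_⟩⟩
  have hann : ∀ K : ℝ, 0 < K → annulus 2 K ρ ⊆ {0}ᶜ := by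
    rintro K hK v hv rfl
    have : ρ / K < 0 := by simpa using hv.1
    linarith [div_pos hρ hK]
  refine ⟨fun _ => 0, fun _ => S, contDiffOn_const, fun _ => ?_, ?_, ?_, ?_⟩
  · exact (hS.1.mono (hann 4 (by norm_num))).of_le (WithTop.coe_le_coe.2 le_top)
  · intro v _ α _
    rw [multiD_two, iterate_partialD_zero, iterate_partialD_zero]
    simp only [abs_zero]
    positivity
  · exact fun v hv α hα _ => hbound ρ hρ v hv α hα
  · intro v hv hθ
    have hv0 : v ≠ 0 := hann 2 two_pos hv
    have h1 := hlow _ hθ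
    have h2 := hSw v hv0 h1
    have hw0 : w v ≠ 0 := by
      intro h0
      rw [hw' _ (inv_pos.2 (norm_pos_iff.2 hv0)), h0] at h1
      simp at h1
      linarith
    rw [Fin.sum_univ_one, zero_add]
    refine mul_left_cancel₀ hw0 ?_
    rw [hpq, ← h2]
    ring

end ClosedJetIdeals

end

/-! ### Criteria for forbidden directions, and invariance under linear maps. -/

noncomputable section

namespace ClosedJetIdeals

open Filter Topology Asymptotics
open scoped ContDiff

theorem mem_of_eq_mul {I : Ideal (JetRing 3 2)} {p r : JetRing 3 2} (hp : p ∈ I)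
    (s : JetRing 3 2) (h : r = s * p) : r ∈ I := by
  rw [h]
  exact I.mul_mem_left _ hp

theorem mem_of_eq_mul_add_mul {I : Ideal (JetRing 3 2)} {p q r : JetRing 3 2} (hp : p ∈ I)
    (hq : q ∈ I) (s t : JetRing 3 2) (h : r = s * p + t * q) : r ∈ I := by
  rw [h]
  exact I.add_mem (I.mul_mem_left _ hp) (I.mul_mem_left _ hq)

theorem jt_mem_jetsAtZero {a b c d e f g h k l : ℝ} :
    jt a b c d e f g h k l ∈ jetsAtZero 3 2 ↔ a = 0 :=
  jt_mem_models_13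

/-- P(0, ·) is the leading form of p. If it is non-zero at v, then |p| is at least of order t^k ≥ t³
on a thin cone around v. -/
theorem repels_of_eval_smul {I : Ideal (JetRing 3 2)} {p : JetRing 3 2} (hp : p ∈ I) {v : Plane}
    {k : ℕ} (hk : k ≤ 3) (P : ℝ × Plane → ℝ) (hP : Continuous P)
    (h : ∀ t u, jetEval p (t • u) = t ^ k * P (t, u)) (hv : P (0, v) ≠ 0) : Repels I v := by
  have h0 : 0 < |P (0, v)| := abs_pos.2 hv
  have h1 : ∀ᶠ s : ℝ × Plane in 𝓝 (0, v), |P (0, v)| / 2 < |P s| :=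
    (hP.abs.tendsto _).eventually_const_lt (half_lt_self h0)
  rw [nhds_prod_eq] at h1
  obtain ⟨A, hA, B, hB, hAB⟩ := eventually_prod_iff.1 h1
  obtain ⟨r, hr, hrA⟩ := Metric.eventually_nhds_iff.1 hA
  refine ⟨p, hp, p, hp, |P (0, v)| / 2, half_pos h0, min r 1, lt_min hr one_pos, ?_⟩
  filter_upwards [hB] with u hu t ht0 htr
  have ht : A t := hrA (by
    rw [Real.dist_eq, sub_zero, abs_of_pos ht0]
    exact htr.trans_le (min_le_left _ _))
  have h2 := hAB ht hu
  have h3 : t ^ 3 ≤ t ^ k :=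
    pow_le_pow_of_le_one ht0.le (htr.le.trans (min_le_right _ _)) hk
  have h4 : 0 < t ^ k := by positivity
  rw [h, abs_mul, abs_of_pos h4]
  nlinarith [abs_nonneg (P (t, u))]

theorem repels_of_linear {I : Ideal (JetRing 3 2)} {b c d e f g h k l : ℝ}
    (hp : jt 0 b c d e f g h k l ∈ I) {v : Plane} (hv : b * v 0 + c * v 1 ≠ 0) : Repels I v := by
  refine repels_of_eval_smul hp (k := 1) (by norm_num) (fun s => b * s.2 0 + c * s.2 1 +
    s.1 * (d * s.2 0 ^ 2 + e * s.2 0 * s.2 1 + f * s.2 1 ^ 2) + s.1 ^ 2 * (g * s.2 0 ^ 3 +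
      h * s.2 0 ^ 2 * s.2 1 + k * s.2 0 * s.2 1 ^ 2 + l * s.2 1 ^ 3)) (by fun_prop) ?_ (by simpa)
  intro t u
  rw [jetEval_jt]
  simp only [cubicFun, PiLp.smul_apply, smul_eq_mul]
  ring

theorem repels_of_quadratic {I : Ideal (JetRing 3 2)} {d e f g h k l : ℝ}
    (hp : jt 0 0 0 d e f g h k l ∈ I) {v : Plane}
    (hv : d * v 0 ^ 2 + e * v 0 * v 1 + f * v 1 ^ 2 ≠ 0) : Repels I v := by
  refine repels_of_eval_smul hp (k := 2) (by norm_num) (fun s =>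
    d * s.2 0 ^ 2 + e * s.2 0 * s.2 1 + f * s.2 1 ^ 2 + s.1 * (g * s.2 0 ^ 3 +
      h * s.2 0 ^ 2 * s.2 1 + k * s.2 0 * s.2 1 ^ 2 + l * s.2 1 ^ 3)) (by fun_prop) ?_ (by simpa)
  intro t u
  rw [jetEval_jt]
  simp only [cubicFun, PiLp.smul_apply, smul_eq_mul]
  ring

theorem repels_of_cubic {I : Ideal (JetRing 3 2)} {g h k l : ℝ}
    (hp : jt 0 0 0 0 0 0 g h k l ∈ I) {v : Plane}
    (hv : g * v 0 ^ 3 + h * v 0 ^ 2 * v 1 + k * v 0 * v 1 ^ 2 + l * v 1 ^ 3 ≠ 0) :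
    Repels I v := by
  refine repels_of_eval_smul hp (k := 3) le_rfl (fun s => g * s.2 0 ^ 3 +
      h * s.2 0 ^ 2 * s.2 1 + k * s.2 0 * s.2 1 ^ 2 + l * s.2 1 ^ 3) (by fun_prop) ?_ (by simpa)
  intro t u
  rw [jetEval_jt]
  simp only [cubicFun, PiLp.smul_apply, smul_eq_mul]
  ring

/-- If `x² + ey³` with `e ≠ 0` and `xy + by³` belong to the ideal, then every direction outside the
line `y = 0` is forbidden: a curve on which `xy + by³` is small satisfies `x = O(y²)`. -/
theorem repels_of_cusp {I : Ideal (JetRing 3 2)} {b e : ℝ} (he : e ≠ 0)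
    (hp : jt 0 0 0 1 0 0 0 0 0 e ∈ I) (hq : jt 0 0 0 0 1 0 0 0 0 b ∈ I) {v : Plane} (hv1 : v 1 ≠ 0) :
    Repels I v := by
  set m : ℝ := |v 1| / 2 with hm
  have hv1' : 0 < |v 1| := abs_pos.2 hv1
  have hm0 : 0 < m := half_pos hv1'
  have he' : 0 < |e| := abs_pos.2 he
  -- A quarter of the least size of e·y³ near v. If both jets were at most ct³, then |e y³| ≤ 2c
  -- would follow after rescaling, against |e y³| ≥ 4c.
  set c : ℝ := |e| * m ^ 3 / 4 with hc
  have hc0 : 0 < c := by positivity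
  -- Smallness of xy + by³ gives |u 0| ≤ Kt.
  set K : ℝ := (c + |b| * (4 * m) ^ 3) / m with hK
  have hK0 : 0 ≤ K := by positivity
  have h1 : ∀ᶠ u : Plane in 𝓝 v, m < |u 1| := by
    have : Continuous fun u : Plane => |u 1| := by fun_prop
    exact this.continuousAt.eventually_const_lt (half_lt_self hv1')
  have h2 : ∀ᶠ u : Plane in 𝓝 v, |u 1| < 4 * m := by
    have : Continuous fun u : Plane => |u 1| := by fun_prop
    refine this.continuousAt.eventually_lt_const ?_
    rw [hm]
    linarith
  -- For t below this radius K²t² ≤ ct, so the x² term cannot compensate e·y³.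
  refine ⟨_, hp, _, hq, c, hc0, c / (K ^ 2 + 1), by positivity, ?_⟩
  filter_upwards [h1, h2] with u hu1 hu2 t ht htr
  have h3 : jetEval (jt 0 0 0 1 0 0 0 0 0 e) (t • u) = t ^ 2 * (u 0 ^ 2 + e * u 1 ^ 3 * t) := by
    rw [jetEval_jt]
    simp only [cubicFun, PiLp.smul_apply, smul_eq_mul]
    ring
  have h4 : jetEval (jt 0 0 0 0 1 0 0 0 0 b) (t • u) = t ^ 2 * (u 0 * u 1 + b * u 1 ^ 3 * t) := by
    rw [jetEval_jt]
    simp only [cubicFun, PiLp.smul_apply, smul_eq_mul]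
    ring
  rw [h3, h4, abs_mul, abs_mul, abs_of_pos (by positivity : 0 < t ^ 2), ← mul_add]
  have h5 : c * t ^ 3 = t ^ 2 * (c * t) := by ring
  rw [h5]
  refine mul_lt_mul_of_pos_left ?_ (by positivity)
  by_contra! hcon
  have h6 : |u 0 * u 1 + b * u 1 ^ 3 * t| ≤ c * t := by
    linarith [abs_nonneg (u 0 ^ 2 + e * u 1 ^ 3 * t)]
  have h7 : |u 0 ^ 2 + e * u 1 ^ 3 * t| ≤ c * t := by
    linarith [abs_nonneg (u 0 * u 1 + b * u 1 ^ 3 * t)]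
  have hcube : |u 1| ^ 3 ≤ (4 * m) ^ 3 := by gcongr
  have hcube' : m ^ 3 ≤ |u 1| ^ 3 := by gcongr
  have h8 : |u 0| ≤ K * t := by
    rw [hK, div_mul_eq_mul_div, le_div_iff₀ hm0]
    have h81 : |u 0 * u 1| ≤ |u 0 * u 1 + b * u 1 ^ 3 * t| + |b * u 1 ^ 3 * t| := by
      have := abs_sub (u 0 * u 1 + b * u 1 ^ 3 * t) (b * u 1 ^ 3 * t)
      rwa [add_sub_cancel_right] at this
    rw [abs_mul, abs_mul, abs_mul, abs_pow, abs_of_pos ht] at h81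
    have h82 : |b| * |u 1| ^ 3 * t ≤ |b| * (4 * m) ^ 3 * t := by gcongr
    have h83 : |u 0| * m ≤ |u 0| * |u 1| := by gcongr
    linarith
  have h9 : |e * u 1 ^ 3 * t| ≤ |u 0 ^ 2 + e * u 1 ^ 3 * t| + |u 0 ^ 2| := by
    have := abs_sub (u 0 ^ 2 + e * u 1 ^ 3 * t) (u 0 ^ 2)
    rwa [add_sub_cancel_left] at this
  rw [abs_mul, abs_mul, abs_pow, abs_of_pos ht, abs_pow] at h9
  have h10 : |u 0| ^ 2 ≤ (K * t) ^ 2 := by gcongr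
  have h11 : |e| * m ^ 3 * t ≤ |e| * |u 1| ^ 3 * t := by gcongr
  rw [lt_div_iff₀ (by positivity)] at htr
  have h12 : (K * t) ^ 2 ≤ c * t := by nlinarith
  have h13 : |e| * m ^ 3 * t = 4 * (c * t) := by rw [hc]; ring
  nlinarith [mul_pos hc0 ht]

theorem linearDiffeo_smul {α β γ δ : ℝ} (hdet : α * δ - β * γ ≠ 0) (t : ℝ) (v : Plane) :
    (linearDiffeo α β γ δ hdet).toEquiv (t • v) = t • (linearDiffeo α β γ δ hdet).toEquiv v := by
  ext i
  fin_cases i <;> simp [linearDiffeo] <;> ring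

theorem linearDiffeo_symm_smul {α β γ δ : ℝ} (hdet : α * δ - β * γ ≠ 0) (t : ℝ) (v : Plane) :
    (linearDiffeo α β γ δ hdet).toEquiv.symm (t • v) =
      t • (linearDiffeo α β γ δ hdet).toEquiv.symm v := by
  rw [Equiv.symm_apply_eq, linearDiffeo_smul, Equiv.apply_symm_apply]

theorem contDiff_linearDiffeo_symm {α β γ δ : ℝ} (hdet : α * δ - β * γ ≠ 0) :
    ContDiff ℝ ∞ (linearDiffeo α β γ δ hdet).toEquiv.symm := by
  rw [contDiff_euclidean]
  intro i
  fin_cases i <;> simp [linearDiffeo] <;> fun_prop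

theorem pull_linearDiffeo_mem_jetsAtZero {α β γ δ : ℝ} (hdet : α * δ - β * γ ≠ 0)
    {p : JetRing 3 2} :
    (linearDiffeo α β γ δ hdet).pull p ∈ jetsAtZero 3 2 ↔ p ∈ jetsAtZero 3 2 := by
  obtain ⟨a, b, c, d, e, f, g, h, k, l, rfl⟩ := exists_jt p
  rw [pull_linearDiffeo, jt_mem_jetsAtZero, jt_mem_jetsAtZero]

theorem Repels.of_map {I : Ideal (JetRing 3 2)} {α β γ δ : ℝ} (hdet : α * δ - β * γ ≠ 0)
    {v : Plane} (h : Repels (I.map (linearDiffeo α β γ δ hdet).pull)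
      ((linearDiffeo α β γ δ hdet).toEquiv.symm v)) : Repels I v := by
  obtain ⟨p, hp, q, hq, c, hc, r, hr, h⟩ := h
  obtain ⟨p, hp', rfl⟩ := mem_map_pull.1 hp
  obtain ⟨q, hq', rfl⟩ := mem_map_pull.1 hq
  refine ⟨p, hp', q, hq', c, hc, r, hr, ?_⟩
  filter_upwards [(contDiff_linearDiffeo_symm hdet).continuous.continuousAt.eventually h]
    with u hu t ht htr
  have h1 := hu t ht htr
  rwa [← linearDiffeo_symm_smul, jetEval_pull_linearDiffeo, jetEval_pull_linearDiffeo,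
    Equiv.apply_symm_apply] at h1

/-- Linear changes preserve homogeneity of u and w. Nothing comparable is available for the
nonlinear shears, so below saturation is used before shearing. -/
theorem IsSaturated.map {I : Ideal (JetRing 3 2)} (hI : IsSaturated I) {α β γ δ : ℝ}
    (hdet : α * δ - β * γ ≠ 0) : IsSaturated (I.map (linearDiffeo α β γ δ hdet).pull) := by
  have hS := contDiff_linearDiffeo_symm hdet
  have hSt := linearDiffeo_symm_smul hdet
  have hR := fun v : Plane => @Repels.of_map I α β γ δ hdet v
  have hE := fun p => jetEval_pull_linearDiffeo hdet p
  have h0 := fun p => @pull_linearDiffeo_mem_jetsAtZero α β γ δ hdet p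
  generalize linearDiffeo α β γ δ hdet = φ at *
  refine ⟨fun p hp => ?_, fun p hp q hq d u w hu hw hu' hw' hpq hrep => ?_⟩
  · obtain ⟨p, hp', rfl⟩ := mem_map_pull.1 hp
    exact (h0 p).2 (hI.le hp')
  · obtain ⟨q, hq', rfl⟩ := mem_map_pull.1 hq
    obtain ⟨p, rfl⟩ := φ.pull.surjective p
    rw [pull_mem_map]
    refine hI.mem_of_mul_eq p ((h0 p).1 hp) q hq' d _ _ (hu.comp hS) (hw.comp hS) ?_ ?_ ?_ ?_
    · intro t ht v
      simp only [Function.comp_apply]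
      rw [hSt, hu' t ht]
    · intro t ht v
      simp only [Function.comp_apply]
      rw [hSt, hw' t ht]
    · intro v
      have h1 := hpq (φ.toEquiv.symm v)
      rwa [hE, hE, Equiv.apply_symm_apply] at h1
    · intro v hv hwv
      refine hR v (hrep _ ?_ hwv)
      rw [Ne, Equiv.symm_apply_eq, φ.map_zero]
      exact hv

/-- The jets in `I` have no linear part. -/
def NoLinear (I : Ideal (JetRing 3 2)) : Prop :=
  ∀ a b c d e f g h k l, jt a b c d e f g h k l ∈ I → a = 0 ∧ b = 0 ∧ c = 0

/-- The jets in `I` have neither a linear nor a quadratic part. -/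
def NoQuadratic (I : Ideal (JetRing 3 2)) : Prop :=
  ∀ a b c d e f g h k l, jt a b c d e f g h k l ∈ I →
    a = 0 ∧ b = 0 ∧ c = 0 ∧ d = 0 ∧ e = 0 ∧ f = 0

theorem exists_of_jt_mem_map {I : Ideal (JetRing 3 2)} {φ : OriginDiffeo}
    {a b c d e f g h k l : ℝ} (H : jt a b c d e f g h k l ∈ I.map φ.pull) :
    ∃ a' b' c' d' e' f' g' h' k' l', jt a' b' c' d' e' f' g' h' k' l' ∈ I ∧
      φ.pull (jt a' b' c' d' e' f' g' h' k' l') = jt a b c d e f g h k l := by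
  obtain ⟨p, hp, hpq⟩ := mem_map_pull.1 H
  obtain ⟨a', b', c', d', e', f', g', h', k', l', rfl⟩ := exists_jt p
  exact ⟨_, _, _, _, _, _, _, _, _, _, hp, hpq⟩

theorem NoLinear.map {I : Ideal (JetRing 3 2)} (hI : NoLinear I) {α β γ δ : ℝ}
    (hdet : α * δ - β * γ ≠ 0) : NoLinear (I.map (linearDiffeo α β γ δ hdet).pull) := by
  intro a b c d e f g h k l H
  obtain ⟨a', b', c', d', e', f', g', h', k', l', H', heq⟩ := exists_of_jt_mem_map H
  obtain ⟨rfl, rfl, rfl⟩ := hI _ _ _ _ _ _ _ _ _ _ H'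
  rw [pull_linearDiffeo, jt_inj] at heq
  grind

theorem NoQuadratic.map {I : Ideal (JetRing 3 2)} (hI : NoQuadratic I) {α β γ δ : ℝ}
    (hdet : α * δ - β * γ ≠ 0) : NoQuadratic (I.map (linearDiffeo α β γ δ hdet).pull) := by
  intro a b c d e f g h k l H
  obtain ⟨a', b', c', d', e', f', g', h', k', l', H', heq⟩ := exists_of_jt_mem_map H
  obtain ⟨rfl, rfl, rfl, rfl, rfl, rfl⟩ := hI _ _ _ _ _ _ _ _ _ _ H'
  rw [pull_linearDiffeo, jt_inj] at heq
  grind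

theorem NoQuadratic.noLinear {I : Ideal (JetRing 3 2)} (hI : NoQuadratic I) : NoLinear I :=
  fun _ _ _ _ _ _ _ _ _ _ H => by
    obtain ⟨ha, hb, hc, -⟩ := hI _ _ _ _ _ _ _ _ _ _ H
    exact ⟨ha, hb, hc⟩

/-- With w = u = 0 and q = 0 the division property applies to every p. -/
theorem IsSaturated.eq_jetsAtZero {I : Ideal (JetRing 3 2)} (hI : IsSaturated I)
    (h : ∀ v ≠ 0, Repels I v) : I = jetsAtZero 3 2 := by
  refine le_antisymm hI.le fun p hp => ?_
  refine hI.mem_of_mul_eq p hp 0 I.zero_mem 0 (fun _ => 0) (fun _ => 0) contDiff_const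
    contDiff_const ?_ ?_ ?_ fun v hv _ => h v hv
  all_goals intros; simp

theorem IsSaturated.exists_not_repels {I : Ideal (JetRing 3 2)} (hI : IsSaturated I)
    (hN : NoLinear I) : ∃ v ≠ 0, ¬ Repels I v := by
  by_contra! h
  have h1 : jt 0 1 0 0 0 0 0 0 0 0 ∈ I := by
    rw [hI.eq_jetsAtZero h, jt_mem_jetsAtZero]
  exact one_ne_zero (hN _ _ _ _ _ _ _ _ _ _ h1).2.1

/-- The ideal is equivalent to one of the model ideals. -/
def IsClassified (I : Ideal (JetRing 3 2)) : Prop := ∃ i : Fin 15, Equivalent I (models i)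

theorem IsClassified.of_map {I : Ideal (JetRing 3 2)} (φ : OriginDiffeo)
    (h : IsClassified (I.map φ.pull)) : IsClassified I := by
  obtain ⟨i, hi⟩ := h
  exact ⟨i, (equivalent_map I φ).trans hi⟩

/-- Reflexivity of equivalence, through the identity matrix. -/
theorem isClassified_of_eq {I : Ideal (JetRing 3 2)} (i : Fin 15) (h : I = models i) :
    IsClassified I := by
  subst h
  refine ⟨i, ?_⟩
  have h1 := equivalent_map (models i) (linearDiffeo 1 0 0 1 (by norm_num))
  have h2 : (models i).map (linearDiffeo 1 0 0 1 (by norm_num)).pull = models i := by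
    ext p
    have h3 : ∀ p, (linearDiffeo 1 0 0 1 (by norm_num)).pull p = p := by
      intro p
      obtain ⟨a, b, c, d, e, f, g, h, k, l, rfl⟩ := exists_jt p
      rw [pull_linearDiffeo]
      apply jt_congr <;> ring
    rw [mem_map_pull]
    simp [h3]
  rwa [h2] at h1

end ClosedJetIdeals

end

/-! ### Ideals with a jet of order one, or with leading form xy. -/

noncomputable section

namespace ClosedJetIdeals

open Filter Topology Asymptotics
open scoped ContDiff

theorem mem_map_of_pull_eq {I : Ideal (JetRing 3 2)} {φ : OriginDiffeo} {p q : JetRing 3 2}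
    (hp : p ∈ I) (h : φ.pull p = q) : q ∈ I.map φ.pull := mem_map_pull.2 ⟨p, hp, h⟩

theorem map_pull_le {I J : Ideal (JetRing 3 2)} {φ : OriginDiffeo}
    (h : ∀ a b c d e f g h k l, jt a b c d e f g h k l ∈ I →
      φ.pull (jt a b c d e f g h k l) ∈ J) : I.map φ.pull ≤ J := by
  intro q hq
  obtain ⟨p, hp, rfl⟩ := mem_map_pull.1 hq
  obtain ⟨a, b, c, d, e, f, g, h', k, l, rfl⟩ := exists_jt p
  exact h _ _ _ _ _ _ _ _ _ _ hp

theorem isClassified_of_map_eq {I : Ideal (JetRing 3 2)} (φ : OriginDiffeo) (i : Fin 15)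
    (h : I.map φ.pull = models i) : IsClassified I := ⟨i, h ▸ equivalent_map I φ⟩

theorem isClassified_of_forall_repels {I : Ideal (JetRing 3 2)} (hI : IsSaturated I)
    (h : ∀ v ≠ 0, Repels I v) : IsClassified I :=
  isClassified_of_eq 13 (hI.eq_jetsAtZero h)

theorem ne_zero_or_ne_zero {v : Plane} (hv : v ≠ 0) : v 0 ≠ 0 ∨ v 1 ≠ 0 := by
  by_contra! h
  exact hv (by ext i; fin_cases i <;> simp [h])

/-- After the shear x lies in the ideal. Either nothing else does modulo x, or a jet in y does, and
then y³ does too. In the latter case x and y³ together repel every direction. -/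
theorem isClassified_of_x_add_mem {I : Ideal (JetRing 3 2)} (hI : IsSaturated I) {α β : ℝ}
    (hp : jt 0 1 0 0 0 α 0 0 0 β ∈ I) : IsClassified I := by
  have hx : jt 0 1 0 0 0 0 0 0 0 0 ∈ I.map (shearFst (-α) (-β)).pull :=
    mem_map_of_pull_eq hp (by rw [pull_shearFst]; apply jt_congr <;> ring)
  by_cases hall : ∀ a b c d e f g h k l,
      jt a b c d e f g h k l ∈ I.map (shearFst (-α) (-β)).pull → c = 0 ∧ f = 0 ∧ l = 0
  · refine isClassified_of_map_eq (shearFst (-α) (-β)) 1 (le_antisymm ?_ ?_)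
    · refine map_pull_le fun a b c d e f g h k l H => ?_
      have ha := jt_mem_jetsAtZero.1 (hI.le H)
      have h1 := (pull_mem_map (shearFst (-α) (-β))).2 H
      rw [pull_shearFst] at h1 ⊢
      obtain ⟨hc, hf, hl⟩ := hall _ _ _ _ _ _ _ _ _ _ h1
      exact jt_mem_models_1.2 ⟨ha, hc, hf, hl⟩
    · rw [models_1_eq_span, Ideal.span_singleton_le_iff_mem]
      exact hx
  · push Not at hall
    obtain ⟨a, b, c, d, e, f, g, h, k, l, H, hcfl⟩ := hall
    have ha : a = 0 := by
      obtain ⟨a', b', c', d', e', f', g', h', k', l', H', heq⟩ := exists_of_jt_mem_map H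
      have := jt_mem_jetsAtZero.1 (hI.le H')
      rw [pull_shearFst, jt_inj] at heq
      rw [← heq.1, this]
    subst ha
    have hy : jt 0 0 0 0 0 0 0 0 0 1 ∈ I.map (shearFst (-α) (-β)).pull := by
      by_cases hc : c = 0
      · by_cases hf : f = 0
        · have hl := hcfl hc hf
          refine mem_of_eq_mul_add_mul H hx (jt (1 / l) 0 0 0 0 0 0 0 0 0)
            (jt (-b / l) (-d / l) (-e / l) (-g / l) (-h / l) (-k / l) 0 0 0 0) ?_
          simp only [jt_mul, jt_add]
          apply jt_congr <;> first | ring1 | grind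
        · refine mem_of_eq_mul_add_mul H hx (jt 0 0 (1 / f) 0 0 0 0 0 0 0)
            (jt 0 0 (-b / f) 0 (-d / f) (-e / f) 0 0 0 0) ?_
          simp only [jt_mul, jt_add]
          apply jt_congr <;> first | ring1 | grind
      · refine mem_of_eq_mul_add_mul H hx (jt 0 0 0 0 0 (1 / c) 0 0 0 0)
          (jt 0 0 0 0 0 (-b / c) 0 0 0 0) ?_
        simp only [jt_mul, jt_add]
        apply jt_congr <;> first | ring1 | grind
    -- The shear fixes y³, so y³ lies in the original ideal, for which saturation is known.
    have hy' : (shearFst (-α) (-β)).pull (jt 0 0 0 0 0 0 0 0 0 1) = jt 0 0 0 0 0 0 0 0 0 1 := by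
      rw [pull_shearFst]
      apply jt_congr <;> ring
    rw [← hy', pull_mem_map] at hy
    refine isClassified_of_forall_repels hI fun v hv => ?_
    by_cases hv0 : v 0 = 0
    · refine repels_of_cubic hy ?_
      have := (ne_zero_or_ne_zero hv).resolve_left (not_not.2 hv0)
      simpa [hv0]
    · exact repels_of_linear hp (by simpa)

theorem isClassified_of_linear_mem {I : Ideal (JetRing 3 2)} (hI : IsSaturated I)
    {b c d e f g h k l : ℝ} (hp : jt 0 b c d e f g h k l ∈ I) (hbc : b ≠ 0 ∨ c ≠ 0) :
    IsClassified I := by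
  have hpos : 0 < b ^ 2 + c ^ 2 := by
    rcases hbc with h | h <;> positivity
  have hdet : b / (b ^ 2 + c ^ 2) * b - (-c) * (c / (b ^ 2 + c ^ 2)) ≠ 0 := by
    rw [div_mul_eq_mul_div, neg_mul, mul_div_assoc', sub_neg_eq_add, ← add_div]
    exact div_ne_zero (by nlinarith) hpos.ne'
  refine IsClassified.of_map (linearDiffeo _ _ _ _ hdet) ?_
  have h1 := (pull_mem_map (linearDiffeo _ _ _ _ hdet)).2 hp
  rw [pull_linearDiffeo] at h1
  have hb : b * (b / (b ^ 2 + c ^ 2)) + c * (c / (b ^ 2 + c ^ 2)) = 1 := by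
    field_simp
  have hc : b * (-c) + c * b = 0 := by ring
  rw [hb, hc] at h1
  generalize d * _ + e * _ * _ + f * _ = d' at h1
  generalize 2 * d * _ * _ + e * _ + 2 * f * _ * _ = e' at h1
  generalize d * _ + e * _ * _ + f * _ = f' at h1
  revert h1
  generalize g * _ + _ + _ + _ = g'
  generalize 3 * g * _ * _ + _ + _ + _ = h'
  generalize 3 * g * _ * _ + _ + _ + _ = k'
  generalize g * _ + _ + _ + _ = l'
  intro h1
  -- The unit is chosen to clear every monomial divisible by x except x itself, leaving x + f'y² +
  -- (l' − e'f')y³.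
  refine isClassified_of_x_add_mem (hI.map hdet) (α := f') (β := l' - e' * f')
    (mem_of_eq_mul h1 (jt 1 (-d') (-e') (d' ^ 2 - g') (2 * d' * e' - h')
      (e' ^ 2 - k' + d' * f') 0 0 0 0) ?_)
  rw [jt_mul]
  apply jt_congr <;> ring

/-- Jets of order two whose quadratic part is the product of two independent linear forms. -/
theorem isClassified_of_xy_add_of_sq {I : Ideal (JetRing 3 2)} (hI : IsSaturated I)
    (hN : NoLinear I) {g h k l : ℝ} (hp : jt 0 0 0 0 1 0 g h k l ∈ I) {d' e' f' g' h' k' l' : ℝ}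
    (hr : jt 0 0 0 d' e' f' g' h' k' l' ∈ I) (hd : d' ≠ 0) : IsClassified I := by
  obtain ⟨v, hv, hvR⟩ := hI.exists_not_repels hN
  have hxxy : jt 0 0 0 0 0 0 0 1 0 0 ∈ I := mem_of_eq_mul hp (jt 0 1 0 0 0 0 0 0 0 0) (by
    rw [jt_mul]; apply jt_congr <;> ring)
  have hxyy : jt 0 0 0 0 0 0 0 0 1 0 ∈ I := mem_of_eq_mul hp (jt 0 0 1 0 0 0 0 0 0 0) (by
    rw [jt_mul]; apply jt_congr <;> ring)
  have hv01 : v 0 * v 1 = 0 := by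
    by_contra h0
    exact hvR (repels_of_quadratic hp (by simpa using h0))
  -- The unrepelled direction is off neither axis by xy, and off the x-axis by the x² term. It is
  -- therefore the y-axis, so y² never occurs in I, nor y³ among its cubic forms.
  have hv0 : v 0 = 0 := by
    by_contra h0
    have h1 : v 1 = 0 := by simpa [h0] using hv01
    exact hvR (repels_of_quadratic hr (by simp [h0, h1, hd]))
  have hv1 := (ne_zero_or_ne_zero hv).resolve_left (not_not.2 hv0)
  have hf : ∀ a b c d e f g h k l, jt a b c d e f g h k l ∈ I → f = 0 := by
    intro a b c d e f g h k l H
    obtain ⟨rfl, rfl, rfl⟩ := hN _ _ _ _ _ _ _ _ _ _ H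
    by_contra h0
    exact hvR (repels_of_quadratic H (by simp [hv0, h0, hv1]))
  have hl : ∀ g h k l, jt 0 0 0 0 0 0 g h k l ∈ I → l = 0 := by
    intro g h k l H
    by_contra h0
    exact hvR (repels_of_cubic H (by simp [hv0, h0, hv1]))
  obtain rfl := hf _ _ _ _ _ _ _ _ _ _ hr
  have hxxx : jt 0 0 0 0 0 0 1 0 0 0 ∈ I :=
    mem_of_eq_mul_add_mul hr hxxy (jt 0 (1 / d') 0 0 0 0 0 0 0 0)
      (jt (-e' / d') 0 0 0 0 0 0 0 0 0) (by
        simp only [jt_mul, jt_add]; apply jt_congr <;> first | ring1 | grind)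
  have hcub : ∀ g h k, jt 0 0 0 0 0 0 g h k 0 ∈ I := by
    intro g h k
    refine mem_of_eq_mul_add_mul (mem_of_eq_mul_add_mul hxxx hxxy (jt g 0 0 0 0 0 0 0 0 0)
      (jt h 0 0 0 0 0 0 0 0 0) rfl) hxyy 1 (jt k 0 0 0 0 0 0 0 0 0) ?_
    rw [one_mul]
    simp only [jt_mul, jt_add]
    apply jt_congr <;> ring
  have hp' : jt 0 0 0 0 1 0 0 0 0 l ∈ I :=
    mem_of_eq_mul_add_mul hp (hcub (-g) (-h) (-k)) 1 1 (by
      rw [one_mul, one_mul, jt_add]; apply jt_congr <;> ring)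
  have hr' : jt 0 0 0 1 0 0 0 0 0 ((l' - e' * l) / d') ∈ I := by
    refine mem_of_eq_mul_add_mul (mem_of_eq_mul_add_mul hr hp' (jt (1 / d') 0 0 0 0 0 0 0 0 0)
      (jt (-e' / d') 0 0 0 0 0 0 0 0 0) rfl) (hcub (-g' / d') (-h' / d') (-k' / d')) 1 1 ?_
    rw [one_mul, one_mul]
    simp only [jt_mul, jt_add]
    apply jt_congr <;> first | ring1 | grind
  -- Otherwise `repels_of_cusp` would repel the one remaining direction.
  have hz : (l' - e' * l) / d' = 0 := by
    by_contra h0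
    exact hvR (repels_of_cusp h0 hr' hp' hv1)
  rw [hz] at hr'
  refine isClassified_of_map_eq (shearFst (-l) 0) 8 (le_antisymm ?_ ?_)
  · refine map_pull_le fun a b c d e f g h k l₁ H => ?_
    obtain ⟨rfl, rfl, rfl⟩ := hN _ _ _ _ _ _ _ _ _ _ H
    obtain rfl := hf _ _ _ _ _ _ _ _ _ _ H
    have h1 : jt 0 0 0 0 0 0 g h k (l₁ - e * l) ∈ I := by
      refine mem_of_eq_mul_add_mul (mem_of_eq_mul_add_mul hr' hp' (jt (-d) 0 0 0 0 0 0 0 0 0)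
        (jt (-e) 0 0 0 0 0 0 0 0 0) rfl) H 1 1 ?_
      rw [one_mul, one_mul]
      simp only [jt_mul, jt_add]
      apply jt_congr <;> ring
    have h2 := hl _ _ _ _ h1
    rw [pull_shearFst]
    refine jt_mem_models_8.2 ⟨rfl, rfl, rfl, ?_, ?_⟩
    · ring
    · linarith
  · rw [models_8_eq_span, Ideal.span_le, Set.insert_subset_iff, Set.singleton_subset_iff]
    constructor
    · refine mem_map_of_pull_eq (I.add_mem hr' (hcub 0 0 (2 * l))) ?_
      rw [jt_add, pull_shearFst]
      apply jt_congr <;> ring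
    · refine mem_map_of_pull_eq hp' ?_
      rw [pull_shearFst]
      apply jt_congr <;> ring

/-- If no x² or y² occurs, the jets of I are, modulo multiples of xy + gx³ + ly³, combinations of x³
and y³. Either none of these remain and two shears give ⟨xy⟩, or one remains and division produces a
forbidden x² or y². -/
theorem isClassified_of_xy_add_mem {I : Ideal (JetRing 3 2)} (hI : IsSaturated I)
    (hN : NoLinear I) {g h k l : ℝ} (hp : jt 0 0 0 0 1 0 g h k l ∈ I) : IsClassified I := by
  by_cases hd : ∀ a b c d e f g h k l, jt a b c d e f g h k l ∈ I → d = 0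
  swap
  · push Not at hd
    obtain ⟨a, b, c, d, e, f, g', h', k', l', H, hd⟩ := hd
    obtain ⟨rfl, rfl, rfl⟩ := hN _ _ _ _ _ _ _ _ _ _ H
    exact isClassified_of_xy_add_of_sq hI hN hp H hd
  by_cases hf : ∀ a b c d e f g h k l, jt a b c d e f g h k l ∈ I → f = 0
  swap
  · push Not at hf
    obtain ⟨a, b, c, d, e, f, g', h', k', l', H, hf⟩ := hf
    obtain ⟨rfl, rfl, rfl⟩ := hN _ _ _ _ _ _ _ _ _ _ H
    have hdet : (0 : ℝ) * 0 - 1 * 1 ≠ 0 := by norm_num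
    refine IsClassified.of_map (linearDiffeo 0 1 1 0 hdet) ?_
    have hp1 : jt 0 0 0 0 1 0 l k h g ∈ I.map (linearDiffeo 0 1 1 0 hdet).pull :=
      mem_map_of_pull_eq hp (by rw [pull_linearDiffeo]; apply jt_congr <;> ring)
    have H1 : jt 0 0 0 f e d l' k' h' g' ∈ I.map (linearDiffeo 0 1 1 0 hdet).pull :=
      mem_map_of_pull_eq H (by rw [pull_linearDiffeo]; apply jt_congr <;> ring)
    exact isClassified_of_xy_add_of_sq (hI.map hdet) (hN.map hdet) hp1 H1 hf
  obtain ⟨v, hv, hvR⟩ := hI.exists_not_repels hN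
  have hxxy : jt 0 0 0 0 0 0 0 1 0 0 ∈ I := mem_of_eq_mul hp (jt 0 1 0 0 0 0 0 0 0 0) (by
    rw [jt_mul]; apply jt_congr <;> ring)
  have hxyy : jt 0 0 0 0 0 0 0 0 1 0 ∈ I := mem_of_eq_mul hp (jt 0 0 1 0 0 0 0 0 0 0) (by
    rw [jt_mul]; apply jt_congr <;> ring)
  have hp' : jt 0 0 0 0 1 0 g 0 0 l ∈ I := by
    refine mem_of_eq_mul_add_mul (mem_of_eq_mul_add_mul hxxy hxyy (jt (-h) 0 0 0 0 0 0 0 0 0)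
      (jt (-k) 0 0 0 0 0 0 0 0 0) rfl) hp 1 1 ?_
    rw [one_mul, one_mul]
    simp only [jt_mul, jt_add]
    apply jt_congr <;> ring
  have hcub : ∀ a b c d e f g' h k l', jt a b c d e f g' h k l' ∈ I →
      jt 0 0 0 0 0 0 (g' - e * g) 0 0 (l' - e * l) ∈ I := by
    intro a b c d e f g' h k l' H
    obtain ⟨rfl, rfl, rfl⟩ := hN _ _ _ _ _ _ _ _ _ _ H
    obtain rfl := hd _ _ _ _ _ _ _ _ _ _ H
    obtain rfl := hf _ _ _ _ _ _ _ _ _ _ H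
    refine mem_of_eq_mul_add_mul (mem_of_eq_mul_add_mul hxxy hxyy (jt (-h) 0 0 0 0 0 0 0 0 0)
      (jt (-k) 0 0 0 0 0 0 0 0 0) rfl) (mem_of_eq_mul_add_mul H hp' 1
      (jt (-e) 0 0 0 0 0 0 0 0 0) rfl) 1 1 ?_
    rw [one_mul, one_mul, one_mul]
    simp only [jt_mul, jt_add]
    apply jt_congr <;> ring
  have hquad : ∀ v : Plane, v 0 ≠ 0 → v 1 ≠ 0 → Repels I v := fun v h0 h1 =>
    repels_of_quadratic hp (by simp [h0, h1])
  by_cases hg : ∀ a b c d e f g' h k l', jt a b c d e f g' h k l' ∈ I → g' - e * g = 0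
  · by_cases hl : ∀ a b c d e f g' h k l', jt a b c d e f g' h k l' ∈ I → l' - e * l = 0
    · refine IsClassified.of_map (shearFst (-l) 0) (isClassified_of_map_eq (shearSnd (-g)) 4
        (le_antisymm ?_ ?_))
      · refine map_pull_le fun a b c d e f g' h k l' H => ?_
        obtain ⟨a, b, c, d, e, f, g', h, k, l', H', heq⟩ := exists_of_jt_mem_map H
        obtain ⟨rfl, rfl, rfl⟩ := hN _ _ _ _ _ _ _ _ _ _ H'
        obtain rfl := hd _ _ _ _ _ _ _ _ _ _ H'
        obtain rfl := hf _ _ _ _ _ _ _ _ _ _ H'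
        have h1 := hg _ _ _ _ _ _ _ _ _ _ H'
        have h2 := hl _ _ _ _ _ _ _ _ _ _ H'
        rw [← heq, pull_shearFst, pull_shearSnd]
        refine jt_mem_models_4.2 ⟨?_, ?_, ?_, ?_, ?_, ?_, ?_⟩ <;> linarith
      · rw [models_4_eq_span, Ideal.span_singleton_le_iff_mem]
        refine mem_map_of_pull_eq (mem_map_of_pull_eq hp' rfl) ?_
        rw [pull_shearFst, pull_shearSnd]
        apply jt_congr <;> ring
    · push Not at hl
      obtain ⟨a, b, c, d, e, f, g', h', k', l', H, hl⟩ := hl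
      have H1 := hcub _ _ _ _ _ _ _ _ _ _ H
      rw [hg _ _ _ _ _ _ _ _ _ _ H] at H1
      have hq : jt 0 0 0 0 1 0 g 0 0 0 ∈ I :=
        mem_of_eq_mul_add_mul hp' H1 1 (jt (-l / (l' - e * l)) 0 0 0 0 0 0 0 0 0) (by
          rw [one_mul]; simp only [jt_mul, jt_add]; apply jt_congr <;> first | ring1 | grind)
      -- The division x·(y² + gx²y) = y·(xy + gx³), allowed because y³ repels the line x = 0.
      have hmem : jt 0 0 0 0 0 1 0 g 0 0 ∈ I := by
        refine hI.mem_of_mul_eq _ (jt_mem_jetsAtZero.2 rfl) _ hq 1 (fun v => v 1) (fun v => v 0)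
          (by fun_prop) (by fun_prop) (by intros; simp) (by intros; simp) ?_ ?_
        · intro v
          simp only [jetEval_jt, cubicFun]
          ring
        · intro v hv hv0
          refine repels_of_cubic H1 ?_
          have hv1 := (ne_zero_or_ne_zero hv).resolve_left (not_not.2 hv0)
          rw [hv0]
          simpa using ⟨hl, hv1⟩
      exact absurd (hf _ _ _ _ _ _ _ _ _ _ hmem) one_ne_zero
  · push Not at hg
    obtain ⟨a, b, c, d, e, f, g', h', k', l', H, hg⟩ := hg
    have H1 := hcub _ _ _ _ _ _ _ _ _ _ H
    have hl : ∀ a b c d e f g' h k l', jt a b c d e f g' h k l' ∈ I → l' - e * l = 0 := by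
      intro a b c d e f g₁ h k l₁ H₁
      by_contra hne
      have H2 := hcub _ _ _ _ _ _ _ _ _ _ H₁
      refine hvR ?_
      by_cases hv0 : v 0 = 0
      · have hv1 := (ne_zero_or_ne_zero hv).resolve_left (not_not.2 hv0)
        refine repels_of_cubic H2 ?_
        rw [hv0]
        simpa using ⟨hne, hv1⟩
      · by_cases hv1 : v 1 = 0
        · refine repels_of_cubic H1 ?_
          rw [hv1]
          simpa using ⟨hg, hv0⟩
        · exact hquad v hv0 hv1
    rw [hl _ _ _ _ _ _ _ _ _ _ H] at H1
    have hq : jt 0 0 0 0 1 0 0 0 0 l ∈ I :=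
      mem_of_eq_mul_add_mul hp' H1 1 (jt (-g / (g' - e * g)) 0 0 0 0 0 0 0 0 0) (by
        rw [one_mul]; simp only [jt_mul, jt_add]; apply jt_congr <;> first | ring1 | grind)
    -- The symmetric division y·(x² + lxy²) = x·(xy + ly³), allowed because x³ repels the line y =
    -- 0.
    have hmem : jt 0 0 0 1 0 0 0 0 l 0 ∈ I := by
      refine hI.mem_of_mul_eq _ (jt_mem_jetsAtZero.2 rfl) _ hq 1 (fun v => v 0) (fun v => v 1)
        (by fun_prop) (by fun_prop) (by intros; simp) (by intros; simp) ?_ ?_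
      · intro v
        simp only [jetEval_jt, cubicFun]
        ring
      · intro v hv hv1
        refine repels_of_cubic H1 ?_
        have hv0 := (ne_zero_or_ne_zero hv).resolve_right (not_not.2 hv1)
        rw [hv1]
        simpa using ⟨hg, hv0⟩
    exact absurd (hd _ _ _ _ _ _ _ _ _ _ hmem) one_ne_zero

end ClosedJetIdeals

end

/-! ### Ideals with other leading forms of degree two. -/

noncomputable section

namespace ClosedJetIdeals

open Filter Topology Asymptotics
open scoped ContDiff

/-- Two isotropic vectors of the quadratic part as columns turn it into a multiple of xy. -/
theorem isClassified_of_isotropic {I : Ideal (JetRing 3 2)} (hI : IsSaturated I)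
    (hN : NoLinear I) {d e f g h k l : ℝ} (hp : jt 0 0 0 d e f g h k l ∈ I) {α β γ δ : ℝ}
    (hdet : α * δ - β * γ ≠ 0) (h1 : d * α ^ 2 + e * α * γ + f * γ ^ 2 = 0)
    (h2 : d * β ^ 2 + e * β * δ + f * δ ^ 2 = 0)
    (h3 : 2 * d * α * β + e * (α * δ + β * γ) + 2 * f * γ * δ ≠ 0) : IsClassified I := by
  refine IsClassified.of_map (linearDiffeo _ _ _ _ hdet) ?_
  have hp' := (pull_mem_map (linearDiffeo _ _ _ _ hdet)).2 hp
  rw [pull_linearDiffeo, h1, h2] at hp'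
  generalize 2 * d * α * β + e * (α * δ + β * γ) + 2 * f * γ * δ = e' at hp' h3
  revert hp'
  generalize g * _ + _ + _ + _ = g'
  generalize 3 * g * _ * _ + _ + _ + _ = h'
  generalize 3 * g * _ * _ + _ + _ + _ = k'
  generalize g * _ + _ + _ + _ = l'
  intro hp'
  refine isClassified_of_xy_add_mem (hI.map hdet) (hN.map hdet) (g := g' / e') (h := h' / e')
    (k := k' / e') (l := l' / e') (mem_of_eq_mul hp' (jt (1 / e') 0 0 0 0 0 0 0 0 0) ?_)
  rw [jt_mul]
  apply jt_congr <;> first | ring1 | grind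

theorem isClassified_of_discrim_pos {I : Ideal (JetRing 3 2)} (hI : IsSaturated I)
    (hN : NoLinear I) {d e f g h k l : ℝ} (hp : jt 0 0 0 d e f g h k l ∈ I)
    (hdisc : 0 < e ^ 2 - 4 * d * f) : IsClassified I := by
  by_cases hd : d = 0
  · subst hd
    have he : e ≠ 0 := by
      rintro rfl
      simp at hdisc
    -- For y(ex + fy) the isotropic vectors are (1, 0) and (f, −e).
    refine isClassified_of_isotropic hI hN hp (α := 1) (β := f) (γ := 0) (δ := -e) (by simpa)
      (by ring) (by ring) ?_
    have : 2 * 0 * 1 * f + e * (1 * -e + f * 0) + 2 * f * 0 * -e = -e ^ 2 := by ring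
    rw [this]
    simpa
  · have hs : √(e ^ 2 - 4 * d * f) ^ 2 = e ^ 2 - 4 * d * f := Real.sq_sqrt hdisc.le
    have hs0 : √(e ^ 2 - 4 * d * f) ≠ 0 := (Real.sqrt_pos.2 hdisc).ne'
    generalize √(e ^ 2 - 4 * d * f) = s at hs hs0
    refine isClassified_of_isotropic hI hN hp (α := -e + s) (β := -e - s) (γ := 2 * d)
      (δ := 2 * d) ?_ ?_ ?_ ?_
    · have : (-e + s) * (2 * d) - (-e - s) * (2 * d) = 4 * d * s := by ring
      rw [this]
      positivity
    · linear_combination d * hs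
    · linear_combination d * hs
    · have : 2 * d * (-e + s) * (-e - s) + e * ((-e + s) * (2 * d) + (-e - s) * (2 * d)) +
          2 * f * (2 * d) * (2 * d) = -4 * d * s ^ 2 := by linear_combination 2 * d * hs
      rw [this]
      exact mul_ne_zero (mul_ne_zero (by norm_num) hd) (pow_ne_zero 2 hs0)

/-- The quadratic parts of the jets in `I` are semidefinite. -/
def NoHyperbolic (I : Ideal (JetRing 3 2)) : Prop :=
  ∀ a b c d e f g h k l, jt a b c d e f g h k l ∈ I → e ^ 2 - 4 * d * f ≤ 0

theorem NoHyperbolic.map {I : Ideal (JetRing 3 2)} (hI : NoHyperbolic I)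
    {α β γ δ : ℝ} (hdet : α * δ - β * γ ≠ 0) :
    NoHyperbolic (I.map (linearDiffeo α β γ δ hdet).pull) := by
  intro a b c d e f g h k l H
  obtain ⟨a', b', c', d', e', f', g', h', k', l', H', heq⟩ := exists_of_jt_mem_map H
  have h1 := hI _ _ _ _ _ _ _ _ _ _ H'
  rw [pull_linearDiffeo, jt_inj] at heq
  obtain ⟨-, -, -, rfl, rfl, rfl, -⟩ := heq
  have h2 := mul_nonneg (sq_nonneg (α * δ - β * γ)) (neg_nonneg.2 h1)
  linarith

/-- All quadratic parts are multiples of x², and the unrepelled direction is the y-axis. Hence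
modulo x³ and x²y only x² + kxy² + ly³, and perhaps xy², remain. -/
theorem isClassified_of_sq_add_mem {I : Ideal (JetRing 3 2)} (hI : IsSaturated I)
    (hN : NoLinear I) (hD : NoHyperbolic I) {g h k l : ℝ}
    (hp : jt 0 0 0 1 0 0 g h k l ∈ I) : IsClassified I := by
  have hef : ∀ a b c d e f g h k l, jt a b c d e f g h k l ∈ I → e = 0 ∧ f = 0 := by
    intro a b c d e f g' h' k' l' H
    have hf : f = 0 := by
      by_contra hf
      -- This multiple of x² makes the discriminant of the sum equal to 1, against `NoHyperbolic`.
      have h1 := mem_of_eq_mul_add_mul H hp 1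
        (jt ((e ^ 2 - 1) / (4 * f) - d) 0 0 0 0 0 0 0 0 0) rfl
      rw [one_mul, jt_mul, jt_add] at h1
      have h2 := hD _ _ _ _ _ _ _ _ _ _ h1
      field_simp at h2
      grind
    subst hf
    have h3 := hD _ _ _ _ _ _ _ _ _ _ H
    refine ⟨?_, rfl⟩
    nlinarith
  obtain ⟨v, hv, hvR⟩ := hI.exists_not_repels hN
  have hxxx : jt 0 0 0 0 0 0 1 0 0 0 ∈ I := mem_of_eq_mul hp (jt 0 1 0 0 0 0 0 0 0 0) (by
    rw [jt_mul]; apply jt_congr <;> ring)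
  have hxxy : jt 0 0 0 0 0 0 0 1 0 0 ∈ I := mem_of_eq_mul hp (jt 0 0 1 0 0 0 0 0 0 0) (by
    rw [jt_mul]; apply jt_congr <;> ring)
  have hp' : jt 0 0 0 1 0 0 0 0 k l ∈ I := by
    refine mem_of_eq_mul_add_mul (mem_of_eq_mul_add_mul hxxx hxxy (jt (-g) 0 0 0 0 0 0 0 0 0)
      (jt (-h) 0 0 0 0 0 0 0 0 0) rfl) hp 1 1 ?_
    rw [one_mul, one_mul]
    simp only [jt_mul, jt_add]
    apply jt_congr <;> ring
  have hv0 : v 0 = 0 := by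
    by_contra h0
    exact hvR (repels_of_quadratic hp (by simpa using h0))
  have hv1 := (ne_zero_or_ne_zero hv).resolve_left (not_not.2 hv0)
  have hl : ∀ a b c d e f g' h' k' l', jt a b c d e f g' h' k' l' ∈ I →
      l' = d * l ∧ jt 0 0 0 0 0 0 0 0 (k' - d * k) 0 ∈ I := by
    intro a b c d e f g' h' k' l' H
    obtain ⟨rfl, rfl, rfl⟩ := hN _ _ _ _ _ _ _ _ _ _ H
    obtain ⟨rfl, rfl⟩ := hef _ _ _ _ _ _ _ _ _ _ H
    have h1 : jt 0 0 0 0 0 0 0 0 (k' - d * k) (l' - d * l) ∈ I := by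
      refine mem_of_eq_mul_add_mul (mem_of_eq_mul_add_mul hxxx hxxy
        (jt (-g') 0 0 0 0 0 0 0 0 0) (jt (-h') 0 0 0 0 0 0 0 0 0) rfl)
        (mem_of_eq_mul_add_mul H hp' 1 (jt (-d) 0 0 0 0 0 0 0 0 0) rfl) 1 1 ?_
      rw [one_mul, one_mul, one_mul]
      simp only [jt_mul, jt_add]
      apply jt_congr <;> ring
    have h2 : l' - d * l = 0 := by
      by_contra hne
      refine hvR (repels_of_cubic h1 ?_)
      rw [hv0]
      simpa using ⟨hne, hv1⟩
    rw [h2] at h1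
    exact ⟨by linarith, h1⟩
  -- The scaling x ↦ l²x, y ↦ −ly turns x² + ly³ into l⁴(x² − y³).
  have hdiag : l ≠ 0 → (l ^ 2) * (-l) - 0 * 0 ≠ 0 := fun h0 => by
    rw [mul_zero, sub_zero, mul_neg, neg_ne_zero]
    positivity
  by_cases hk : ∀ a b c d e f g' h' k' l', jt a b c d e f g' h' k' l' ∈ I → k' = d * k
  -- Completing the square removes the term k·xy².
  · have hshear : jt 0 0 0 1 0 0 0 0 0 l ∈ I.map (shearFst (-k / 2) 0).pull :=
      mem_map_of_pull_eq hp' (by rw [pull_shearFst]; apply jt_congr <;> ring)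
    have hform : ∀ a b c d e f g' h' k' l',
        jt a b c d e f g' h' k' l' ∈ I.map (shearFst (-k / 2) 0).pull →
        a = 0 ∧ b = 0 ∧ c = 0 ∧ e = 0 ∧ f = 0 ∧ k' = 0 ∧ l' = d * l := by
      intro a b c d e f g' h' k' l' H
      obtain ⟨a, b, c, d₁, e, f, g', h', k₁, l₁, H', heq⟩ := exists_of_jt_mem_map H
      obtain ⟨rfl, rfl, rfl⟩ := hN _ _ _ _ _ _ _ _ _ _ H'
      obtain ⟨rfl, rfl⟩ := hef _ _ _ _ _ _ _ _ _ _ H'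
      have h1 := hk _ _ _ _ _ _ _ _ _ _ H'
      have h2 := (hl _ _ _ _ _ _ _ _ _ _ H').1
      rw [pull_shearFst, jt_inj] at heq
      obtain ⟨rfl, rfl, rfl, rfl, rfl, rfl, rfl, rfl, rfl, rfl⟩ := heq
      refine ⟨?_, ?_, ?_, ?_, ?_, ?_, ?_⟩ <;> linarith
    refine IsClassified.of_map (shearFst (-k / 2) 0) ?_
    by_cases hl0 : l = 0
    · subst hl0
      refine isClassified_of_eq 2 (le_antisymm ?_ ?_)
      · intro p hp
        obtain ⟨a, b, c, d, e, f, g', h', k', l', rfl⟩ := exists_jt p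
        obtain ⟨ha, hb, hc, he, hf, hk', hl'⟩ := hform _ _ _ _ _ _ _ _ _ _ hp
        exact jt_mem_models_2.2 ⟨ha, hb, hc, he, hf, hk', by linarith⟩
      · rw [models_2_eq_span, Ideal.span_singleton_le_iff_mem]
        exact hshear
    · refine isClassified_of_map_eq (linearDiffeo _ _ _ _ (hdiag hl0)) 7 (le_antisymm ?_ ?_)
      · refine map_pull_le fun a b c d e f g' h' k' l' H => ?_
        obtain ⟨rfl, rfl, rfl, rfl, rfl, rfl, rfl⟩ := hform _ _ _ _ _ _ _ _ _ _ H
        rw [pull_linearDiffeo]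
        refine jt_mem_models_7.2 ⟨?_, ?_, ?_, ?_, ?_, ?_, ?_⟩ <;> ring
      · rw [models_7_eq_span, Ideal.span_singleton_le_iff_mem]
        refine mem_map_of_pull_eq (Ideal.mul_mem_left _
          (jt (1 / l ^ 4) 0 0 0 0 0 0 0 0 0) hshear) ?_
        rw [jt_mul, pull_linearDiffeo]
        apply jt_congr <;> first | ring1 | grind
  · push Not at hk
    obtain ⟨a, b, c, d, e, f, g', h', k', l', H, hk⟩ := hk
    have hk0 : k' - d * k ≠ 0 := sub_ne_zero.2 hk
    have hxyy : jt 0 0 0 0 0 0 0 0 1 0 ∈ I := by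
      refine mem_of_eq_mul (hl _ _ _ _ _ _ _ _ _ _ H).2
        (jt (1 / (k' - d * k)) 0 0 0 0 0 0 0 0 0) ?_
      rw [jt_mul]
      apply jt_congr <;> first | ring1 | grind
    have hp1 : jt 0 0 0 1 0 0 0 0 0 l ∈ I := by
      refine mem_of_eq_mul_add_mul hp' hxyy 1 (jt (-k) 0 0 0 0 0 0 0 0 0) ?_
      rw [one_mul, jt_mul, jt_add]
      apply jt_congr <;> ring
    by_cases hl0 : l = 0
    · subst hl0
      refine isClassified_of_eq 9 (le_antisymm ?_ ?_)
      · intro p hp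
        obtain ⟨a, b, c, d, e, f, g', h', k', l', rfl⟩ := exists_jt p
        obtain ⟨ha, hb, hc⟩ := hN _ _ _ _ _ _ _ _ _ _ hp
        obtain ⟨he, hf⟩ := hef _ _ _ _ _ _ _ _ _ _ hp
        have hl' := (hl _ _ _ _ _ _ _ _ _ _ hp).1
        exact jt_mem_models_9.2 ⟨ha, hb, hc, he, hf, by linarith⟩
      · rw [models_9_eq_span, Ideal.span_le, Set.insert_subset_iff, Set.singleton_subset_iff]
        exact ⟨hp1, hxyy⟩
    · refine isClassified_of_map_eq (linearDiffeo _ _ _ _ (hdiag hl0)) 12 (le_antisymm ?_ ?_)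
      · refine map_pull_le fun a b c d e f g' h' k' l' H => ?_
        obtain ⟨rfl, rfl, rfl⟩ := hN _ _ _ _ _ _ _ _ _ _ H
        obtain ⟨rfl, rfl⟩ := hef _ _ _ _ _ _ _ _ _ _ H
        obtain ⟨rfl, -⟩ := hl _ _ _ _ _ _ _ _ _ _ H
        rw [pull_linearDiffeo]
        refine jt_mem_models_12.2 ⟨?_, ?_, ?_, ?_, ?_, ?_⟩ <;> ring
      · rw [models_12_eq_span, Ideal.span_le, Set.insert_subset_iff, Set.singleton_subset_iff]
        constructor
        · refine mem_map_of_pull_eq (I.mul_mem_left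
            (jt (1 / l ^ 4) 0 0 0 0 0 0 0 0 0) hp1) ?_
          rw [jt_mul, pull_linearDiffeo]
          apply jt_congr <;> first | ring1 | grind
        · have hmem : jt 0 0 0 0 0 0 0 0 (1 / l ^ 4) 0 ∈ I :=
            mem_of_eq_mul hxyy (jt (1 / l ^ 4) 0 0 0 0 0 0 0 0 0) (by
              rw [jt_mul]; apply jt_congr <;> ring)
          have hcoef : 1 / l ^ 4 * (l ^ 2 * (-l) ^ 2) = 1 := by field_simp
          refine mem_map_of_pull_eq hmem ?_
          rw [pull_linearDiffeo]
          apply jt_congr <;> first | ring1 | linear_combination hcoef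

/-- A definite quadratic part would repel every direction, so the discriminant is zero and
completing the square leaves a multiple of x². -/
theorem isClassified_of_quadratic_fst {I : Ideal (JetRing 3 2)} (hI : IsSaturated I)
    (hN : NoLinear I) (hD : NoHyperbolic I) {d e f g h k l : ℝ}
    (hp : jt 0 0 0 d e f g h k l ∈ I) (hd : d ≠ 0) : IsClassified I := by
  have hdisc := hD _ _ _ _ _ _ _ _ _ _ hp
  rcases hdisc.lt_or_eq with hdisc | hdisc
  · obtain ⟨v, hv, hvR⟩ := hI.exists_not_repels hN
    refine absurd (repels_of_quadratic hp fun h0 => ?_) hvR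
    have h1 : (2 * d * v 0 + e * v 1) ^ 2 + (4 * d * f - e ^ 2) * v 1 ^ 2 = 0 := by
      linear_combination 4 * d * h0
    have h2 : 0 < 4 * d * f - e ^ 2 := by linarith
    have h3 : v 1 = 0 := by
      by_contra hne
      have : 0 < (4 * d * f - e ^ 2) * v 1 ^ 2 := by positivity
      nlinarith [sq_nonneg (2 * d * v 0 + e * v 1)]
    rw [h3] at h1
    rcases ne_zero_or_ne_zero hv with h4 | h4
    · simp [hd, h4] at h1
    · exact h4 h3
  · have hdet : (1 : ℝ) * 1 - (-e / (2 * d)) * 0 ≠ 0 := by norm_num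
    refine IsClassified.of_map (linearDiffeo _ _ _ _ hdet) ?_
    have hp' := (pull_mem_map (linearDiffeo _ _ _ _ hdet)).2 hp
    have h1 : 2 * d * 1 * (-e / (2 * d)) + e * (1 * 1 + -e / (2 * d) * 0) + 2 * f * 0 * 1 = 0 := by
      field_simp
      ring
    have h2 : d * (-e / (2 * d)) ^ 2 + e * (-e / (2 * d)) * 1 + f * 1 ^ 2 = 0 := by
      field_simp
      linear_combination -hdisc
    rw [pull_linearDiffeo, h1, h2] at hp'
    revert hp'
    generalize g * _ + _ + _ + _ = g'
    generalize 3 * g * _ * _ + _ + _ + _ = h'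
    generalize 3 * g * _ * _ + _ + _ + _ = k'
    generalize g * _ + _ + _ + _ = l'
    intro hp'
    refine isClassified_of_sq_add_mem (hI.map hdet) (hN.map hdet) (hD.map hdet) (g := g' / d)
      (h := h' / d) (k := k' / d) (l := l' / d)
      (mem_of_eq_mul hp' (jt (1 / d) 0 0 0 0 0 0 0 0 0) ?_)
    rw [jt_mul]
    apply jt_congr <;> first | ring1 | grind

theorem isClassified_of_quadratic {I : Ideal (JetRing 3 2)} (hI : IsSaturated I)
    (hN : NoLinear I) (hQ : ¬ NoQuadratic I) : IsClassified I := by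
  by_cases hD : NoHyperbolic I
  · unfold NoQuadratic at hQ
    push Not at hQ
    obtain ⟨a, b, c, d, e, f, g, h, k, l, H, hQ⟩ := hQ
    obtain ⟨rfl, rfl, rfl⟩ := hN _ _ _ _ _ _ _ _ _ _ H
    by_cases hd : d = 0
    · subst hd
      have h1 := hD _ _ _ _ _ _ _ _ _ _ H
      have he : e = 0 := by nlinarith
      have hf := hQ rfl rfl rfl rfl he
      have hdet : (0 : ℝ) * 0 - 1 * 1 ≠ 0 := by norm_num
      refine IsClassified.of_map (linearDiffeo _ _ _ _ hdet) ?_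
      have H1 : jt 0 0 0 f e 0 l k h g ∈ I.map (linearDiffeo 0 1 1 0 hdet).pull :=
        mem_map_of_pull_eq H (by rw [pull_linearDiffeo]; apply jt_congr <;> ring)
      exact isClassified_of_quadratic_fst (hI.map hdet) (hN.map hdet) (hD.map hdet) H1 hf
    · exact isClassified_of_quadratic_fst hI hN hD H hd
  · unfold NoHyperbolic at hD
    push Not at hD
    obtain ⟨a, b, c, d, e, f, g, h, k, l, H, hD⟩ := hD
    obtain ⟨rfl, rfl, rfl⟩ := hN _ _ _ _ _ _ _ _ _ _ H
    exact isClassified_of_discrim_pos hI hN H hD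

end ClosedJetIdeals

end

/-! ### Ideals consisting of cubic forms. -/

noncomputable section

namespace ClosedJetIdeals

open Filter Topology Asymptotics
open scoped ContDiff

/-- The cubic form given by its coefficients. -/
def cubicForm (g h k l : ℝ) (v : Plane) : ℝ :=
  g * v 0 ^ 3 + h * v 0 ^ 2 * v 1 + k * v 0 * v 1 ^ 2 + l * v 1 ^ 3

theorem isClassified_of_binomial_multiples {I : Ideal (JetRing 3 2)}
    (hform : ∀ a b c d e f g h k l, jt a b c d e f g h k l ∈ I →
      a = 0 ∧ b = 0 ∧ c = 0 ∧ d = 0 ∧ e = 0 ∧ f = 0 ∧ g = 0 ∧ l = 0) {h₀ k₀ : ℝ}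
    (H₀ : jt 0 0 0 0 0 0 0 h₀ k₀ 0 ∈ I) (hne : h₀ = 0 → k₀ ≠ 0)
    (hdep : ∀ h k, jt 0 0 0 0 0 0 0 h k 0 ∈ I → h * k₀ = k * h₀) : IsClassified I := by
  by_cases hh : h₀ = 0
  · subst hh
    have hk : k₀ ≠ 0 := hne rfl
    have hdet : (0 : ℝ) * 0 - 1 * 1 ≠ 0 := by norm_num
    refine isClassified_of_map_eq (linearDiffeo _ _ _ _ hdet) 5 (le_antisymm ?_ ?_)
    · refine map_pull_le fun a b c d e f g h k l H => ?_
      obtain ⟨rfl, rfl, rfl, rfl, rfl, rfl, rfl, rfl⟩ := hform _ _ _ _ _ _ _ _ _ _ H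
      have h1 : h = 0 := by simpa [hk] using hdep _ _ H
      subst h1
      rw [pull_linearDiffeo]
      refine jt_mem_models_5.2 ⟨?_, ?_, ?_, ?_, ?_, ?_, ?_, ?_, ?_⟩ <;> ring
    · rw [models_5_eq_span, Ideal.span_singleton_le_iff_mem]
      have hmem : jt 0 0 0 0 0 0 0 0 1 0 ∈ I :=
        mem_of_eq_mul H₀ (jt (1 / k₀) 0 0 0 0 0 0 0 0 0) (by
          rw [jt_mul]; apply jt_congr <;> first | ring1 | grind)
      refine mem_map_of_pull_eq hmem ?_
      rw [pull_linearDiffeo]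
      apply jt_congr <;> ring
  · by_cases hk : k₀ = 0
    · subst hk
      refine isClassified_of_eq 5 (le_antisymm ?_ ?_)
      · intro p hp
        obtain ⟨a, b, c, d, e, f, g, h, k, l, rfl⟩ := exists_jt p
        obtain ⟨rfl, rfl, rfl, rfl, rfl, rfl, rfl, rfl⟩ := hform _ _ _ _ _ _ _ _ _ _ hp
        have h1 : k = 0 := by simpa [hh] using (hdep _ _ hp).symm
        subst h1
        exact jt_mem_models_5.2 ⟨rfl, rfl, rfl, rfl, rfl, rfl, rfl, rfl, rfl⟩
      · rw [models_5_eq_span, Ideal.span_singleton_le_iff_mem]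
        refine mem_of_eq_mul H₀ (jt (1 / h₀) 0 0 0 0 0 0 0 0 0) ?_
        rw [jt_mul]
        apply jt_congr <;> first | ring1 | grind
    -- Scaling x by k₀ and y by h₀ makes the coefficients of x²y and xy² equal.
    · have hdet : k₀ * h₀ - 0 * 0 ≠ 0 := by simp [hh, hk]
      refine isClassified_of_map_eq (linearDiffeo _ _ _ _ hdet) 6 (le_antisymm ?_ ?_)
      · refine map_pull_le fun a b c d e f g h k l H => ?_
        obtain ⟨rfl, rfl, rfl, rfl, rfl, rfl, rfl, rfl⟩ := hform _ _ _ _ _ _ _ _ _ _ H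
        have h1 := hdep _ _ H
        rw [pull_linearDiffeo]
        refine jt_mem_models_6.2 ⟨?_, ?_, ?_, ?_, ?_, ?_, ?_, ?_, ?_⟩ <;>
          first | ring1 | linear_combination -(k₀ * h₀) * h1
      · rw [models_6_eq_span, Ideal.span_singleton_le_iff_mem]
        have hmem : jt 0 0 0 0 0 0 0 (h₀ / (h₀ * k₀) ^ 2) (k₀ / (h₀ * k₀) ^ 2) 0 ∈ I :=
          mem_of_eq_mul H₀ (jt (1 / (h₀ * k₀) ^ 2) 0 0 0 0 0 0 0 0 0) (by
            rw [jt_mul]; apply jt_congr <;> ring)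
        have h1 : h₀ / (h₀ * k₀) ^ 2 * (k₀ ^ 2 * h₀) = 1 := by field_simp
        have h2 : k₀ / (h₀ * k₀) ^ 2 * (k₀ * h₀ ^ 2) = 1 := by field_simp
        refine mem_map_of_pull_eq hmem ?_
        rw [pull_linearDiffeo]
        apply jt_congr <;> first | ring1 | linear_combination h1

/-- Both axes are common zeros, so I is a subspace of the span of x²y and xy². Its dimension
decides, and for a line also whether the third factor of the form is new. -/
theorem isClassified_of_binomials {I : Ideal (JetRing 3 2)} (hQ : NoQuadratic I)
    (hC : ∀ g h k l, jt 0 0 0 0 0 0 g h k l ∈ I → g = 0 ∧ l = 0) : IsClassified I := by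
  have hform : ∀ a b c d e f g h k l, jt a b c d e f g h k l ∈ I →
      a = 0 ∧ b = 0 ∧ c = 0 ∧ d = 0 ∧ e = 0 ∧ f = 0 ∧ g = 0 ∧ l = 0 := by
    intro a b c d e f g h k l H
    obtain ⟨rfl, rfl, rfl, rfl, rfl, rfl⟩ := hQ _ _ _ _ _ _ _ _ _ _ H
    obtain ⟨rfl, rfl⟩ := hC _ _ _ _ H
    simp
  by_cases h0 : ∀ h k, jt 0 0 0 0 0 0 0 h k 0 ∈ I → h = 0 ∧ k = 0
  · refine isClassified_of_eq 0 (le_antisymm ?_ bot_le)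
    intro p hp
    obtain ⟨a, b, c, d, e, f, g, h, k, l, rfl⟩ := exists_jt p
    obtain ⟨rfl, rfl, rfl, rfl, rfl, rfl, rfl, rfl⟩ := hform _ _ _ _ _ _ _ _ _ _ hp
    obtain ⟨rfl, rfl⟩ := h0 _ _ hp
    rw [jt_zero]
    exact Ideal.zero_mem _
  push Not at h0
  obtain ⟨h₀, k₀, H₀, hne⟩ := h0
  by_cases hdep : ∀ h k, jt 0 0 0 0 0 0 0 h k 0 ∈ I → h * k₀ = k * h₀
  · exact isClassified_of_binomial_multiples hform H₀ hne hdep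
  · push Not at hdep
    obtain ⟨h₁, k₁, H₁, hdet⟩ := hdep
    rw [← sub_ne_zero] at hdet
    refine isClassified_of_eq 10 (le_antisymm ?_ ?_)
    · intro p hp
      obtain ⟨a, b, c, d, e, f, g, h, k, l, rfl⟩ := exists_jt p
      exact jt_mem_models_10.2 (hform _ _ _ _ _ _ _ _ _ _ hp)
    · rw [models_10_eq_span, Ideal.span_le, Set.insert_subset_iff, Set.singleton_subset_iff]
      constructor
      · refine mem_of_eq_mul_add_mul H₀ H₁ (jt (-k₁ / (h₁ * k₀ - k₁ * h₀)) 0 0 0 0 0 0 0 0 0)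
          (jt (k₀ / (h₁ * k₀ - k₁ * h₀)) 0 0 0 0 0 0 0 0 0) ?_
        simp only [jt_mul, jt_add]
        apply jt_congr <;> first | ring1 | grind
      · refine mem_of_eq_mul_add_mul H₀ H₁ (jt (h₁ / (h₁ * k₀ - k₁ * h₀)) 0 0 0 0 0 0 0 0 0)
          (jt (-h₀ / (h₁ * k₀ - k₁ * h₀)) 0 0 0 0 0 0 0 0 0) ?_
        simp only [jt_mul, jt_add]
        apply jt_congr <;> first | ring1 | grind

/-- The forms of I are x times quadratic forms. If they share another zero line, it is moved to the
x-axis. If not, every direction off the y-axis is repelled, and the multiplicity of the common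
factor x decides. -/
theorem isClassified_of_snd_axis {I : Ideal (JetRing 3 2)} (hI : IsSaturated I)
    (hQ : NoQuadratic I) (hC : ∀ g h k l, jt 0 0 0 0 0 0 g h k l ∈ I → l = 0) :
    IsClassified I := by
  have hform : ∀ a b c d e f g h k l, jt a b c d e f g h k l ∈ I →
      a = 0 ∧ b = 0 ∧ c = 0 ∧ d = 0 ∧ e = 0 ∧ f = 0 ∧ l = 0 := by
    intro a b c d e f g h k l H
    obtain ⟨rfl, rfl, rfl, rfl, rfl, rfl⟩ := hQ _ _ _ _ _ _ _ _ _ _ H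
    obtain rfl := hC _ _ _ _ H
    simp
  by_cases hz : ∃ v : Plane, v 0 ≠ 0 ∧ ∀ g h k, jt 0 0 0 0 0 0 g h k 0 ∈ I →
      cubicForm g h k 0 v = 0
  · obtain ⟨v, hv, hz⟩ := hz
    have hdet : v 0 * 1 - 0 * v 1 ≠ 0 := by simpa
    refine IsClassified.of_map (linearDiffeo _ _ _ _ hdet)
      (isClassified_of_binomials (hQ.map hdet) ?_)
    intro g h k l H
    obtain ⟨a', b', c', d', e', f', g', h', k', l', H', heq⟩ := exists_of_jt_mem_map H
    obtain ⟨rfl, rfl, rfl, rfl, rfl, rfl, rfl⟩ := hform _ _ _ _ _ _ _ _ _ _ H'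
    have h1 := hz _ _ _ H'
    rw [cubicForm] at h1
    rw [pull_linearDiffeo, jt_inj] at heq
    obtain ⟨-, -, -, -, -, -, h2, -, -, h3⟩ := heq
    constructor <;> linarith
  · push Not at hz
    have hrep : ∀ v : Plane, v 0 ≠ 0 → Repels I v := by
      intro v hv
      obtain ⟨g, h, k, H, hne⟩ := hz v hv
      exact repels_of_cubic H hne
    by_cases hk : ∀ g h k, jt 0 0 0 0 0 0 g h k 0 ∈ I → k = 0
    · by_cases hh : ∀ g h, jt 0 0 0 0 0 0 g h 0 0 ∈ I → h = 0
      · obtain ⟨g, h, k, H, hne⟩ := hz !₂[1, 0] (by simp)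
        obtain rfl := hk _ _ _ H
        obtain rfl := hh _ _ H
        have hg : g ≠ 0 := by simpa [cubicForm] using hne
        refine isClassified_of_eq 3 (le_antisymm ?_ ?_)
        · intro p hp
          obtain ⟨a, b, c, d, e, f, g, h, k, l, rfl⟩ := exists_jt p
          obtain ⟨rfl, rfl, rfl, rfl, rfl, rfl, rfl⟩ := hform _ _ _ _ _ _ _ _ _ _ hp
          obtain rfl := hk _ _ _ hp
          obtain rfl := hh _ _ hp
          exact jt_mem_models_3.2 ⟨rfl, rfl, rfl, rfl, rfl, rfl, rfl, rfl, rfl⟩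
        · rw [models_3_eq_span, Ideal.span_singleton_le_iff_mem]
          refine mem_of_eq_mul H (jt (1 / g) 0 0 0 0 0 0 0 0 0) ?_
          rw [jt_mul]
          apply jt_congr <;> first | ring1 | grind
      · push Not at hh
        obtain ⟨g₀, h₀, H₀, hh⟩ := hh
        -- The point is a zero of g₀x + h₀y, so a form not vanishing there is independent of the
        -- first one.
        obtain ⟨g, h, k, H, hne⟩ := hz !₂[h₀, -g₀] (by simpa)
        obtain rfl := hk _ _ _ H
        have hdet : g * h₀ - h * g₀ ≠ 0 := by
          intro h1
          apply hne
          simp only [cubicForm, Matrix.cons_val_zero, Matrix.cons_val_one]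
          linear_combination h₀ ^ 2 * h1
        refine isClassified_of_eq 11 (le_antisymm ?_ ?_)
        · intro p hp
          obtain ⟨a, b, c, d, e, f, g, h, k, l, rfl⟩ := exists_jt p
          obtain ⟨rfl, rfl, rfl, rfl, rfl, rfl, rfl⟩ := hform _ _ _ _ _ _ _ _ _ _ hp
          obtain rfl := hk _ _ _ hp
          exact jt_mem_models_11.2 ⟨rfl, rfl, rfl, rfl, rfl, rfl, rfl, rfl⟩
        · rw [models_11_eq_span, Ideal.span_le, Set.insert_subset_iff, Set.singleton_subset_iff]
          constructor
          · refine mem_of_eq_mul_add_mul H₀ H (jt (-h / (g * h₀ - h * g₀)) 0 0 0 0 0 0 0 0 0)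
              (jt (h₀ / (g * h₀ - h * g₀)) 0 0 0 0 0 0 0 0 0) ?_
            simp only [jt_mul, jt_add]
            apply jt_congr <;> first | ring1 | grind
          · refine mem_of_eq_mul_add_mul H₀ H (jt (g / (g * h₀ - h * g₀)) 0 0 0 0 0 0 0 0 0)
              (jt (-g₀ / (g * h₀ - h * g₀)) 0 0 0 0 0 0 0 0 0) ?_
            simp only [jt_mul, jt_add]
            apply jt_congr <;> first | ring1 | grind
    · push Not at hk
      obtain ⟨g, h, k, H, hk⟩ := hk
      -- Division of quadratic cofactors: the denominator gx² + hxy + ky² has k ≠ 0, so its zeros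
      -- avoid the y-axis and are repelled.
      have hmem : ∀ g' h' k', jt 0 0 0 0 0 0 g' h' k' 0 ∈ I := by
        intro g' h' k'
        refine hI.mem_of_mul_eq _ (jt_mem_jetsAtZero.2 rfl) _ H 2
          (fun v => g' * v 0 ^ 2 + h' * v 0 * v 1 + k' * v 1 ^ 2)
          (fun v => g * v 0 ^ 2 + h * v 0 * v 1 + k * v 1 ^ 2) (by fun_prop) (by fun_prop)
          ?_ ?_ ?_ ?_
        · intro t ht v
          simp only [PiLp.smul_apply, smul_eq_mul]
          ring
        · intro t ht v
          simp only [PiLp.smul_apply, smul_eq_mul]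
          ring
        · intro v
          simp only [jetEval_jt, cubicFun]
          ring
        · intro v hv hw
          refine hrep v fun h0 => ?_
          have h1 := (ne_zero_or_ne_zero hv).resolve_left (not_not.2 h0)
          rw [h0] at hw
          simp [hk, h1] at hw
      refine isClassified_of_eq 14 (le_antisymm ?_ ?_)
      · intro p hp
        obtain ⟨a, b, c, d, e, f, g, h, k, l, rfl⟩ := exists_jt p
        exact jt_mem_models_14.2 (hform _ _ _ _ _ _ _ _ _ _ hp)
      · intro p hp
        obtain ⟨a, b, c, d, e, f, g, h, k, l, rfl⟩ := exists_jt p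
        obtain ⟨rfl, rfl, rfl, rfl, rfl, rfl, rfl⟩ := jt_mem_models_14.1 hp
        exact hmem _ _ _

/-- An unrepelled direction is a common zero of all forms in I. A rotation with scaling, having it
as second column, makes every y³ coefficient vanish. -/
theorem isClassified_of_noQuadratic {I : Ideal (JetRing 3 2)} (hI : IsSaturated I)
    (hQ : NoQuadratic I) : IsClassified I := by
  obtain ⟨v, hv, hvR⟩ := hI.exists_not_repels hQ.noLinear
  have hdet : v 1 * v 1 - v 0 * -v 0 ≠ 0 := by
    have : v 1 * v 1 - v 0 * -v 0 = v 0 ^ 2 + v 1 ^ 2 := by ring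
    rw [this]
    rcases ne_zero_or_ne_zero hv with h | h <;> positivity
  refine IsClassified.of_map (linearDiffeo _ _ _ _ hdet)
    (isClassified_of_snd_axis (hI.map hdet) (hQ.map hdet) ?_)
  intro g h k l H
  obtain ⟨a', b', c', d', e', f', g', h', k', l', H', heq⟩ := exists_of_jt_mem_map H
  obtain ⟨rfl, rfl, rfl, rfl, rfl, rfl⟩ := hQ _ _ _ _ _ _ _ _ _ _ H'
  rw [pull_linearDiffeo, jt_inj] at heq
  obtain ⟨-, -, -, -, -, -, -, -, -, heq⟩ := heq
  rw [← heq]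
  by_contra hne
  exact hvR (repels_of_cubic H' hne)

theorem IsSaturated.isClassified {I : Ideal (JetRing 3 2)} (hI : IsSaturated I) :
    IsClassified I := by
  by_cases hN : NoLinear I
  · by_cases hQ : NoQuadratic I
    · exact isClassified_of_noQuadratic hI hQ
    · exact isClassified_of_quadratic hI hN hQ
  · unfold NoLinear at hN
    push Not at hN
    obtain ⟨a, b, c, d, e, f, g, h, k, l, H, hN⟩ := hN
    obtain rfl := jt_mem_jetsAtZero.1 (hI.le H)
    refine isClassified_of_linear_mem hI H ?_
    by_cases hb : b = 0
    · exact Or.inr (hN rfl hb)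
    · exact Or.inl hb

end ClosedJetIdeals

end

theorem theorem1p4 :
    (∀ I : Ideal (ClosedJetIdeals.JetRing 3 2), ClosedJetIdeals.IsClosedIdeal I →
      ∃ i : Fin 15, ClosedJetIdeals.Equivalent I (ClosedJetIdeals.models i)) ∧
    (∀ i : Fin 15, ∃ E : Set (EuclideanSpace ℝ (Fin 2)),
      ClosedJetIdeals.IsSemialgebraic E ∧ (0 : EuclideanSpace ℝ (Fin 2)) ∈ E ∧
      (ClosedJetIdeals.models i : Set (ClosedJetIdeals.JetRing 3 2)) =
        ClosedJetIdeals.vanishingJets 3 E) ∧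
    (∀ i j : Fin 15, i ≠ j →
      ¬ ClosedJetIdeals.Equivalent (ClosedJetIdeals.models i) (ClosedJetIdeals.models j)) :=
  ⟨fun _ hI => hI.isSaturated.isClassified, ClosedJetIdeals.isRealizable_models,
    fun _ _ hij => ClosedJetIdeals.not_equivalent_models hij⟩
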